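/- Let $Q$ be a finite group, let $S$ be a finite-dimensional semisimple algebra over $\mathbb{C}$, let $I_S$ be the set of isomorphism classes of simple $S$-modules, and choose a representative $V_i\in i$ for every $i\in I_S$. A \emph{$Q$-extension} of $S$ is a strongly $Q$-graded $\mathbb{C}$-algebra $R=\bigoplus_{q\in Q}R_q$ (so $R_pR_q=R_{pq}$) with $R_1=S$; an isomorphism of $Q$-extensions is an isomorphism of graded algebras that is the identity on $S$. For an action $\rho$ of $Q$ on the set $I_S$, the extension $R$ \emph{has band} $\rho$ if for all $q\in Q$ and all simple $S$-modules $V$ the $S$-module $R_q\otimes_S V$ is simple of class $\rho(q)[V]$. Let $Q\ltimes I_S$ be the action groupoid of $\rho$, with arrows $q:i\to\rho(q)i$. An \emph{$S^1$-gerbe} on $Q\ltimes I_S$ is a $\mathbb{C}^\times$-central extension of this groupoid: a groupoid with the same objects, a functor from it to $Q\ltimes I_S$ that is the identity on objects and surjective on arrows, and an action of $\mathbb{C}^\times$ on its arrows that is compatible with composition and simply transitive on the fibres over the arrows of $Q\ltimes I_S$; isomorphisms of gerbes are isomorphisms of such extensions (identity on $Q\ltimes I_S$ and on $\mathbb{C}^\times$).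 An \emph{$S^1$-twisted representation} of a gerbe is a functor from it to finite-dimensional complex vector spaces that sends $c\cdot f$ to $c$ times the image of $f$, for all $c\in\mathbb{C}^\times$ and all arrows $f$. Then, for every action $\rho$ of $Q$ on $I_S$, there is a bijection between isomorphism classes of $Q$-extensions $R$ of $S$ with band $\rho$ and isomorphism classes of $S^1$-gerbes $\widehat{Q\ltimes I_S}$ on $Q\ltimes I_S$. It sends the class of $R$ to the class of the gerbe whose arrows over $q:i\to j=\rho(q)i$ are the nonzero elements of the line $\mathrm{Hom}_S(V_j,R_q\otimes_S V_i)$, where the composite of $f$ over $q:i\to j$ with $g$ over $p:j\to k$ is $V_k\xrightarrow{\,g\,}R_p\otimes_S V_j\xrightarrow{\,1\otimes f\,}R_p\otimes_S R_q\otimes_S V_i\to R_{pq}\otimes_S V_i$, the last map being multiplication in $R$. Furthermore, whenever $R$ corresponds to $\widehat{Q\ltimes I_S}$, the category $R\text{-mod}$ of finite-dimensional $R$-modules and the category $\mathrm{Rep}'\,\widehat{Q\ltimes I_S}$ of $S^1$-twisted representations are equivalent as ($\mathbb{C}$-linear) abelian categories. -/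

import Mathlib

open CategoryTheory
open scoped TensorProduct

universe u v w

/-! ### Isomorphism classes of simple modules -/

/-- The simple (left) modules over a ring. -/
abbrev SimpleMod (S : Type u) [Ring S] : Type (u + 1) :=
  {V : ModuleCat.{u} S // IsSimpleModule S V}

/-- Isomorphism of simple modules. -/
instance simpleModSetoid (S : Type u) [Ring S] : Setoid (SimpleMod S) where
  r V W := Nonempty (V.1 ≃ₗ[S] W.1)
  iseqv :=
    { refl := fun V => ⟨LinearEquiv.refl S V.1⟩
      symm := fun ⟨e⟩ => ⟨e.symm⟩
      trans := fun ⟨e⟩ ⟨f⟩ => ⟨e.trans f⟩ }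

/-- `I_S`, the set of isomorphism classes of simple `S`-modules. -/
def SimpleClass (S : Type u) [Ring S] : Type (u + 1) :=
  Quotient (simpleModSetoid S)

/-- The isomorphism class of a simple module. -/
def SimpleMod.toClass {S : Type u} [Ring S] (V : SimpleMod S) : SimpleClass S :=
  Quotient.mk _ V

/-! ### Tensor products over a noncommutative ring -/

section Balanced

variable (S : Type u) [Ring S]
  (M : Type v) [AddCommGroup M] [Module S M] [Module Sᵐᵒᵖ M]
  (N : Type w) [AddCommGroup N] [Module S N]

/-- The `S`-submodule of `M ⊗_ℤ N` spanned by the elements `(m s) ⊗ n - m ⊗ (s n)`. Since these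
elements are stable under the left action of `S`, it is also the subgroup that they generate. -/
def balancedRel : Submodule S (M ⊗[ℤ] N) :=
  Submodule.span S
    {t | ∃ (m : M) (s : S) (n : N), t = (MulOpposite.op s • m) ⊗ₜ[ℤ] n - m ⊗ₜ[ℤ] (s • n)}

/-- The tensor product `M ⊗_S N` of an `S`-bimodule `M` with a left `S`-module `N`. -/
abbrev BalancedTensor : Type (max v w) :=
  (M ⊗[ℤ] N) ⧸ balancedRel S M N

variable {M N}

/-- The class of `m ⊗ n` in `M ⊗_S N`. -/
def balancedTmul (m : M) (n : N) : BalancedTensor S M N :=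
  (balancedRel S M N).mkQ (m ⊗ₜ[ℤ] n)

variable {S}

/-- Additive maps out of `M ⊗_S N` from balanced biadditive maps. -/
def balancedLift [SMulCommClass S Sᵐᵒᵖ M] {A : Type*} [AddCommGroup A] (f : M →+ N →+ A)
    (hf : ∀ (m : M) (s : S) (n : N), f (MulOpposite.op s • m) n = f m (s • n)) :
    BalancedTensor S M N →+ A :=
  QuotientAddGroup.lift (balancedRel S M N).toAddSubgroup
    (TensorProduct.liftAddHom f (fun r m n => by simp)) (by
      intro x hx
      have key : ∀ s : S, TensorProduct.liftAddHom f (fun r m n => by simp) (s • x) = 0 := by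
        refine Submodule.span_induction (p := fun x _ => ∀ s : S,
          TensorProduct.liftAddHom f (fun r m n => by simp) (s • x) = 0) ?_ ?_ ?_ ?_ hx
        · rintro _ ⟨m, t, n, rfl⟩ s
          rw [smul_sub, TensorProduct.smul_tmul', TensorProduct.smul_tmul', smul_comm, map_sub,
            TensorProduct.liftAddHom_tmul, TensorProduct.liftAddHom_tmul, hf, sub_self]
        · intro s
          rw [smul_zero, map_zero]
        · intro x y _ _ h₁ h₂ s
          rw [smul_add, map_add, h₁, h₂, add_zero]
        · intro t x _ h s
          rw [smul_smul]
          exact h _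
      simpa using key 1)

@[simp]
theorem balancedLift_tmul [SMulCommClass S Sᵐᵒᵖ M] {A : Type*} [AddCommGroup A] (f : M →+ N →+ A)
    (hf : ∀ (m : M) (s : S) (n : N), f (MulOpposite.op s • m) n = f m (s • n)) (m : M) (n : N) :
    balancedLift f hf (balancedTmul S m n) = f m n :=
  rfl

@[elab_as_elim]
theorem balancedTensor_induction {p : BalancedTensor S M N → Prop} (t : BalancedTensor S M N)
    (h0 : p 0) (hm : ∀ m n, p (balancedTmul S m n)) (ha : ∀ x y, p x → p y → p (x + y)) : p t := by
  obtain ⟨t, rfl⟩ := (balancedRel S M N).mkQ_surjective t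
  induction t using TensorProduct.induction_on with
  | zero => rwa [map_zero]
  | tmul m n => exact hm m n
  | add x y hx hy => rw [map_add]; exact ha _ _ hx hy

theorem balancedTmul_add_left (m m' : M) (n : N) :
    balancedTmul S (m + m') n = balancedTmul S m n + balancedTmul S m' n := by
  simp [balancedTmul, TensorProduct.add_tmul]

theorem balancedTmul_add_right (m : M) (n n' : N) :
    balancedTmul S m (n + n') = balancedTmul S m n + balancedTmul S m n' := by
  simp [balancedTmul, TensorProduct.tmul_add]

theorem balancedTmul_smul (m : M) (s : S) (n : N) :
    balancedTmul S (MulOpposite.op s • m) n = balancedTmul S m (s • n) := by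
  refine (Submodule.Quotient.eq _).2 (Submodule.subset_span ⟨m, s, n, rfl⟩)

theorem smul_balancedTmul (s : S) (m : M) (n : N) :
    s • balancedTmul S m n = balancedTmul S (s • m) n :=
  rfl

end Balanced

/-! ### Extensions of algebras by a group -/

/-- A `Q`-extension of the `ℂ`-algebra `S`: a strongly `Q`-graded `ℂ`-algebra
`R = ⨁ q, R_q` (so `R_p R_q = R_{pq}`) whose identity component is `S`. -/
structure QExtension (Q S : Type u) [Group Q] [Ring S] [Algebra ℂ S] where
  /-- the underlying algebra `R` -/
  carrier : Type u
  [ring : Ring carrier]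
  [algebra : Algebra ℂ carrier]
  /-- the homogeneous components `R_q` -/
  grade : Q → Submodule ℂ carrier
  /-- the sum of the components is direct -/
  grade_indep : iSupIndep grade
  /-- the components span `R` -/
  grade_iSup : ⨆ q, grade q = ⊤
  /-- the grading is strong -/
  grade_mul : ∀ p q, grade p * grade q = grade (p * q)
  /-- the identification of `S` with the identity component -/
  incl : S →ₐ[ℂ] carrier
  incl_injective : Function.Injective incl
  incl_range : LinearMap.range incl.toLinearMap = grade 1

namespace QExtension

variable {Q S : Type u} [Group Q] [Ring S] [Algebra ℂ S]

attribute [instance] ring algebra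

/-- An isomorphism of `Q`-extensions of `S`: an isomorphism of graded algebras which is the
identity on `S`. -/
structure Iso (R R' : QExtension Q S) where
  /-- the underlying isomorphism of algebras -/
  toAlgEquiv : R.carrier ≃ₐ[ℂ] R'.carrier
  map_grade : ∀ q, (R.grade q).map toAlgEquiv.toLinearMap = R'.grade q
  map_incl : ∀ s, toAlgEquiv (R.incl s) = R'.incl s

variable (R : QExtension Q S)

theorem mul_mem {p q : Q} {a b : R.carrier} (ha : a ∈ R.grade p) (hb : b ∈ R.grade q) :
    a * b ∈ R.grade (p * q) :=
  R.grade_mul p q ▸ Submodule.mul_mem_mul ha hb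

theorem incl_mem (s : S) : R.incl s ∈ R.grade 1 :=
  R.incl_range ▸ LinearMap.mem_range_self R.incl.toLinearMap s

/-- `S` acts on `R_q` by multiplication on the left. -/
instance gradeLeft (q : Q) : Module S (R.grade q) where
  smul s r := ⟨R.incl s * r, by simpa using R.mul_mem (R.incl_mem s) r.2⟩
  one_smul r := Subtype.ext (by change R.incl 1 * (r : R.carrier) = r; simp)
  mul_smul s t r := Subtype.ext (by
    change R.incl (s * t) * (r : R.carrier) = R.incl s * (R.incl t * r)
    simp [mul_assoc])
  smul_zero s := Subtype.ext (by change R.incl s * 0 = 0; simp)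
  smul_add s r r' := Subtype.ext (mul_add (R.incl s) (r : R.carrier) r')
  add_smul s t r := Subtype.ext (by
    change R.incl (s + t) * (r : R.carrier) = R.incl s * r + R.incl t * r
    simp [add_mul])
  zero_smul r := Subtype.ext (by change R.incl 0 * (r : R.carrier) = 0; simp)

/-- `S` acts on `R_q` by multiplication on the right. -/
instance gradeRight (q : Q) : Module Sᵐᵒᵖ (R.grade q) where
  smul s r := ⟨r * R.incl s.unop, by simpa using R.mul_mem r.2 (R.incl_mem s.unop)⟩
  one_smul r := Subtype.ext (by change (r : R.carrier) * R.incl 1 = r; simp)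
  mul_smul s t r := Subtype.ext (by
    change (r : R.carrier) * R.incl (t.unop * s.unop) = (r * R.incl t.unop) * R.incl s.unop
    simp [mul_assoc])
  smul_zero s := Subtype.ext (by change 0 * R.incl s.unop = 0; simp)
  smul_add s r r' := Subtype.ext (add_mul (r : R.carrier) r' (R.incl s.unop))
  add_smul s t r := Subtype.ext (by
    change (r : R.carrier) * R.incl (s.unop + t.unop) = r * R.incl s.unop + r * R.incl t.unop
    simp [mul_add])
  zero_smul r := Subtype.ext (by change (r : R.carrier) * R.incl 0 = 0; simp)

instance gradeBimodule (q : Q) : SMulCommClass S Sᵐᵒᵖ (R.grade q) where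
  smul_comm s t r := Subtype.ext (mul_assoc (R.incl s) (r : R.carrier) (R.incl t.unop)).symm

/-- `R_q ⊗_S V`. -/
abbrev act (q : Q) (V : Type u) [AddCommGroup V] [Module S V] : Type u :=
  BalancedTensor S (R.grade q) V

/-- The extension `R` has band the given action of `Q` on `I_S`: for every `q ∈ Q` and every simple
`S`-module `V`, the `S`-module `R_q ⊗_S V` is simple of class `q • [V]`. -/
def HasBand [MulAction Q (SimpleClass S)] : Prop :=
  ∀ (q : Q) (V : SimpleMod S),
    ∃ W : SimpleMod S, W.toClass = q • V.toClass ∧ Nonempty (R.act q V.1 ≃ₗ[S] W.1)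

/-- Left multiplication by `r ∈ R_p`, as a map `R_q ⊗_S V → R_{pq} ⊗_S V`,
`r' ⊗ v ↦ (r r') ⊗ v`. -/
def leftMul (p q : Q) (V : Type u) [AddCommGroup V] [Module S V] (r : R.grade p) :
    R.act q V →+ R.act (p * q) V :=
  balancedLift
    (AddMonoidHom.mk' (fun r' : R.grade q => AddMonoidHom.mk'
        (fun v : V => balancedTmul S (⟨r * r', R.mul_mem r.2 r'.2⟩ : R.grade (p * q)) v)
        (fun v v' => balancedTmul_add_right _ v v'))
      (fun a b => AddMonoidHom.ext fun v => by
        refine Eq.trans (congrArg (fun x => balancedTmul S x v) ?_) (balancedTmul_add_left _ _ v)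
        exact Subtype.ext (mul_add (r : R.carrier) a b)))
    (fun a s v => by
      refine Eq.trans (congrArg (fun x => balancedTmul S x v) ?_) (balancedTmul_smul _ s v)
      exact Subtype.ext (mul_assoc (r : R.carrier) a (R.incl s)).symm)

@[simp]
theorem leftMul_tmul (p q : Q) (V : Type u) [AddCommGroup V] [Module S V] (r : R.grade p)
    (r' : R.grade q) (v : V) :
    R.leftMul p q V r (balancedTmul S r' v) =
      balancedTmul S (⟨r * r', R.mul_mem r.2 r'.2⟩ : R.grade (p * q)) v :=
  rfl

theorem leftMul_add (p q : Q) (V : Type u) [AddCommGroup V] [Module S V] (a b : R.grade p)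
    (t : R.act q V) :
    R.leftMul p q V (a + b) t = R.leftMul p q V a t + R.leftMul p q V b t := by
  induction t using balancedTensor_induction with
  | h0 => rw [map_zero, map_zero, map_zero, add_zero]
  | hm m n =>
    rw [leftMul_tmul, leftMul_tmul, leftMul_tmul, ← balancedTmul_add_left]
    exact congrArg (fun x => balancedTmul S x n) (Subtype.ext (add_mul (a : R.carrier) b m))
  | ha x y hx hy => rw [map_add, map_add, map_add, hx, hy]; exact add_add_add_comm _ _ _ _

theorem leftMul_op_smul (p q : Q) (V : Type u) [AddCommGroup V] [Module S V] (a : R.grade p)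
    (s : S) (t : R.act q V) :
    R.leftMul p q V (MulOpposite.op s • a) t = R.leftMul p q V a (s • t) := by
  induction t using balancedTensor_induction with
  | h0 => rw [smul_zero, map_zero, map_zero]
  | hm m n =>
    rw [smul_balancedTmul, leftMul_tmul, leftMul_tmul]
    exact congrArg (fun x => balancedTmul S x n)
      (Subtype.ext (mul_assoc (a : R.carrier) (R.incl s) m))
  | ha x y hx hy => rw [map_add, smul_add, map_add, hx, hy]

theorem leftMul_smul (p q : Q) (V : Type u) [AddCommGroup V] [Module S V] (a : R.grade p)
    (s : S) (t : R.act q V) :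
    R.leftMul p q V (s • a) t = s • R.leftMul p q V a t := by
  induction t using balancedTensor_induction with
  | h0 => rw [map_zero, map_zero, smul_zero]
  | hm m n =>
    rw [leftMul_tmul, leftMul_tmul, smul_balancedTmul]
    exact congrArg (fun x => balancedTmul S x n)
      (Subtype.ext (mul_assoc (R.incl s) (a : R.carrier) m))
  | ha x y hx hy => rw [map_add, map_add, smul_add, hx, hy]

/-- The biadditive map `(r, w) ↦ r · h w` behind `QExtension.extend`. -/
def extendAux (p q : Q) {V W : Type u} [AddCommGroup V] [Module S V] [AddCommGroup W] [Module S W]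
    (h : W →ₗ[S] R.act q V) : R.act p W →+ R.act (p * q) V :=
  balancedLift
    (AddMonoidHom.mk' (fun r : R.grade p => (R.leftMul p q V r).comp h.toAddMonoidHom)
      (fun a b => AddMonoidHom.ext fun w => R.leftMul_add p q V a b (h w)))
    (fun a s w => (R.leftMul_op_smul p q V a s (h w)).trans
      (congrArg (R.leftMul p q V a) (h.map_smul s w).symm))

theorem extendAux_tmul (p q : Q) {V W : Type u} [AddCommGroup V] [Module S V] [AddCommGroup W]
    [Module S W] (h : W →ₗ[S] R.act q V) (r : R.grade p) (x : W) :
    R.extendAux p q h (balancedTmul S r x) = R.leftMul p q V r (h x) :=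
  rfl

/-- For an `S`-linear map `h : W → R_q ⊗_S V`, the composite
`R_p ⊗_S W → R_p ⊗_S (R_q ⊗_S V) → R_{pq} ⊗_S V`, that is `r ⊗ w ↦ r · h w`. -/
def extend (p q : Q) {V W : Type u} [AddCommGroup V] [Module S V] [AddCommGroup W] [Module S W]
    (h : W →ₗ[S] R.act q V) : R.act p W →ₗ[S] R.act (p * q) V where
  toFun := R.extendAux p q h
  map_add' := map_add _
  map_smul' s t := by
    rw [RingHom.id_apply]
    induction t using balancedTensor_induction with
    | h0 => rw [smul_zero, map_zero, smul_zero]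
    | hm m n => rw [smul_balancedTmul, extendAux_tmul, extendAux_tmul, leftMul_smul]
    | ha x y hx hy => rw [smul_add, map_add, map_add, smul_add, hx, hy]

theorem extend_tmul (p q : Q) {V W : Type u} [AddCommGroup V] [Module S V] [AddCommGroup W]
    [Module S W] (h : W →ₗ[S] R.act q V) (r : R.grade p) (x : W) :
    R.extend p q h (balancedTmul S r x) = R.leftMul p q V r (h x) :=
  rfl

end QExtension

/-- Isomorphism of `Q`-extensions of `S` with the given band. -/
instance bandedExtensionSetoid (Q S : Type u) [Group Q] [Ring S] [Algebra ℂ S]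
    [MulAction Q (SimpleClass S)] : Setoid {R : QExtension Q S // R.HasBand} where
  r R R' := Nonempty (QExtension.Iso R.1 R'.1)
  iseqv :=
    { refl := fun R => ⟨⟨AlgEquiv.refl, fun q => Submodule.map_id _, fun _ => rfl⟩⟩
      symm := fun {R R'} ⟨e⟩ => ⟨⟨e.toAlgEquiv.symm, fun q => by
        rw [← e.map_grade q, ← Submodule.map_comp]
        convert Submodule.map_id _
        ext x
        simp, fun s => by rw [← e.map_incl s, AlgEquiv.symm_apply_apply]⟩⟩
      trans := fun {R R' R''} ⟨e⟩ ⟨f⟩ => ⟨⟨e.toAlgEquiv.trans f.toAlgEquiv, fun q => by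
        rw [← f.map_grade q, ← e.map_grade q, ← Submodule.map_comp]
        rfl, fun s => by rw [AlgEquiv.trans_apply, e.map_incl, f.map_incl]⟩⟩ }

/-- Isomorphism classes of `Q`-extensions of `S` with the given band. -/
def BandedExtensionClass (Q S : Type u) [Group Q] [Ring S] [Algebra ℂ S]
    [MulAction Q (SimpleClass S)] : Type (u + 1) :=
  Quotient (bandedExtensionSetoid Q S)

/-! ### Central extensions of groupoids and their twisted representations -/

/-- An `S¹`-gerbe on the groupoid `Γ`, that is a `ℂˣ`-central extension of `Γ`: a category with the
same objects as `Γ`, a functor `proj` to `Γ` which is the identity on objects and surjective on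
arrows, and an action of `ℂˣ` on the arrows which is compatible with composition and simply
transitive on the fibres of `proj`. All arrows are then invertible, see `SOneGerbe.exists_inv`. -/
structure SOneGerbe (Γ : Type w) [Groupoid.{v} Γ] where
  /-- the arrows of the extension -/
  Hom : Γ → Γ → Type u
  /-- identity arrows -/
  id : ∀ x, Hom x x
  /-- composition, in diagrammatic order -/
  comp : ∀ {x y z}, Hom x y → Hom y z → Hom x z
  id_comp : ∀ {x y} (f : Hom x y), comp (id x) f = f
  comp_id : ∀ {x y} (f : Hom x y), comp f (id y) = f
  assoc : ∀ {x y z t} (f : Hom x y) (g : Hom y z) (h : Hom z t),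
    comp (comp f g) h = comp f (comp g h)
  /-- the functor to `Γ` -/
  proj : ∀ {x y}, Hom x y → (x ⟶ y)
  proj_id : ∀ x, proj (id x) = 𝟙 x
  proj_comp : ∀ {x y z} (f : Hom x y) (g : Hom y z), proj (comp f g) = proj f ≫ proj g
  proj_surjective : ∀ x y, Function.Surjective (proj : Hom x y → (x ⟶ y))
  /-- the action of `ℂˣ` on the arrows -/
  [mulAction : ∀ x y, MulAction ℂˣ (Hom x y)]
  smul_comp : ∀ {x y z} (c : ℂˣ) (f : Hom x y) (g : Hom y z), comp (c • f) g = c • comp f g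
  comp_smul : ∀ {x y z} (c : ℂˣ) (f : Hom x y) (g : Hom y z), comp f (c • g) = c • comp f g
  proj_smul : ∀ {x y} (c : ℂˣ) (f : Hom x y), proj (c • f) = proj f
  existsUnique_smul : ∀ {x y} (f g : Hom x y), proj f = proj g → ∃! c : ℂˣ, c • f = g

namespace SOneGerbe

variable {Γ : Type w} [Groupoid.{v} Γ]

attribute [instance] mulAction

/-- Every arrow of an `S¹`-gerbe is invertible. -/
theorem exists_inv (G : SOneGerbe.{u} Γ) {x y : Γ} (f : G.Hom x y) :
    ∃ g : G.Hom y x, G.comp f g = G.id x ∧ G.comp g f = G.id y := by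
  have right : ∀ {x y : Γ} (f : G.Hom x y), ∃ g : G.Hom y x, G.comp f g = G.id x := by
    intro x y f
    obtain ⟨g, hg⟩ := G.proj_surjective y x (Groupoid.inv (G.proj f))
    obtain ⟨c, hc, -⟩ := G.existsUnique_smul (G.comp f g) (G.id x) (by
      rw [G.proj_comp, hg, G.proj_id, Groupoid.comp_inv])
    exact ⟨c • g, by rw [G.comp_smul]; exact hc⟩
  obtain ⟨g, hg⟩ := right f
  obtain ⟨k, hk⟩ := right g
  have : f = k := by rw [← G.comp_id f, ← hk, ← G.assoc, hg, G.id_comp]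
  exact ⟨g, hg, this ▸ hk⟩

/-- An isomorphism of `S¹`-gerbes on `Γ`: an isomorphism of central extensions, the identity on
`Γ` and `ℂˣ`. -/
structure Iso (G G' : SOneGerbe.{u} Γ) where
  /-- the bijection on arrows -/
  equiv : ∀ x y, G.Hom x y ≃ G'.Hom x y
  map_comp : ∀ {x y z} (f : G.Hom x y) (g : G.Hom y z),
    equiv x z (G.comp f g) = G'.comp (equiv x y f) (equiv y z g)
  map_proj : ∀ {x y} (f : G.Hom x y), G'.proj (equiv x y f) = G.proj f
  map_smul : ∀ {x y} (c : ℂˣ) (f : G.Hom x y), equiv x y (c • f) = c • equiv x y f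

/-- The total category of the gerbe: the objects of `Γ`, with the arrows of the extension. -/
def Total (_G : SOneGerbe.{u} Γ) : Type w :=
  Γ

instance (G : SOneGerbe.{u} Γ) : Category.{u} G.Total where
  Hom x y := G.Hom x y
  id x := G.id x
  comp f g := G.comp f g
  id_comp f := G.id_comp f
  comp_id f := G.comp_id f
  assoc f g h := G.assoc f g h

/-- A functor from the gerbe to finite-dimensional vector spaces is an `S¹`-twisted
representation if each `c ∈ ℂˣ` acts as multiplication by `c`. -/
def isTwisted (G : SOneGerbe.{u} Γ) : ObjectProperty (G.Total ⥤ FGModuleCat.{u} ℂ) :=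
  fun F => ∀ (x y : Γ) (c : ℂˣ) (f : G.Hom x y) (m : F.obj x),
    (F.map (X := x) (Y := y) (c • f)).hom.hom m =
      (c : ℂ) • (F.map (X := x) (Y := y) f).hom.hom m

/-- The category of (finite-dimensional) `S¹`-twisted representations of the gerbe. -/
abbrev TwistedRep (G : SOneGerbe.{u} Γ) :=
  G.isTwisted.FullSubcategory

end SOneGerbe

/-- Isomorphism of `S¹`-gerbes on `Γ`. -/
instance sOneGerbeSetoid (Γ : Type w) [Groupoid.{v} Γ] : Setoid (SOneGerbe.{u} Γ) where
  r G G' := Nonempty (SOneGerbe.Iso G G')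
  iseqv :=
    { refl := fun G => ⟨⟨fun _ _ => Equiv.refl _, fun _ _ => rfl, fun _ => rfl, fun _ _ => rfl⟩⟩
      symm := fun {G G'} ⟨e⟩ => ⟨⟨fun x y => (e.equiv x y).symm,
        fun f g => by rw [Equiv.symm_apply_eq, e.map_comp]; simp,
        fun f => by rw [← e.map_proj, Equiv.apply_symm_apply],
        fun c f => by rw [Equiv.symm_apply_eq, e.map_smul]; simp⟩⟩
      trans := fun {G G' G''} ⟨e⟩ ⟨e'⟩ => ⟨⟨fun x y => (e.equiv x y).trans (e'.equiv x y),
        fun f g => by simp [e.map_comp, e'.map_comp],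
        fun f => by simp [e.map_proj, e'.map_proj],
        fun c f => by simp [e.map_smul, e'.map_smul]⟩⟩ }

/-- Isomorphism classes of `S¹`-gerbes on `Γ`. -/
def SOneGerbeClass (Γ : Type w) [Groupoid.{v} Γ] :=
  Quotient (sOneGerbeSetoid.{u} Γ)

/-! ### The gerbe of an extension -/

/-- An identification of the gerbe `G` on the action groupoid `Q ⋉ I_S` with the gerbe of the
`Q`-extension `R` formed with the representatives `V i ∈ i`: the arrows of `G` over
`q : i → j = q • i` are the nonzero vectors of the line `Hom_S(V j, R_q ⊗_S V i)`, with `ℂˣ` acting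
by scalars, and the composition of `f` over `q : i → j` with `g` over `p : j → k` is
`V k → R_p ⊗_S V j → R_p ⊗_S R_q ⊗_S V i → R_{pq} ⊗_S V i`. -/
structure GerbeIdentification {Q S : Type u} [Group Q] [Ring S] [Algebra ℂ S]
    [MulAction Q (SimpleClass S)] (V : SimpleClass S → SimpleMod S) (R : QExtension Q S)
    (G : SOneGerbe.{u} (ActionCategory Q (SimpleClass S))) where
  /-- the bijection of the fibres of `G` with the punctured lines -/
  equiv : ∀ (x y : ActionCategory Q (SimpleClass S)) (q : Q),
    {f : G.Hom x y // (G.proj f).val = q} ≃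
      {h : (V y.back).1 →ₗ[S] R.act q (V x.back).1 // h ≠ 0}
  equiv_smul : ∀ (x y : ActionCategory Q (SimpleClass S)) (q : Q) (c : ℂˣ)
    (f f' : {f : G.Hom x y // (G.proj f).val = q}), f'.1 = c • f.1 →
      ∀ v, (equiv x y q f').1 v = algebraMap ℂ S c • (equiv x y q f).1 v
  equiv_comp : ∀ (x y z : ActionCategory Q (SimpleClass S)) (p q : Q)
    (f : {f : G.Hom x y // (G.proj f).val = q}) (g : {g : G.Hom y z // (G.proj g).val = p})
    (k : {k : G.Hom x z // (G.proj k).val = p * q}), k.1 = G.comp f.1 g.1 →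
      (equiv x z (p * q) k).1 = R.extend p q (equiv x y q f).1 ∘ₗ (equiv y z p g).1

/-! A nonzero element of the line `Hom_S(V_j, R_q ⊗_S V_i)` is an isomorphism of simple modules. Its
inverse `R_q ⊗_S V_i → V_j` amounts to an operator `V_i → V_j` for every `r ∈ R_q`, compatible with
`S` on both sides. The proof works with these operators throughout. A `GerbeModel` attaches to each
arrow `f` of a gerbe `G` operators `map f r`, multiplicative along composition and with `map (c • f)
= c⁻¹ • map f`; the inverse scalar comes from the passage to inverses. By `toIdentification` and
`toModel`, a model relating `R` and `G` is the same thing as an identification of `G` with the gerbe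
of `R`.

A model determines each side from the other. Since `S` is the product of the algebras `End V_i` and
`R_q R_{q⁻¹}` contains `1`, the operators identify `R_q` with the product over `i` of the spaces
`Hom(V_i, V_{q i})` (`eq_zero`, `exists_mem_map_eq`); hence the extension is unique
(`nonempty_extensionIso`). By Schur's lemma the bimodule maps `R_q → Hom(V_i, V_j)` form a line
(`exists_eq_smul`), hence the gerbe is unique (`nonempty_gerbeIso`). For existence, a banded
extension yields the gerbe whose arrows are the nonzero operator families themselves
(`operatorGerbe`), and a gerbe yields the convolution algebra of equivariant operator-valued
functions on its arrows (`convolutionExtension`).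

For modules, a model lets the gerbe act on the spaces `Hom_S(V_x, M)` by `(f φ)(map f r v) = r
φ(v)`, where the scalar `c` appears because `map (c • f)` carries `c⁻¹`. In the other direction `R`
acts on the sum of the `V_x ⊗ E_x` by `map f r ⊗ E(f)`, where the two scalars cancel. Every
`R`-module is the sum of its parts `V_x ⊗ Hom_S(V_x, M)`, which gives full faithfulness; essential
surjectivity is `coinduced_bijective`. -/

set_option linter.unusedSectionVars false

/-! ### Complete families of simple modules -/

/-- The scalars act `ℂ`-linearly on a module over a `ℂ`-algebra. -/
def actionHom (S : Type u) [Ring S] [Algebra ℂ S] (V : Type v) [AddCommGroup V] [Module S V]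
    [Module ℂ V] [IsScalarTower ℂ S V] : S →ₐ[ℂ] Module.End ℂ V :=
  Algebra.lsmul ℂ ℂ V

@[simp]
theorem actionHom_apply {S : Type u} [Ring S] [Algebra ℂ S] {V : Type v} [AddCommGroup V]
    [Module S V] [Module ℂ V] [IsScalarTower ℂ S V] (s : S) (v : V) :
    actionHom S V s v = s • v :=
  rfl

/-- A family of finite-dimensional simple `S`-modules such that `S` is the product of their
endomorphism algebras. -/
class IsSimpleFamily (S : Type u) [Ring S] [Algebra ℂ S] {X : Type w} (V : X → Type v)
    [∀ x, AddCommGroup (V x)] [∀ x, Module S (V x)] [∀ x, Module ℂ (V x)]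
    [∀ x, IsScalarTower ℂ S (V x)] : Prop where
  simple : ∀ x, IsSimpleModule S (V x)
  finite : ∀ x, FiniteDimensional ℂ (V x)
  bijective : Function.Bijective fun (s : S) (x : X) => actionHom S (V x) s

/-- Schur's lemma for finite-dimensional simple modules over a `ℂ`-algebra. -/
theorem exists_smul_of_isSimpleModule {S : Type u} [Ring S] [Algebra ℂ S] {V : Type v}
    [AddCommGroup V] [Module S V] [Module ℂ V] [IsScalarTower ℂ S V] [IsSimpleModule S V]
    [FiniteDimensional ℂ V] (T : V →ₗ[S] V) : ∃ c : ℂ, ∀ v, T v = c • v := by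
  have : Nontrivial V := IsSimpleModule.nontrivial S V
  obtain ⟨c, hc⟩ := Module.End.exists_eigenvalue (T.restrictScalars ℂ)
  obtain ⟨v, hv⟩ := hc.exists_hasEigenvector
  refine ⟨c, fun w => ?_⟩
  have hv' : T v = c • v := hv.apply_eq_smul
  -- The eigenvector generates the simple module, so its eigenvalue governs every vector.
  obtain ⟨s, rfl⟩ := IsSimpleModule.toSpanSingleton_surjective S hv.2 w
  rw [LinearMap.toSpanSingleton_apply, map_smul, hv']
  exact (actionHom S V s).map_smul c v

namespace IsSimpleFamily

variable {S : Type u} [Ring S] [Algebra ℂ S] {X : Type w} (V : X → Type v)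
  [∀ x, AddCommGroup (V x)] [∀ x, Module S (V x)] [∀ x, Module ℂ (V x)]
  [∀ x, IsScalarTower ℂ S (V x)]

theorem ext [hV : IsSimpleFamily S V] {s t : S} (h : ∀ x (v : V x), s • v = t • v) : s = t :=
  hV.bijective.1 (funext fun x => LinearMap.ext (h x))

variable (S)

theorem nontrivial [hV : IsSimpleFamily S V] (x : X) : Nontrivial (V x) :=
  have := hV.simple x
  IsSimpleModule.nontrivial S (V x)

open Classical in
/-- The element of `S` that acts as `T` on `V x` and as zero on the other members. -/
noncomputable def unit [hV : IsSimpleFamily S V] (x : X) (T : Module.End ℂ (V x)) : S :=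
  (hV.bijective.2 (Function.update 0 x T)).choose

theorem unit_smul [hV : IsSimpleFamily S V] (x : X) (T : Module.End ℂ (V x)) (v : V x) :
    unit S V x T • v = T v := by
  classical
  have h := congrFun (hV.bijective.2 (Function.update 0 x T)).choose_spec x
  rw [Function.update_self] at h
  have h' := LinearMap.congr_fun h v
  exact h'

theorem unit_smul_of_ne [hV : IsSimpleFamily S V] {x y : X} (hxy : y ≠ x)
    (T : Module.End ℂ (V x)) (v : V y) :
    unit S V x T • v = 0 := by
  classical
  have h := congrFun (hV.bijective.2 (Function.update 0 x T)).choose_spec y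
  rw [Function.update_of_ne hxy] at h
  have h' := LinearMap.congr_fun h v
  exact h'

/-- The `S`-linear map `V x → S` that sends `v` to the rank one operator `w ↦ η w • v`. -/
noncomputable def rankOne [hV : IsSimpleFamily S V] (x : X) (η : V x →ₗ[ℂ] ℂ) : V x →ₗ[S] S where
  toFun v := unit S V x (η.smulRight v)
  map_add' v w := by
    refine ext V fun y z => ?_
    by_cases h : y = x
    · subst h; simp [unit_smul, add_smul]
    · simp [unit_smul_of_ne S V h, add_smul]
  map_smul' s v := by
    refine ext V fun y z => ?_
    by_cases h : y = x
    · subst h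
      simp only [unit_smul, mul_smul, LinearMap.smulRight_apply, RingHom.id_apply, smul_eq_mul]
      exact ((actionHom S (V y) s).map_smul (η z) v).symm
    · simp [unit_smul_of_ne S V h, mul_smul]

theorem rankOne_smul [hV : IsSimpleFamily S V] (x : X) (η : V x →ₗ[ℂ] ℂ) (v w : V x) :
    rankOne S V x η v • w = η w • v := by
  simp [rankOne, unit_smul]

theorem rankOne_smul_of_ne [hV : IsSimpleFamily S V] {x y : X} (hxy : y ≠ x)
    (η : V x →ₗ[ℂ] ℂ) (v : V x) (w : V y) :
    rankOne S V x η v • w = 0 := by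
  simp [rankOne, unit_smul_of_ne S V hxy]

/-- A basis of `V x`. -/
noncomputable def basis [hV : IsSimpleFamily S V] (x : X) :
    Module.Basis (Fin (Module.finrank ℂ (V x))) ℂ (V x) :=
  have := hV.finite x
  Module.finBasis ℂ (V x)

/-- On each member the sum acts by expanding a vector in the basis, and elements of `S` are
determined by their actions. Applied to an `S`-module, this decomposition of `1` splits off the
isotypic parts. -/
theorem sum_rankOne [hV : IsSimpleFamily S V] [Fintype X] :
    ∑ x, ∑ k, rankOne S V x ((basis S V x).coord k) (basis S V x k) = 1 := by
  classical
  refine ext V fun y v => ?_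
  rw [Finset.sum_smul, Finset.sum_eq_single y]
  · simp only [Finset.sum_smul, rankOne_smul, one_smul]
    exact (basis S V y).sum_repr v
  · intro x _ hx
    simp [Finset.sum_smul, rankOne_smul_of_ne S V hx.symm]
  · simp

/-- With such a pair, `rankOne η w` carries `v` to `w`, so `v` generates `V x` by explicit elements
of `S`, and `rankOne η v` acts as an idempotent with image the line of `v`. -/
theorem exists_dual [hV : IsSimpleFamily S V] (x : X) : ∃ (v : V x) (η : V x →ₗ[ℂ] ℂ), η v = 1 := by
  have := nontrivial S V x
  obtain ⟨v, hv⟩ := exists_ne (0 : V x)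
  obtain ⟨η, hη⟩ := Module.Projective.exists_dual_ne_zero ℂ hv
  exact ⟨v, (η v)⁻¹ • η, by simp [hη]⟩

end IsSimpleFamily

/-! ### The representatives of the isomorphism classes -/

section Representatives

variable {S : Type u} [Ring S] [Algebra ℂ S]

/-- Each simple module is isomorphic to a left ideal. Simple ideals with the same isotypic component
are isomorphic, and a semisimple ring has finitely many isotypic components. -/
theorem finite_simpleClass [Module.Finite ℂ S] [IsSemisimpleRing S] : Finite (SimpleClass S) := by
  have key : ∀ i : SimpleClass S, ∃ I : Ideal S, Nonempty (i.out.1 ≃ₗ[S] I) := fun i =>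
    have := i.out.2
    IsSemisimpleRing.exists_linearEquiv_ideal_of_isSimpleModule S i.out.1
  choose I hI using key
  have simple : ∀ i, IsSimpleModule S (I i) := fun i =>
    have := i.out.2
    IsSimpleModule.congr (hI i).some.symm
  refine Finite.of_injective (β := isotypicComponents S S)
    (fun i => ⟨isotypicComponent S S (I i), I i, simple i, rfl⟩) fun i j h => ?_
  have h : isotypicComponent S S (I i) = isotypicComponent S S (I j) := congrArg Subtype.val h
  have := simple i
  have := simple j
  obtain ⟨e⟩ := isIsotypicOfType_submodule_iff.mp
    (IsIsotypicOfType.isotypicComponent S S (S := I j)) (I i)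
    (h ▸ (I i).le_isotypicComponent)
  rw [← Quotient.out_eq i, ← Quotient.out_eq j]
  exact Quotient.sound ⟨((hI i).some.trans e).trans (hI j).some.symm⟩

/-- This is the Wedderburn decomposition over `ℂ`. Injectivity holds since `S` is the sum of its
simple left ideals, each isomorphic to a representative, so an element that kills all
representatives kills `1`. Surjectivity is Jacobson density for the product of the representatives.
-/
theorem isSimpleFamily_of_toClass [Module.Finite ℂ S] [IsSemisimpleRing S]
    (V : SimpleClass S → SimpleMod S) (hV : ∀ i, (V i).toClass = i)
    [∀ i, Module ℂ (V i).1] [∀ i, IsScalarTower ℂ S (V i).1] :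
    IsSimpleFamily S fun i => (V i).1 := by
  classical
  have simple : ∀ i, IsSimpleModule S (V i).1 := fun i => (V i).2
  have finite : ∀ i, FiniteDimensional ℂ (V i).1 := fun i =>
    Module.Finite.trans S (V i).1
  have := finite_simpleClass (S := S)
  cases nonempty_fintype (SimpleClass S)
  refine ⟨simple, finite, fun s t hst => ?_, fun T => ?_⟩
  · have hi : ∀ i (v : (V i).1), (s - t) • v = 0 := fun i v => by
      rw [sub_smul, sub_eq_zero]
      exact LinearMap.congr_fun (congrFun hst i) v
    have hmem : (1 : S) ∈ sSup {m : Submodule S S | IsSimpleModule S m} :=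
      (IsSemisimpleModule.sSup_simples_eq_top S S).symm ▸ Submodule.mem_top
    rw [sSup_eq_iSup'] at hmem
    rw [← sub_eq_zero, ← mul_one (s - t)]
    refine Submodule.iSup_induction _ (motive := fun m => (s - t) * m = 0) hmem ?_ (mul_zero _) ?_
    · rintro ⟨m, hm⟩ a ha
      have hm : IsSimpleModule S m := hm
      let M : SimpleMod S := ⟨ModuleCat.of S m, hm⟩
      obtain ⟨e⟩ : Nonempty ((V M.toClass).1 ≃ₗ[S] M.1) := Quotient.exact (hV M.toClass)
      have h2 := hi _ (e.symm ⟨a, ha⟩)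
      rw [← map_smul, LinearEquiv.map_eq_zero_iff] at h2
      exact congrArg Subtype.val h2
    · intro a b ha hb
      rw [mul_add, ha, hb, add_zero]
  · let M := ∀ i, (V i).1
    -- The off-diagonal entries vanish because distinct representatives are not isomorphic, and the
    -- diagonal ones are scalars by Schur's lemma.
    have hEnd : ∀ (φ : Module.End S M), ∃ c : SimpleClass S → ℂ, ∀ m i, φ m i = c i • m i := by
      intro φ
      have h1 : ∀ i, ∃ c : ℂ, ∀ v, φ (Pi.single i v) = Pi.single i (c • v) := by
        intro i
        obtain ⟨c, hc⟩ := exists_smul_of_isSimpleModule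
          ((LinearMap.proj i).comp (φ.comp (LinearMap.single S (fun i => (V i).1) i)))
        refine ⟨c, fun v => funext fun j => ?_⟩
        by_cases hj : j = i
        · subst hj
          rw [Pi.single_eq_same]
          exact hc v
        · rw [Pi.single_eq_of_ne hj]
          let ψ := (LinearMap.proj j).comp (φ.comp (LinearMap.single S (fun i => (V i).1) i))
          rcases ψ.bijective_or_eq_zero with h | h
          · refine absurd ?_ hj
            rw [← hV i, ← hV j]
            exact Quotient.sound ⟨(LinearEquiv.ofBijective ψ h).symm⟩
          · exact LinearMap.congr_fun h v
      choose c hc using h1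
      refine ⟨c, fun m i => ?_⟩
      have : m = ∑ j, Pi.single j (m j) := (Finset.univ_sum_single m).symm
      conv_lhs => rw [this, map_sum]
      simp only [hc]
      rw [Finset.univ_sum_single (fun j => c j • m j)]
    -- A family of linear maps commutes with all diagonal scalars, hence lies in the bicommutant.
    let f : Module.End (Module.End S M) M :=
      { toFun := fun m i => T i (m i)
        map_add' := fun m m' => funext fun i => map_add (T i) _ _
        map_smul' := fun φ m => funext fun i => by
          obtain ⟨c, hc⟩ := hEnd φ
          simp only [Module.End.smul_def, hc, map_smul, RingHom.id_apply] }
    let b := fun i => Module.finBasis ℂ (V i).1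
    -- Density needs a finite set of vectors; bases of all the factors suffice to pin down every `T
    -- i`.
    obtain ⟨s, hs⟩ := jacobson_density (R := S) f
      (Finset.univ.image fun k : Σ i, Fin (Module.finrank ℂ (V i).1) =>
        (Pi.single k.1 (b k.1 k.2) : M))
    refine ⟨s, funext fun i => (b i).ext fun k => ?_⟩
    have h := congrFun (hs _ (Finset.mem_image_of_mem _ (Finset.mem_univ ⟨i, k⟩))) i
    have h : T i ((Pi.single i (b i k) : M) i) = s • (Pi.single i (b i k) : M) i := h
    rw [Pi.single_eq_same] at h
    exact h.symm

end Representatives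

/-! ### Homogeneous components -/

namespace QExtension

variable {Q S : Type u} [Group Q] [Ring S] [Algebra ℂ S] (R : QExtension Q S)

open Classical in
/-- The projection of `R` to the component of degree `q`. -/
noncomputable def component (q : Q) : R.carrier →ₗ[ℂ] R.carrier :=
  (R.grade q).subtype ∘ₗ DirectSum.component ℂ Q (fun q => R.grade q) q ∘ₗ
    (LinearEquiv.ofBijective (DirectSum.coeLinearMap R.grade)
      (DirectSum.isInternal_submodule_of_iSupIndep_of_iSup_eq_top
        R.grade_indep R.grade_iSup)).symm.toLinearMap

theorem component_mem (q : Q) (r : R.carrier) : R.component q r ∈ R.grade q :=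
  Subtype.property _

open Classical in
theorem component_coe (p q : Q) (r : R.grade p) :
    R.component q r = DirectSum.lof ℂ Q (fun q => R.grade q) p r q := by
  have h : (LinearEquiv.ofBijective (DirectSum.coeLinearMap R.grade)
      (DirectSum.isInternal_submodule_of_iSupIndep_of_iSup_eq_top
        R.grade_indep R.grade_iSup)).symm r = DirectSum.lof ℂ Q (fun q => R.grade q) p r := by
    rw [LinearEquiv.symm_apply_eq]
    exact (DirectSum.coeLinearMap_lof R.grade p r).symm
  exact congrArg (fun d => ((d q : R.grade q) : R.carrier)) h

theorem component_of_mem {q : Q} {r : R.carrier} (hr : r ∈ R.grade q) : R.component q r = r := by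
  classical
  rw [R.component_coe q q ⟨r, hr⟩, DirectSum.lof_eq_of, DirectSum.of_eq_same]

theorem component_of_mem_of_ne {p q : Q} (hpq : p ≠ q) {r : R.carrier} (hr : r ∈ R.grade p) :
    R.component q r = 0 := by
  classical
  rw [R.component_coe p q ⟨r, hr⟩, DirectSum.lof_eq_of, DirectSum.of_eq_of_ne _ _ _ hpq.symm]
  rfl

theorem homogeneous_induction {motive : R.carrier → Prop} (r : R.carrier)
    (mem : ∀ q, ∀ r ∈ R.grade q, motive r) (add : ∀ a b, motive a → motive b → motive (a + b)) :
    motive r :=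
  Submodule.iSup_induction R.grade (motive := motive)
    (R.grade_iSup.symm ▸ Submodule.mem_top : r ∈ ⨆ q, R.grade q) mem
    (mem 1 0 (Submodule.zero_mem _)) add

theorem eq_zero_of_component {r : R.carrier} (h : ∀ q, R.component q r = 0) : r = 0 := by
  classical
  let e := LinearEquiv.ofBijective (DirectSum.coeLinearMap R.grade)
    (DirectSum.isInternal_submodule_of_iSupIndep_of_iSup_eq_top R.grade_indep R.grade_iSup)
  refine e.symm.map_eq_zero_iff.1 (DFinsupp.ext fun q => Subtype.ext (h q))

theorem exists_incl_eq {r : R.carrier} (hr : r ∈ R.grade 1) : ∃ s, R.incl s = r := by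
  rw [← R.incl_range] at hr
  exact hr

theorem one_mem : (1 : R.carrier) ∈ R.grade 1 := by
  simpa using R.incl_mem 1

theorem incl_mul_mem {q : Q} (s : S) {r : R.carrier} (hr : r ∈ R.grade q) :
    R.incl s * r ∈ R.grade q := by
  simpa using R.mul_mem (R.incl_mem s) hr

theorem mul_incl_mem {q : Q} (s : S) {r : R.carrier} (hr : r ∈ R.grade q) :
    r * R.incl s ∈ R.grade q := by
  simpa using R.mul_mem hr (R.incl_mem s)

/-- Strong grading: the products of elements of degrees `p` and `q` span the component of degree `p
* q`. -/
theorem eq_of_mul_mem {W : Type*} [AddCommGroup W] [Module ℂ W] {β β' : R.carrier →ₗ[ℂ] W}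
    {p q : Q} (h : ∀ a ∈ R.grade p, ∀ b ∈ R.grade q, β (a * b) = β' (a * b)) {r : R.carrier}
    (hr : r ∈ R.grade (p * q)) : β r = β' r := by
  rw [← R.grade_mul] at hr
  exact Submodule.mul_induction_on (C := fun r => β r = β' r) hr h
    fun x y hx hy => by rw [map_add, map_add, hx, hy]

/-- The grading is strong, so `1` lies in `R_q R_{q⁻¹}`. This partition of unity replaces an
invertible element of degree `q`, which need not exist. -/
theorem exists_sum_mul_eq_one (q : Q) : ∃ (ι : Type) (_ : Fintype ι) (a b : ι → R.carrier),
    (∀ k, a k ∈ R.grade q) ∧ (∀ k, b k ∈ R.grade q⁻¹) ∧ ∑ k, a k * b k = 1 := by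
  have h1 : (1 : R.carrier) ∈ R.grade q * R.grade q⁻¹ := by
    rw [R.grade_mul, mul_inv_cancel]
    exact R.one_mem
  generalize (1 : R.carrier) = r at h1
  refine Submodule.mul_induction_on h1 (fun a ha b hb => ⟨Unit, inferInstance, fun _ => a,
    fun _ => b, fun _ => ha, fun _ => hb, by simp⟩) fun x y hx hy => ?_
  · obtain ⟨ι, _, a, b, ha, hb, rfl⟩ := hx
    obtain ⟨κ, _, a', b', ha', hb', rfl⟩ := hy
    exact ⟨ι ⊕ κ, inferInstance, Sum.elim a a', Sum.elim b b', by simpa using ⟨ha, ha'⟩,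
      by simpa using ⟨hb, hb'⟩, by simp⟩

/-- The index type of a decomposition `1 = ∑ k, a k * b k` with `a k` of degree `q` and `b k` of
degree `q⁻¹`. -/
def UnitIndex (q : Q) : Type := (R.exists_sum_mul_eq_one q).choose

noncomputable instance (q : Q) : Fintype (R.UnitIndex q) :=
  (R.exists_sum_mul_eq_one q).choose_spec.choose

/-- The left factors of a decomposition of `1`. -/
noncomputable def unitLeft (q : Q) : R.UnitIndex q → R.carrier :=
  (R.exists_sum_mul_eq_one q).choose_spec.choose_spec.choose

/-- The right factors of a decomposition of `1`. -/
noncomputable def unitRight (q : Q) : R.UnitIndex q → R.carrier :=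
  (R.exists_sum_mul_eq_one q).choose_spec.choose_spec.choose_spec.choose

theorem unitLeft_mem (q : Q) (k : R.UnitIndex q) : R.unitLeft q k ∈ R.grade q :=
  (R.exists_sum_mul_eq_one q).choose_spec.choose_spec.choose_spec.choose_spec.1 k

theorem unitRight_mem (q : Q) (k : R.UnitIndex q) : R.unitRight q k ∈ R.grade q⁻¹ :=
  (R.exists_sum_mul_eq_one q).choose_spec.choose_spec.choose_spec.choose_spec.2.1 k

theorem sum_unit (q : Q) : ∑ k, R.unitLeft q k * R.unitRight q k = 1 :=
  (R.exists_sum_mul_eq_one q).choose_spec.choose_spec.choose_spec.choose_spec.2.2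

end QExtension

/-! ### Gerbes on action groupoids -/

namespace SOneGerbe

variable {Q : Type u} [Group Q] {X : Type w} [MulAction Q X]
  (G : SOneGerbe.{v} (ActionCategory Q X))

/-- The element of `Q` over which an arrow lies. -/
def degree {x y : ActionCategory Q X} (f : G.Hom x y) : Q :=
  (G.proj f).val

@[simp]
theorem degree_id (x : ActionCategory Q X) : G.degree (G.id x) = 1 :=
  congrArg Subtype.val (G.proj_id x)

@[simp]
theorem degree_comp {x y z : ActionCategory Q X} (f : G.Hom x y) (g : G.Hom y z) :
    G.degree (G.comp f g) = G.degree g * G.degree f :=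
  congrArg Subtype.val (G.proj_comp f g)

@[simp]
theorem degree_smul {x y : ActionCategory Q X} (c : ℂˣ) (f : G.Hom x y) :
    G.degree (c • f) = G.degree f :=
  congrArg Subtype.val (G.proj_smul c f)

theorem degree_smul_back {x y : ActionCategory Q X} (f : G.Hom x y) :
    G.degree f • x.back = y.back :=
  (G.proj f).property

theorem exists_degree_eq {x y : ActionCategory Q X} {q : Q} (h : q • x.back = y.back) :
    ∃ f : G.Hom x y, G.degree f = q := by
  obtain ⟨f, hf⟩ := G.proj_surjective x y ⟨q, h⟩
  exact ⟨f, congrArg Subtype.val hf⟩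

theorem exists_arrow (x : ActionCategory Q X) (q : Q) :
    ∃ (y : ActionCategory Q X) (f : G.Hom x y), G.degree f = q :=
  ⟨((q • x.back : X) : ActionCategory Q X), G.exists_degree_eq rfl⟩

theorem exists_smul_eq {x y : ActionCategory Q X} {f g : G.Hom x y}
    (h : G.degree f = G.degree g) : ∃ c : ℂˣ, c • f = g :=
  (G.existsUnique_smul f g (Subtype.ext h)).exists

theorem degree_inv {x y : ActionCategory Q X} {f : G.Hom x y} {g : G.Hom y x}
    (h : G.comp f g = G.id x) : G.degree g = (G.degree f)⁻¹ := by
  rw [← mul_eq_one_iff_eq_inv, ← degree_comp, h, degree_id]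

end SOneGerbe

/-! ### Models of an extension -/

/-- A presentation of the extension `R` by operators: every arrow `f : x → y` of the gerbe `G` gives
an operator `V x → V y` for each element of `R` of the degree of `f`, so that the product of `R`
corresponds to the composition. -/
structure GerbeModel {Q S : Type u} [Group Q] [Ring S] [Algebra ℂ S] {X : Type w} [MulAction Q X]
    (V : X → Type u) [∀ x, AddCommGroup (V x)] [∀ x, Module S (V x)] [∀ x, Module ℂ (V x)]
    (R : QExtension Q S) (G : SOneGerbe.{v} (ActionCategory Q X)) where
  /-- the operator of an element of `R` -/
  map : ∀ {x y : ActionCategory Q X}, G.Hom x y → R.carrier →ₗ[ℂ] V x.back →ₗ[ℂ] V y.back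
  smul_map_smul : ∀ {x y : ActionCategory Q X} (c : ℂˣ) (f : G.Hom x y) (r : R.carrier),
    (c : ℂ) • map (c • f) r = map f r
  map_of_ne : ∀ {x y : ActionCategory Q X} (f : G.Hom x y) {p : Q}, p ≠ G.degree f →
    ∀ r ∈ R.grade p, map f r = 0
  map_comp : ∀ {x y z : ActionCategory Q X} (f : G.Hom x y) (g : G.Hom y z),
    ∀ a ∈ R.grade (G.degree g), ∀ b ∈ R.grade (G.degree f), ∀ v,
      map (G.comp f g) (a * b) v = map g a (map f b v)
  map_id : ∀ (x : ActionCategory Q X) (s : S) (v : V x.back),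
    map (G.id x) (R.incl s) v = s • v

namespace GerbeModel

variable {Q S : Type u} [Group Q] [Ring S] [Algebra ℂ S] {X : Type w} [MulAction Q X]
  {V : X → Type u} [∀ x, AddCommGroup (V x)] [∀ x, Module S (V x)] [∀ x, Module ℂ (V x)]
  {R : QExtension Q S} {G : SOneGerbe.{v} (ActionCategory Q X)} (m : GerbeModel V R G)

theorem map_smul {x y : ActionCategory Q X} (c : ℂˣ) (f : G.Hom x y) (r : R.carrier) :
    m.map (c • f) r = (c⁻¹ : ℂ) • m.map f r := by
  rw [← m.smul_map_smul c f r, smul_smul, inv_mul_cancel₀ c.ne_zero, one_smul]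

/-- Only one factor has to be homogeneous: a component of the other factor in a wrong degree gives,
by cancellation in `Q`, a product in a wrong degree, and both sides vanish. -/
theorem map_comp_left {x y z : ActionCategory Q X} (f : G.Hom x y) (g : G.Hom y z)
    {a : R.carrier} (ha : a ∈ R.grade (G.degree g)) (b : R.carrier) (v : V x.back) :
    m.map (G.comp f g) (a * b) v = m.map g a (m.map f b v) := by
  induction b using R.homogeneous_induction with
  | mem q b hb =>
    by_cases hq : q = G.degree f
    · subst hq; exact m.map_comp f g a ha b hb v
    · rw [m.map_of_ne f hq b hb, m.map_of_ne (G.comp f g) _ _ (R.mul_mem ha hb)]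
      · simp
      · rw [G.degree_comp]
        exact fun h => hq (mul_left_cancel h)
  | add b c hb hc => simp [mul_add, hb, hc]

theorem map_comp_right {x y z : ActionCategory Q X} (f : G.Hom x y) (g : G.Hom y z)
    (a : R.carrier) {b : R.carrier} (hb : b ∈ R.grade (G.degree f)) (v : V x.back) :
    m.map (G.comp f g) (a * b) v = m.map g a (m.map f b v) := by
  induction a using R.homogeneous_induction with
  | mem q a ha =>
    by_cases hq : q = G.degree g
    · subst hq; exact m.map_comp f g a ha b hb v
    · rw [m.map_of_ne g hq a ha, m.map_of_ne (G.comp f g) _ _ (R.mul_mem ha hb)]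
      · simp
      · rw [G.degree_comp]
        exact fun h => hq (mul_right_cancel h)
  | add b c hb hc => simp [add_mul, hb, hc]

theorem map_incl_mul {x y : ActionCategory Q X} (f : G.Hom x y) (s : S) (r : R.carrier)
    (v : V x.back) : m.map f (R.incl s * r) v = s • m.map f r v := by
  rw [← m.map_id, ← m.map_comp_left f (G.id y) (by simpa using R.incl_mem s), G.comp_id]

theorem map_mul_incl {x y : ActionCategory Q X} (f : G.Hom x y) (s : S) (r : R.carrier)
    (v : V x.back) : m.map f (r * R.incl s) v = m.map f r (s • v) := by
  rw [← m.map_id, ← m.map_comp_right (G.id x) f _ (by simpa using R.incl_mem s), G.id_comp]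

theorem map_component {x y : ActionCategory Q X} (f : G.Hom x y) (r : R.carrier) :
    m.map f (R.component (G.degree f) r) = m.map f r := by
  induction r using R.homogeneous_induction with
  | mem q r hr =>
    by_cases hq : q = G.degree f
    · subst hq; rw [R.component_of_mem hr]
    · rw [R.component_of_mem_of_ne hq hr, m.map_of_ne f hq r hr, map_zero]
  | add a b ha hb => rw [map_add, map_add, map_add, ha, hb]

theorem map_comp_eq_id {x y : ActionCategory Q X} {f : G.Hom x y} {g : G.Hom y x}
    (h : G.comp f g = G.id x) {a b : R.carrier} (ha : a ∈ R.grade (G.degree g))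
    (hb : b ∈ R.grade (G.degree f)) :
    ∃ s, R.incl s = a * b ∧ ∀ v, m.map g a (m.map f b v) = s • v := by
  have hab : a * b ∈ R.grade 1 := by
    have := R.mul_mem ha hb
    rwa [← G.degree_comp, h, G.degree_id] at this
  obtain ⟨s, hs⟩ := R.exists_incl_eq hab
  refine ⟨s, hs, fun v => ?_⟩
  rw [← m.map_comp f g a ha b hb, h, ← hs, m.map_id]

/-- The partition of unity is evaluated at the identity arrow of `y`, factored through `x`. In
particular the operators of `f` reach all of `V y`. -/
theorem sum_map_map {x y : ActionCategory Q X} {f : G.Hom x y} {g : G.Hom y x}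
    (h : G.comp g f = G.id y) (w : V y.back) :
    ∑ k, m.map f (R.unitLeft (G.degree f) k) (m.map g (R.unitRight (G.degree f) k) w) = w := by
  have : ∀ k, m.map f (R.unitLeft (G.degree f) k) (m.map g (R.unitRight (G.degree f) k) w) =
      m.map (G.id y) (R.unitLeft (G.degree f) k * R.unitRight (G.degree f) k) w := fun k => by
    rw [← h, m.map_comp_left g f (R.unitLeft_mem _ k)]
  simp only [this]
  rw [← LinearMap.sum_apply, ← map_sum, R.sum_unit, ← map_one R.incl, m.map_id, one_smul]

/-- The operators of `f : x → y` span `V y`. -/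
theorem eq_of_map {x y : ActionCategory Q X} (f : G.Hom x y) {M : Type*} [AddCommGroup M]
    {T T' : V y.back →+ M}
    (h : ∀ r ∈ R.grade (G.degree f), ∀ v, T (m.map f r v) = T' (m.map f r v)) (w : V y.back) :
    T w = T' w := by
  obtain ⟨g, -, hg⟩ := G.exists_inv f
  rw [← m.sum_map_map hg w, map_sum, map_sum]
  exact Finset.sum_congr rfl fun k _ => h _ (R.unitLeft_mem _ k) _

/-- A map `R_q ⊗_S V x → M` as a map `V y → M`, for an arrow `f : x → y` over `q`. -/
noncomputable def descend {x y : ActionCategory Q X} (f : G.Hom x y) {M : Type*} [AddCommGroup M]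
    [Module ℂ M] : (R.carrier →ₗ[ℂ] V x.back →ₗ[ℂ] M) →ₗ[ℂ] V y.back →ₗ[ℂ] M where
  -- With `1 = ∑ a_k b_k` and `g` inverse to `f`, the inverse of evaluation sends `w` to `∑ a_k ⊗
  -- map g b_k w`; `β` is applied to this tensor.
  toFun β := ∑ k, β (R.unitLeft (G.degree f) k) ∘ₗ
    m.map (G.exists_inv f).choose (R.unitRight (G.degree f) k)
  map_add' β β' := by simp [LinearMap.add_comp, Finset.sum_add_distrib]
  map_smul' c β := by simp [LinearMap.smul_comp, Finset.smul_sum]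

/-- Each `b_k r` has degree one, so it comes from `S` and balancedness of `β` moves it to the left;
then `∑ a_k b_k = 1` removes the sum. -/
theorem descend_map {x y : ActionCategory Q X} (f : G.Hom x y) {M : Type*} [AddCommGroup M]
    [Module ℂ M] {β : R.carrier →ₗ[ℂ] V x.back →ₗ[ℂ] M}
    (hβ : ∀ r s v, β (r * R.incl s) v = β r (s • v)) {r : R.carrier}
    (hr : r ∈ R.grade (G.degree f)) (v : V x.back) : m.descend f β (m.map f r v) = β r v := by
  have hg := (G.exists_inv f).choose_spec.1
  change (∑ k, β (R.unitLeft (G.degree f) k) ∘ₗ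
    m.map (G.exists_inv f).choose (R.unitRight (G.degree f) k)) (m.map f r v) = β r v
  have key : ∀ k, β (R.unitLeft (G.degree f) k) (m.map (G.exists_inv f).choose
      (R.unitRight (G.degree f) k) (m.map f r v)) =
      β (R.unitLeft (G.degree f) k * R.unitRight (G.degree f) k * r) v := fun k => by
    obtain ⟨s, hs, hs'⟩ := m.map_comp_eq_id hg (a := R.unitRight (G.degree f) k) (b := r)
      (by rw [G.degree_inv hg]; exact R.unitRight_mem _ k) hr
    rw [hs', mul_assoc, ← hs, hβ]
  simp only [LinearMap.sum_apply, LinearMap.comp_apply, key]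
  rw [← LinearMap.sum_apply, ← map_sum, ← Finset.sum_mul, R.sum_unit, one_mul]

variable [∀ x, IsScalarTower ℂ S (V x)]

/-- For `s` of degree `q⁻¹`, the product of `s` with the component `r_q` lies in `S` and kills every
member of the family, so it is zero. Multiplying by the partition of unity in degree `q` recovers
`r_q = 0`. -/
theorem eq_zero [hV : IsSimpleFamily S V] {r : R.carrier}
    (h : ∀ {x y : ActionCategory Q X} (f : G.Hom x y), m.map f r = 0) :
    r = 0 := by
  refine R.eq_zero_of_component fun q => ?_
  have key : ∀ s ∈ R.grade q⁻¹, s * R.component q r = 0 := by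
    intro s hs
    obtain ⟨t, ht⟩ := R.exists_incl_eq (r := s * R.component q r) (by
      simpa using R.mul_mem hs (R.component_mem q r))
    suffices t = 0 by rw [← ht, this, map_zero]
    suffices h0 : ∀ (x : ActionCategory Q X) (v : V x.back), t • v = 0 from
      IsSimpleFamily.ext V fun x v => (h0 (x : ActionCategory Q X) v).trans (zero_smul _ _).symm
    intro x v
    obtain ⟨y, f, rfl⟩ := G.exists_arrow x q
    obtain ⟨g, hg, -⟩ := G.exists_inv f
    have h1 := m.map_id x t v
    rw [ht, ← hg, m.map_comp_right f g _ (R.component_mem _ r), m.map_component, h f] at h1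
    rw [← h1]
    simp
  rw [← one_mul (R.component q r), ← R.sum_unit q, Finset.sum_mul]
  exact Finset.sum_eq_zero fun k _ => by rw [mul_assoc, key _ (R.unitRight_mem q k), mul_zero]

theorem eq_of_map_eq [hV : IsSimpleFamily S V] {r r' : R.carrier}
    (h : ∀ {x y : ActionCategory Q X} (f : G.Hom x y), m.map f r = m.map f r') : r = r' :=
  sub_eq_zero.1 (m.eq_zero fun f => by rw [map_sub, h, sub_self])

/-- The preimage is `∑ a_k ρ_{jk}`, where `ρ_{jk}` in `S` sends the basis vector `e_j` to `map g b_k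
(T e_j)` and the other basis vectors to zero. By `sum_map_map` it maps `e_j` to `T e_j`, and the
`ρ_{jk}` vanish on all other members. -/
theorem exists_map_eq [hV : IsSimpleFamily S V] {x y : ActionCategory Q X} (f : G.Hom x y)
    (T : V x.back →ₗ[ℂ] V y.back) : ∃ r ∈ R.grade (G.degree f), m.map f r = T ∧
      ∀ {x' y' : ActionCategory Q X} (f' : G.Hom x' y'), x'.back ≠ x.back → m.map f' r = 0 := by
  obtain ⟨g, -, hg⟩ := G.exists_inv f
  refine ⟨∑ j, ∑ k, R.unitLeft (G.degree f) k * R.incl (IsSimpleFamily.rankOne S V x.back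
      ((IsSimpleFamily.basis S V x.back).coord j)
      (m.map g (R.unitRight (G.degree f) k) (T (IsSimpleFamily.basis S V x.back j)))),
    sum_mem fun j _ => sum_mem fun k _ => R.mul_incl_mem _ (R.unitLeft_mem _ k), ?_, ?_⟩
  · refine (IsSimpleFamily.basis S V x.back).ext fun i => ?_
    simp only [map_sum, LinearMap.sum_apply, m.map_mul_incl, IsSimpleFamily.rankOne_smul,
      LinearMap.map_smul, ← Finset.smul_sum, m.sum_map_map hg]
    rw [Finset.sum_eq_single i]
    · simp
    · intro j _ hj
      simp [Finsupp.single_eq_of_ne hj]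
    · simp
  · intro x' y' f' hx
    refine LinearMap.ext fun v => ?_
    simp only [map_sum, LinearMap.sum_apply, m.map_mul_incl,
      IsSimpleFamily.rankOne_smul_of_ne S V hx]
    simp

theorem exists_map_ne_zero [hV : IsSimpleFamily S V] {x y : ActionCategory Q X} (f : G.Hom x y) :
    ∃ r ∈ R.grade (G.degree f), ∃ v, m.map f r v ≠ 0 := by
  by_contra! h
  have := IsSimpleFamily.nontrivial S V y.back
  obtain ⟨w, hw⟩ := exists_ne (0 : V y.back)
  exact hw (m.eq_of_map f (T := AddMonoidHom.id _) (T' := 0) h w)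

/-- The bimodule maps `R_q → Hom (V x, V y)` form a line. -/
theorem exists_eq_smul [hV : IsSimpleFamily S V] {x y : ActionCategory Q X} (f : G.Hom x y)
    {β : R.carrier →ₗ[ℂ] V x.back →ₗ[ℂ] V y.back}
    (hl : ∀ r s v, β (R.incl s * r) v = s • β r v)
    (hr : ∀ r s v, β (r * R.incl s) v = β r (s • v))
    (hne : ∀ p, p ≠ G.degree f → ∀ r ∈ R.grade p, β r = 0) : ∃ c : ℂ, β = c • m.map f := by
  have := hV.simple y.back
  have := hV.finite y.back
  -- The bimodule map `β` factors through the operators of `f`. The induced endomorphism of `V y`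
  -- respects the left action of `S`, so Schur's lemma makes it a scalar.
  let T : V y.back →ₗ[S] V y.back :=
    { m.descend f β with
      map_smul' := fun s w => m.eq_of_map f
        (T := (m.descend f β).toAddMonoidHom.comp (DistribSMul.toAddMonoidHom _ s))
        (T' := (DistribSMul.toAddMonoidHom _ s).comp (m.descend f β).toAddMonoidHom)
        (fun r hr' v => by
          change m.descend f β (s • m.map f r v) = s • m.descend f β (m.map f r v)
          rw [← m.map_incl_mul, m.descend_map f hr (R.incl_mul_mem s hr'),
            m.descend_map f hr hr', hl]) w }
  obtain ⟨c, hc⟩ := exists_smul_of_isSimpleModule T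
  refine ⟨c, LinearMap.ext fun r => LinearMap.ext fun v => ?_⟩
  induction r using R.homogeneous_induction with
  | mem q r hr' =>
    by_cases hq : q = G.degree f
    · subst hq
      have h := hc (m.map f r v)
      rw [show T (m.map f r v) = β r v from m.descend_map f hr hr' v] at h
      exact h
    · simp [hne q hq r hr', m.map_of_ne f hq r hr']
  | add a b ha hb => rw [map_add, LinearMap.add_apply, ha, hb, map_add, LinearMap.add_apply]

end GerbeModel

namespace IsSimpleFamily

/-- The element of `S` that is the identity on `V x` and zero on the other members would force `T =
0` if `y` were different from `x`. -/
theorem eq_of_ne_zero {S : Type u} [Ring S] [Algebra ℂ S] {X : Type w} {V : X → Type v}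
    [∀ x, AddCommGroup (V x)] [∀ x, Module S (V x)] [∀ x, Module ℂ (V x)]
    [∀ x, IsScalarTower ℂ S (V x)] [IsSimpleFamily S V] {x y : X} {T : V x →ₗ[S] V y}
    (hT : T ≠ 0) : x = y := by
  by_contra h
  refine hT (LinearMap.ext fun v => ?_)
  have h1 : unit S V x LinearMap.id • v = v := unit_smul S V x _ v
  rw [← h1, T.map_smul, unit_smul_of_ne S V (Ne.symm h), LinearMap.zero_apply]

end IsSimpleFamily

theorem actionCategory_back_injective {Q : Type u} [Group Q] {X : Type w} [MulAction Q X] :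
    Function.Injective (ActionCategory.back : ActionCategory Q X → X) :=
  (ActionCategory.objEquiv Q X).symm.injective

/-! ### Projection to degree one, and operators as maps out of `R_q ⊗_S V` -/

namespace QExtension

variable {Q S : Type u} [Group Q] [Ring S] [Algebra ℂ S] (R : QExtension Q S)

/-- The left inverse is arbitrary away from the image of `S`; applied after the projection to degree
one it is only used on that image, where it is canonical. -/
theorem exists_leftInverse_incl : ∃ L : R.carrier →ₗ[ℂ] S, L ∘ₗ R.incl.toLinearMap = LinearMap.id :=
  LinearMap.exists_leftInverse_of_injective _ (LinearMap.ker_eq_bot.2 R.incl_injective)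

/-- The projection to the component of degree `1`, as an element of `S`. -/
noncomputable def degreeOne : R.carrier →ₗ[ℂ] S :=
  R.exists_leftInverse_incl.choose ∘ₗ R.component 1

theorem degreeOne_incl (s : S) : R.degreeOne (R.incl s) = s := by
  rw [degreeOne, LinearMap.comp_apply, R.component_of_mem (R.incl_mem s)]
  exact LinearMap.congr_fun R.exists_leftInverse_incl.choose_spec s

theorem degreeOne_of_ne {q : Q} (hq : q ≠ 1) {r : R.carrier} (hr : r ∈ R.grade q) :
    R.degreeOne r = 0 := by
  rw [degreeOne, LinearMap.comp_apply, R.component_of_mem_of_ne hq hr, map_zero]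

theorem degreeOne_incl_mul (s : S) (r : R.carrier) :
    R.degreeOne (R.incl s * r) = s * R.degreeOne r := by
  induction r using R.homogeneous_induction with
  | mem q r hr =>
    by_cases hq : q = 1
    · subst hq
      obtain ⟨t, rfl⟩ := R.exists_incl_eq hr
      rw [← map_mul, degreeOne_incl, degreeOne_incl]
    · rw [R.degreeOne_of_ne hq hr, R.degreeOne_of_ne hq (R.incl_mul_mem s hr), mul_zero]
  | add a b ha hb => rw [mul_add, map_add, map_add, mul_add, ha, hb]

theorem degreeOne_mul_incl (s : S) (r : R.carrier) :
    R.degreeOne (r * R.incl s) = R.degreeOne r * s := by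
  induction r using R.homogeneous_induction with
  | mem q r hr =>
    by_cases hq : q = 1
    · subst hq
      obtain ⟨t, rfl⟩ := R.exists_incl_eq hr
      rw [← map_mul, degreeOne_incl, degreeOne_incl]
    · rw [R.degreeOne_of_ne hq hr, R.degreeOne_of_ne hq (R.mul_incl_mem s hr), zero_mul]
  | add a b ha hb => rw [add_mul, map_add, map_add, add_mul, ha, hb]

/-- An additive map out of `R_q ⊗_S V` that is `S`-linear on the generators. -/
def actLinear (q : Q) {V : Type u} {W : Type v} [AddCommGroup V] [Module S V] [AddCommGroup W]
    [Module S W] (φ : R.act q V →+ W)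
    (h : ∀ (s : S) (r : R.grade q) (v : V),
      φ (balancedTmul S (s • r) v) = s • φ (balancedTmul S r v)) : R.act q V →ₗ[S] W where
  toFun := φ
  map_add' := map_add φ
  map_smul' s t := by
    rw [RingHom.id_apply]
    induction t using balancedTensor_induction with
    | h0 => rw [smul_zero, map_zero, smul_zero]
    | hm r v => exact h s r v
    | ha x y hx hy => rw [smul_add, map_add, map_add, smul_add, hx, hy]

section Operator

variable {V W : Type u} [AddCommGroup V] [Module S V] [AddCommGroup W] [Module S W]

theorem smul_grade_eq (q : Q) (c : ℂ) (r : R.grade q) : c • r = algebraMap ℂ S c • r :=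
  Subtype.ext (by
    change c • (r : R.carrier) = R.incl (algebraMap ℂ S c) * r
    rw [AlgHom.commutes, Algebra.smul_def])

/-- Scalars are central in `R`; this makes the operators of a map out of `R_q ⊗_S V` complex linear
in the vector. -/
theorem op_smul_grade_eq (q : Q) (c : ℂ) (r : R.grade q) :
    MulOpposite.op (algebraMap ℂ S c) • r = algebraMap ℂ S c • r :=
  Subtype.ext (by
    change (r : R.carrier) * R.incl (algebraMap ℂ S c) = R.incl (algebraMap ℂ S c) * r
    rw [AlgHom.commutes, Algebra.commutes])

variable [Module ℂ V] [Module ℂ W]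

/-- The operators `V → W` of the elements of `R` that correspond to a map `R_q ⊗_S V → W`. -/
noncomputable def operator [IsScalarTower ℂ S V] [IsScalarTower ℂ S W] (q : Q)
    (E : R.act q V →ₗ[S] W) : R.carrier →ₗ[ℂ] V →ₗ[ℂ] W :=
  LinearMap.mk₂ ℂ
    (fun r v => E (balancedTmul S (⟨R.component q r, R.component_mem q r⟩ : R.grade q) v))
    (fun r r' v => by
      rw [← map_add, ← balancedTmul_add_left]
      exact congrArg (fun t => E (balancedTmul S t v)) (Subtype.ext (map_add _ r r')))
    (fun c r v => by
      rw [← algebraMap_smul S c (E _), ← map_smul, smul_balancedTmul, ← smul_grade_eq]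
      exact congrArg (fun t => E (balancedTmul S t v))
        (Subtype.ext ((R.component q).map_smul c r)))
    (fun r v v' => by rw [balancedTmul_add_right, map_add])
    (fun c r v => by
      rw [← algebraMap_smul S c v, ← balancedTmul_smul, op_smul_grade_eq, ← smul_balancedTmul,
        map_smul, algebraMap_smul])

theorem operator_of_mem [IsScalarTower ℂ S V] [IsScalarTower ℂ S W]
    {q : Q} (E : R.act q V →ₗ[S] W) {r : R.carrier} (hr : r ∈ R.grade q)
    (v : V) : R.operator q E r v = E (balancedTmul S (⟨r, hr⟩ : R.grade q) v) :=
  congrArg (fun t => E (balancedTmul S t v)) (Subtype.ext (R.component_of_mem hr))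

theorem operator_of_ne [IsScalarTower ℂ S V] [IsScalarTower ℂ S W]
    {p q : Q} (hpq : p ≠ q) (E : R.act q V →ₗ[S] W) {r : R.carrier}
    (hr : r ∈ R.grade p) : R.operator q E r = 0 := by
  refine LinearMap.ext fun v => ?_
  refine Eq.trans (congrArg (fun t => E (balancedTmul S t v)) (Subtype.ext
    (R.component_of_mem_of_ne hpq hr) : _ = (0 : R.grade q))) ?_
  rw [← zero_smul S (0 : R.grade q), ← smul_balancedTmul, zero_smul, map_zero]
  rfl

theorem operator_incl_mul [IsScalarTower ℂ S V] [IsScalarTower ℂ S W]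
    {q : Q} (E : R.act q V →ₗ[S] W) (s : S) (r : R.carrier) (v : V) :
    R.operator q E (R.incl s * r) v = s • R.operator q E r v := by
  induction r using R.homogeneous_induction with
  | mem p r hr =>
    by_cases h : p = q
    · subst h
      rw [R.operator_of_mem E hr, R.operator_of_mem E (R.incl_mul_mem s hr), ← map_smul]
      rfl
    · rw [R.operator_of_ne h E hr, R.operator_of_ne h E (R.incl_mul_mem s hr)]
      simp
  | add a b ha hb => simp [mul_add, ha, hb]

theorem operator_mul_incl [IsScalarTower ℂ S V] [IsScalarTower ℂ S W]
    {q : Q} (E : R.act q V →ₗ[S] W) (s : S) (r : R.carrier) (v : V) :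
    R.operator q E (r * R.incl s) v = R.operator q E r (s • v) := by
  induction r using R.homogeneous_induction with
  | mem p r hr =>
    by_cases h : p = q
    · subst h
      rw [R.operator_of_mem E hr, R.operator_of_mem E (R.mul_incl_mem s hr), ← balancedTmul_smul]
      rfl
    · rw [R.operator_of_ne h E hr, R.operator_of_ne h E (R.mul_incl_mem s hr)]
      simp
  | add a b ha hb => simp [add_mul, ha, hb]

/-- The map `R_q ⊗_S V → W` that corresponds to operators `V → W`. -/
noncomputable def evaluate (q : Q) (β : R.carrier →ₗ[ℂ] V →ₗ[ℂ] W)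
    (hl : ∀ r s v, β (R.incl s * r) v = s • β r v)
    (hr : ∀ r s v, β (r * R.incl s) v = β r (s • v)) : R.act q V →ₗ[S] W :=
  let φ : R.act q V →+ W := balancedLift
    (AddMonoidHom.mk' (fun r : R.grade q => (β r).toAddMonoidHom) (fun r r' => by
      ext v
      exact LinearMap.congr_fun (map_add β (r : R.carrier) r') v))
    (fun r s v => hr r s v)
  R.actLinear q φ fun s r v => hl r s v

end Operator

section Congr

variable {V W : Type u} [AddCommGroup V] [Module S V] [AddCommGroup W] [Module S W]

/-- Functoriality of `R_q ⊗_S V` in `V`. -/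
def actMap (q : Q) (T : V →ₗ[S] W) : R.act q V →ₗ[S] R.act q W :=
  let φ : R.act q V →+ R.act q W := balancedLift
    (AddMonoidHom.mk' (fun r : R.grade q => AddMonoidHom.mk' (fun v => balancedTmul S r (T v))
        (fun v v' => by rw [map_add, balancedTmul_add_right])) (fun r r' => by
      ext v
      exact balancedTmul_add_left r r' (T v)))
    (fun r s v => by
      change balancedTmul S (MulOpposite.op s • r) (T v) = balancedTmul S r (T (s • v))
      rw [balancedTmul_smul, T.map_smul])
  R.actLinear q φ fun _ _ _ => rfl

theorem actMap_tmul (q : Q) (T : V →ₗ[S] W) (r : R.grade q) (v : V) :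
    R.actMap q T (balancedTmul S r v) = balancedTmul S r (T v) :=
  rfl

/-- Isomorphic modules `V` have isomorphic modules `R_q ⊗_S V`. -/
def actCongr (q : Q) (e : V ≃ₗ[S] W) : R.act q V ≃ₗ[S] R.act q W :=
  LinearEquiv.ofLinearMap (R.actMap q e) (R.actMap q e.symm)
    (LinearMap.ext fun t => by
      induction t using balancedTensor_induction with
      | h0 => rw [map_zero, map_zero]
      | hm r v => simp [actMap_tmul]
      | ha x y hx hy => rw [map_add, map_add, hx, hy])
    (LinearMap.ext fun t => by
      induction t using balancedTensor_induction with
      | h0 => rw [map_zero, map_zero]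
      | hm r v => simp [actMap_tmul]
      | ha x y hx hy => rw [map_add, map_add, hx, hy])

end Congr

end QExtension

/-! ### The evaluation isomorphisms of a model -/

namespace GerbeModel

variable {Q S : Type u} [Group Q] [Ring S] [Algebra ℂ S] {X : Type w} [MulAction Q X]
  {V : X → Type u} [∀ x, AddCommGroup (V x)] [∀ x, Module S (V x)] [∀ x, Module ℂ (V x)]
  {R : QExtension Q S} {G : SOneGerbe.{v} (ActionCategory Q X)} (m : GerbeModel V R G)

/-- The evaluation map `R_q ⊗_S V x → V y` of an arrow `x → y`. -/
noncomputable def eval {x y : ActionCategory Q X} (f : G.Hom x y) (q : Q) :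
    R.act q (V x.back) →ₗ[S] V y.back :=
  R.evaluate q (m.map f) (fun r s v => m.map_incl_mul f s r v) fun r s v => m.map_mul_incl f s r v

theorem eval_tmul {x y : ActionCategory Q X} (f : G.Hom x y) {q : Q} (r : R.grade q)
    (v : V x.back) : m.eval f q (balancedTmul S r v) = m.map f r v :=
  rfl

variable [∀ x, IsScalarTower ℂ S (V x)]

/-- Surjectivity is `sum_map_map`. For injectivity, `V x` is generated by one vector `v`, so every
tensor has the form `r ⊗ v`. Let `e` in `S` be the rank one idempotent that fixes `v`. If `map f r v
= 0`, then all operators of `r e` vanish, hence `r e = 0` by `eq_zero`, and `r ⊗ v = r ⊗ e v = r e ⊗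
v = 0`. -/
theorem eval_bijective [IsSimpleFamily S V] {x y : ActionCategory Q X} (f : G.Hom x y) {q : Q}
    (hq : G.degree f = q) : Function.Bijective (m.eval f q) := by
  subst hq
  constructor
  · rw [injective_iff_map_eq_zero]
    intro t ht
    obtain ⟨v, η, hη⟩ := IsSimpleFamily.exists_dual S V x.back
    have hrank : ∀ w, IsSimpleFamily.rankOne S V x.back η w • v = w := fun w => by
      rw [IsSimpleFamily.rankOne_smul, hη, one_smul]
    have key : ∃ r : R.grade (G.degree f), t = balancedTmul S r v := by
      clear ht
      induction t using balancedTensor_induction with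
      | h0 =>
        refine ⟨0, ?_⟩
        rw [← zero_smul S (0 : R.grade (G.degree f)), ← smul_balancedTmul, zero_smul]
      | hm r w =>
        refine ⟨MulOpposite.op (IsSimpleFamily.rankOne S V x.back η w) • r, ?_⟩
        rw [balancedTmul_smul, hrank]
      | ha a b ha hb =>
        obtain ⟨r, rfl⟩ := ha
        obtain ⟨r', rfl⟩ := hb
        exact ⟨r + r', (balancedTmul_add_left r r' v).symm⟩
    obtain ⟨r, rfl⟩ := key
    rw [eval_tmul] at ht
    have hzero : (r : R.carrier) * R.incl (IsSimpleFamily.rankOne S V x.back η v) = 0 := by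
      refine m.eq_zero fun {x' y'} f' => LinearMap.ext fun w => ?_
      rw [m.map_mul_incl, LinearMap.zero_apply]
      by_cases hx : x'.back = x.back
      · obtain rfl := actionCategory_back_injective hx
        rw [IsSimpleFamily.rankOne_smul, LinearMap.map_smul]
        by_cases hq : G.degree f = G.degree f'
        · obtain rfl : y = y' := actionCategory_back_injective (by
            rw [← G.degree_smul_back f, ← G.degree_smul_back f', hq])
          obtain ⟨c, rfl⟩ := G.exists_smul_eq hq
          rw [m.map_smul, LinearMap.smul_apply, ht, smul_zero, smul_zero]
        · rw [m.map_of_ne f' hq r r.2, LinearMap.zero_apply, smul_zero]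
      · rw [IsSimpleFamily.rankOne_smul_of_ne S V hx, map_zero]
    rw [← hrank v, ← balancedTmul_smul]
    have h0 : MulOpposite.op (IsSimpleFamily.rankOne S V x.back η v) • r = 0 := Subtype.ext hzero
    rw [h0, ← zero_smul S (0 : R.grade (G.degree f)), ← smul_balancedTmul, zero_smul]
  · intro w
    obtain ⟨g, -, hg⟩ := G.exists_inv f
    refine ⟨∑ k, balancedTmul S (⟨_, R.unitLeft_mem (G.degree f) k⟩ : R.grade (G.degree f))
      (m.map g (R.unitRight (G.degree f) k) w), ?_⟩
    rw [map_sum]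
    exact m.sum_map_map hg w

/-- The isomorphism `R_q ⊗_S V x ≃ V y` of an arrow `x → y` over `q`. -/
noncomputable def evalEquiv [IsSimpleFamily S V] {x y : ActionCategory Q X} (f : G.Hom x y) {q : Q}
    (hq : G.degree f = q) : R.act q (V x.back) ≃ₗ[S] V y.back :=
  LinearEquiv.ofBijective (m.eval f q) (m.eval_bijective f hq)

theorem evalEquiv_apply [IsSimpleFamily S V] {x y : ActionCategory Q X} (f : G.Hom x y) {q : Q}
    (hq : G.degree f = q) (t : R.act q (V x.back)) : m.evalEquiv f hq t = m.eval f q t :=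
  rfl

theorem eval_smul {x y : ActionCategory Q X} (c : ℂˣ) (f : G.Hom x y) {q : Q}
    (t : R.act q (V x.back)) : (c : ℂ) • m.eval (c • f) q t = m.eval f q t := by
  induction t using balancedTensor_induction with
  | h0 => rw [map_zero, map_zero, smul_zero]
  | hm r v => rw [eval_tmul, eval_tmul, ← LinearMap.smul_apply, m.smul_map_smul]
  | ha x y hx hy => rw [map_add, map_add, smul_add, hx, hy]

/-- Inversion turns the factor `c⁻¹` on operators into the factor `c` that the gerbe of the
extension requires. -/
theorem evalEquiv_smul_symm [IsSimpleFamily S V] {x y : ActionCategory Q X} (c : ℂˣ)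
    (f : G.Hom x y) {q : Q} (hf : G.degree f = q) (hf' : G.degree (c • f) = q) (v : V y.back) :
    (m.evalEquiv (c • f) hf').symm v = algebraMap ℂ S c • (m.evalEquiv f hf).symm v := by
  rw [LinearEquiv.symm_apply_eq, LinearEquiv.map_smul, algebraMap_smul, evalEquiv_apply,
    m.eval_smul,
    ← m.evalEquiv_apply f hf, LinearEquiv.apply_symm_apply]

theorem eval_leftMul {x y z : ActionCategory Q X} (f : G.Hom x y) (g : G.Hom y z) {p q : Q}
    (hg : G.degree g = p) (a : R.grade p) (t : R.act q (V x.back)) :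
    m.eval (G.comp f g) (p * q) (R.leftMul p q (V x.back) a t) = m.map g a (m.eval f q t) := by
  induction t using balancedTensor_induction with
  | h0 => rw [map_zero, map_zero, map_zero, map_zero]
  | hm r v =>
    rw [R.leftMul_tmul, eval_tmul, eval_tmul]
    exact m.map_comp_left f g (hg.symm ▸ a.2) _ _
  | ha x y hx hy => rw [map_add, map_add, map_add, map_add, hx, hy]

/-- Read through the inverses, this is the composition rule of the gerbe: on `r ⊗ w`
multiplicativity of the model strips off `g`, and the evaluation of `f` cancels its inverse. -/
theorem eval_extend [IsSimpleFamily S V] {x y z : ActionCategory Q X} (f : G.Hom x y)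
    (g : G.Hom y z) {p q : Q} (hf : G.degree f = q) (hg : G.degree g = p)
    (t : R.act p (V y.back)) :
    m.eval (G.comp f g) (p * q)
      (R.extend p q ((m.evalEquiv f hf).symm : V y.back →ₗ[S] _) t) = m.eval g p t := by
  induction t using balancedTensor_induction with
  | h0 => rw [map_zero, map_zero, map_zero]
  | hm r v =>
    rw [R.extend_tmul, m.eval_leftMul f g hg, ← m.evalEquiv_apply f hf]
    exact congrArg (m.map g r) ((m.evalEquiv f hf).apply_symm_apply v)
  | ha x y hx hy => rw [map_add, map_add, map_add, hx, hy]

theorem map_injective [IsSimpleFamily S V] {x y : ActionCategory Q X} {f f' : G.Hom x y}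
    (h : ∀ r ∈ R.grade (G.degree f), ∀ v, m.map f r v = m.map f' r v) : f = f' := by
  obtain ⟨r, hr, v, hv⟩ := m.exists_map_ne_zero f
  have hd : G.degree f = G.degree f' := by
    by_contra hne
    rw [h r hr, m.map_of_ne f' hne r hr] at hv
    exact hv rfl
  obtain ⟨c, rfl⟩ := G.exists_smul_eq hd
  have h1 := h r hr v
  rw [← m.smul_map_smul c f, LinearMap.smul_apply] at h1 hv
  rw [← one_smul ℂ (m.map (c • f) r v), smul_smul, mul_one] at h1
  have h2 : (c : ℂ) = 1 := smul_left_injective ℂ (right_ne_zero_of_smul hv) h1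
  rw [Units.val_eq_one.1 h2, one_smul]

/-- Composing `h` with the evaluation of some arrow `x → y'` over `q` gives a nonzero map `V y → V
y'`. Hence `y = y'`, and Schur's lemma turns the composite into a scalar. -/
theorem exists_evalEquiv_symm_eq [hV : IsSimpleFamily S V] {x y : ActionCategory Q X} {q : Q}
    {h : V y.back →ₗ[S] R.act q (V x.back)} (hh : h ≠ 0) :
    ∃ (f : G.Hom x y) (hf : G.degree f = q), ∀ v, (m.evalEquiv f hf).symm v = h v := by
  obtain ⟨y', f, hf⟩ := G.exists_arrow x q
  have hT : (m.evalEquiv f hf).toLinearMap ∘ₗ h ≠ 0 := fun h0 => hh (LinearMap.ext fun v => by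
    have := LinearMap.congr_fun h0 v
    exact (m.evalEquiv f hf).map_eq_zero_iff.1 this)
  obtain rfl : y = y' := actionCategory_back_injective (IsSimpleFamily.eq_of_ne_zero hT)
  have := hV.simple y.back
  have := hV.finite y.back
  obtain ⟨c, hc⟩ := exists_smul_of_isSimpleModule ((m.evalEquiv f hf).toLinearMap ∘ₗ h)
  have hc0 : c ≠ 0 := by
    rintro rfl
    exact hT (LinearMap.ext fun v => by rw [hc, zero_smul, LinearMap.zero_apply])
  -- Rescaling `f` by `c` divides its evaluation by `c`, so the composite with `h` becomes the
  -- identity.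
  refine ⟨Units.mk0 c hc0 • f, by rw [G.degree_smul, hf], fun v => ?_⟩
  rw [LinearEquiv.symm_apply_eq, evalEquiv_apply]
  have h1 := m.eval_smul (Units.mk0 c hc0) f (h v)
  have h2 : m.eval f q (h v) = c • v := hc v
  rw [h2] at h1
  exact (smul_right_injective _ hc0 h1).symm

end GerbeModel

/-- Isomorphisms of gerbes are only required to respect composition; that they preserve identities
follows because an idempotent arrow of a groupoid is an identity. -/
theorem SOneGerbe.eq_id_of_comp_self {Γ : Type w} [Groupoid.{v} Γ] (G : SOneGerbe.{u} Γ) {x : Γ}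
    {f : G.Hom x x} (h : G.comp f f = f) : f = G.id x := by
  obtain ⟨g, hg, -⟩ := G.exists_inv f
  rw [← hg]
  nth_rw 2 [← h]
  rw [G.assoc, hg, G.comp_id]

/-! ### Uniqueness of the gerbe and of the extension of a model -/

namespace GerbeModel

variable {Q S : Type u} [Group Q] [Ring S] [Algebra ℂ S] {X : Type w} [MulAction Q X]
  {V : X → Type u} [∀ x, AddCommGroup (V x)] [∀ x, Module S (V x)] [∀ x, Module ℂ (V x)]
  {R R' : QExtension Q S} {G G' : SOneGerbe.{v} (ActionCategory Q X)}

/-- Transport of a model along an isomorphism of extensions. -/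
def ofExtensionIso (m : GerbeModel V R G) (e : QExtension.Iso R R') : GerbeModel V R' G :=
  have he : ∀ {q : Q} {r : R'.carrier}, r ∈ R'.grade q → e.toAlgEquiv.symm r ∈ R.grade q := by
    intro q r hr
    rw [← e.map_grade] at hr
    obtain ⟨r, hr, rfl⟩ := hr
    simpa using hr
  { map := fun f => m.map f ∘ₗ e.toAlgEquiv.symm.toLinearMap
    smul_map_smul := fun c f r => m.smul_map_smul c f _
    map_of_ne := fun f _ hp r hr => m.map_of_ne f hp _ (he hr)
    map_comp := fun f g a ha b hb v => by
      simpa using! m.map_comp f g _ (he ha) _ (he hb) v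
    map_id := fun x s v => by
      rw [← m.map_id x s v, ← e.map_incl s]
      simp }

/-- Transport of a model along an isomorphism of gerbes. -/
def ofGerbeIso (m : GerbeModel V R G) (e : SOneGerbe.Iso G G') : GerbeModel V R G' :=
  have hd : ∀ {x y : ActionCategory Q X} (f : G'.Hom x y),
      G.degree ((e.equiv x y).symm f) = G'.degree f := fun {x y} f => by
    have := e.map_proj ((e.equiv x y).symm f)
    rw [Equiv.apply_symm_apply] at this
    exact congrArg Subtype.val this.symm
  { map := fun {x y} f => m.map ((e.equiv x y).symm f)
    smul_map_smul := fun {x y} c f r => by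
      rw [← m.smul_map_smul c ((e.equiv x y).symm f)]
      congr 3
      rw [Equiv.symm_apply_eq, e.map_smul, Equiv.apply_symm_apply]
    map_of_ne := fun f _ hp r hr => m.map_of_ne _ (by rwa [hd]) r hr
    map_comp := fun {x y z} f g a ha b hb v => by
      rw [← m.map_comp _ _ a (by rwa [hd]) b (by rwa [hd])]
      congr 3
      rw [Equiv.symm_apply_eq, e.map_comp, Equiv.apply_symm_apply, Equiv.apply_symm_apply]
    map_id := fun x s v => by
      rw [← m.map_id x s v]
      congr 3
      rw [Equiv.symm_apply_eq]
      exact (G'.eq_id_of_comp_self (by rw [← e.map_comp, G.id_comp])).symm }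

variable [∀ x, IsScalarTower ℂ S (V x)] [hV : IsSimpleFamily S V]

/-- The operators of `f` are a nonzero multiple of those of any arrow of `G'` over the same element,
since such bimodule maps form a line; the multiple is absorbed by rescaling the arrow. -/
theorem exists_map_eq_map (m : GerbeModel V R G) (m' : GerbeModel V R G')
    {x y : ActionCategory Q X} (f : G.Hom x y) : ∃ f' : G'.Hom x y, m'.map f' = m.map f := by
  obtain ⟨f', hf'⟩ := G'.exists_degree_eq (G.degree_smul_back f)
  obtain ⟨c, hc⟩ := m'.exists_eq_smul f' (β := m.map f) (fun r s v => m.map_incl_mul f s r v)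
    (fun r s v => m.map_mul_incl f s r v) (fun p hp r hr => m.map_of_ne f (hf' ▸ hp) r hr)
  have hc0 : c ≠ 0 := by
    rintro rfl
    obtain ⟨r, -, v, hv⟩ := m.exists_map_ne_zero f
    rw [hc, zero_smul] at hv
    exact hv rfl
  refine ⟨(Units.mk0 c hc0)⁻¹ • f', LinearMap.ext fun r => ?_⟩
  rw [m'.map_smul, hc]
  simp

/-- The gerbe of an extension is unique up to isomorphism. -/
theorem nonempty_gerbeIso (m : GerbeModel V R G) (m' : GerbeModel V R G') :
    Nonempty (SOneGerbe.Iso G G') := by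
  -- Arrows of the two gerbes correspond when they have the same operators. As operators determine
  -- arrows, every required property can be tested on them.
  choose φ hφ using fun (x y : ActionCategory Q X) (f : G.Hom x y) => m.exists_map_eq_map m' f
  have inj : ∀ (x y : ActionCategory Q X) (f f' : G'.Hom x y), m'.map f = m'.map f' → f = f' :=
    fun x y f f' h => m'.map_injective fun r _ v => by rw [h]
  have hd : ∀ (x y : ActionCategory Q X) (f : G.Hom x y), G'.degree (φ x y f) = G.degree f := by
    intro x y f
    by_contra hne
    obtain ⟨r, hr, v, hv⟩ := m.exists_map_ne_zero f
    rw [← hφ, m'.map_of_ne _ (Ne.symm hne) r hr] at hv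
    exact hv rfl
  refine ⟨⟨fun x y => Equiv.ofBijective (φ x y) ⟨fun f f' h => ?_, fun f' => ?_⟩,
    fun {x y z} f g => ?_, fun f => Subtype.ext (hd _ _ f), fun {x y} c f => ?_⟩⟩
  · exact m.map_injective fun r _ v => by rw [← hφ, h, hφ]
  · obtain ⟨f, hf⟩ := m'.exists_map_eq_map m f'
    exact ⟨f, inj _ _ _ _ (by rw [hφ, hf])⟩
  · refine m'.map_injective fun r hr v => ?_
    have hr : r ∈ R.grade (G'.degree (φ x z (G.comp f g))) := hr
    have : ∀ r ∈ R.grade (G.degree g * G.degree f), m'.map (φ x z (G.comp f g)) r =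
        m'.map (G'.comp (φ x y f) (φ y z g)) r := by
      intro r hr
      refine R.eq_of_mul_mem (fun a ha b hb => LinearMap.ext fun v => ?_) hr
      rw [hφ, m.map_comp f g a ha b hb, m'.map_comp _ _ a (by rwa [hd]) b (by rwa [hd]), hφ, hφ]
    exact LinearMap.congr_fun (this r (by rwa [hd, G.degree_comp] at hr)) v
  · refine inj _ _ _ _ (LinearMap.ext fun r => ?_)
    change m'.map (φ x y (c • f)) r = m'.map (c • φ x y f) r
    rw [hφ, m.map_smul, m'.map_smul, hφ]

/-- Choose one arrow over `q` from each source and realize the prescribed operator there. The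
realizations vanish on the other sources, so they can be added, and equivariance settles the
remaining arrows over `q`. -/
theorem exists_mem_map_eq [Finite X] (m : GerbeModel V R G)
    (T : ∀ {x y : ActionCategory Q X}, G.Hom x y → V x.back →ₗ[ℂ] V y.back)
    (hT : ∀ {x y : ActionCategory Q X} (c : ℂˣ) (f : G.Hom x y), T (c • f) = (c⁻¹ : ℂ) • T f)
    (q : Q) : ∃ r ∈ R.grade q, ∀ {x y : ActionCategory Q X} (f : G.Hom x y), G.degree f = q →
      m.map f r = T f := by
  have := Finite.of_equiv X (ActionCategory.objEquiv Q X)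
  have := Fintype.ofFinite (ActionCategory Q X)
  choose y g hg using fun x : ActionCategory Q X => G.exists_arrow x q
  choose r hr hrT hr0 using fun x => m.exists_map_eq (g x) (T (g x))
  refine ⟨∑ x, r x, sum_mem fun x _ => hg x ▸ hr x, fun {x z} f hf => ?_⟩
  obtain rfl : y x = z := actionCategory_back_injective (by
    rw [← G.degree_smul_back f, ← G.degree_smul_back (g x), hg, hf])
  obtain ⟨c, rfl⟩ := G.exists_smul_eq ((hg x).trans hf.symm)
  rw [hT, m.map_smul, map_sum, Finset.sum_eq_single x, hrT]
  · intro x' _ hx'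
    exact hr0 x' _ fun h => hx' (actionCategory_back_injective h.symm)
  · simp

theorem eq_of_mem (m : GerbeModel V R G) {q : Q} {r r' : R.carrier} (hr : r ∈ R.grade q)
    (hr' : r' ∈ R.grade q) (h : ∀ x, ∃ (y : ActionCategory Q X) (f : G.Hom x y),
      G.degree f = q ∧ m.map f r = m.map f r') : r = r' := by
  refine m.eq_of_map_eq fun {x z} f => ?_
  by_cases hf : G.degree f = q
  · obtain ⟨y, g, hg, h⟩ := h x
    obtain rfl : y = z := actionCategory_back_injective (by
      rw [← G.degree_smul_back f, ← G.degree_smul_back g, hg, hf])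
    obtain ⟨c, rfl⟩ := G.exists_smul_eq (hg.trans hf.symm)
    rw [m.map_smul, m.map_smul, h]
  · rw [m.map_of_ne f (Ne.symm hf) r hr, m.map_of_ne f (Ne.symm hf) r' hr']

/-- The extension of a gerbe is unique up to isomorphism. -/
theorem nonempty_extensionIso [Finite X] (m : GerbeModel V R G) (m' : GerbeModel V R' G) :
    Nonempty (QExtension.Iso R R') := by
  have exists_mem : ∀ {R R' : QExtension Q S} (m : GerbeModel V R G) (m' : GerbeModel V R' G)
      (q : Q) (r : R.carrier) (_ : r ∈ R.grade q), ∃ r' ∈ R'.grade q,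
        ∀ {x y : ActionCategory Q X} (f : G.Hom x y), m'.map f r' = m.map f r := by
    intro R R' m m' q r hr
    obtain ⟨r', hr', h⟩ := m'.exists_mem_map_eq (fun f => m.map f r) (fun c f => m.map_smul c f r) q
    refine ⟨r', hr', fun f => ?_⟩
    by_cases hf : G.degree f = q
    · exact h f hf
    · rw [m.map_of_ne f (Ne.symm hf) r hr, m'.map_of_ne f (Ne.symm hf) r' hr']
  have exists_eq : ∀ {R R' : QExtension Q S} (m : GerbeModel V R G) (m' : GerbeModel V R' G)
      (r : R.carrier), ∃ r' : R'.carrier,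
        ∀ (x y : ActionCategory Q X) (f : G.Hom x y), m'.map f r' = m.map f r := by
    intro R R' m m' r
    induction r using R.homogeneous_induction with
    | mem q r hr =>
      obtain ⟨r', -, h⟩ := exists_mem m m' q r hr
      exact ⟨r', fun _ _ f => h f⟩
    | add a b ha hb =>
      obtain ⟨a', ha⟩ := ha
      obtain ⟨b', hb⟩ := hb
      exact ⟨a' + b', fun x y f => by rw [map_add, map_add, ha, hb]⟩
  -- The image of `r` is the unique element of `R'` with the same operators, and uniqueness yields
  -- linearity, multiplicativity and compatibility with `S`.
  choose φ hφ using exists_eq m m'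
  have uniq : ∀ {r r'}, (∀ {x y : ActionCategory Q X} (f : G.Hom x y),
      m'.map f r' = m.map f r) → φ r = r' := fun h => m'.eq_of_map_eq fun f => by rw [hφ, h]
  have hmem : ∀ {q r}, r ∈ R.grade q → φ r ∈ R'.grade q := fun {q r} hr => by
    obtain ⟨r', hr', h⟩ := exists_mem m m' q r hr
    exact uniq h ▸ hr'
  let Φ : R.carrier →ₗ[ℂ] R'.carrier :=
    { toFun := φ
      map_add' := fun a b => uniq fun f => by rw [map_add, map_add, hφ, hφ]
      map_smul' := fun c a => uniq fun f => by
        rw [LinearMap.map_smul, LinearMap.map_smul, hφ, RingHom.id_apply] }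
  have hincl : ∀ s, φ (R.incl s) = R'.incl s := fun s =>
    m'.eq_of_mem (hmem (R.incl_mem s)) (R'.incl_mem s) fun x => ⟨x, G.id x, G.degree_id x,
      LinearMap.ext fun v => by rw [hφ, m.map_id, m'.map_id]⟩
  have hmul : ∀ a b, Φ (a * b) = Φ a * Φ b := by
    intro a b
    induction a using R.homogeneous_induction with
    | mem p a ha =>
      induction b using R.homogeneous_induction with
      | mem q b hb =>
        refine m'.eq_of_mem (hmem (R.mul_mem ha hb)) (R'.mul_mem (hmem ha) (hmem hb)) fun x => ?_
        obtain ⟨y, f, rfl⟩ := G.exists_arrow x q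
        obtain ⟨z, g, rfl⟩ := G.exists_arrow y p
        refine ⟨z, G.comp f g, G.degree_comp f g, LinearMap.ext fun v => ?_⟩
        change m'.map (G.comp f g) (φ (a * b)) v = m'.map (G.comp f g) (φ a * φ b) v
        rw [m'.map_comp f g _ (hmem ha) _ (hmem hb), hφ, hφ, hφ, m.map_comp f g a ha b hb]
      | add b c hb hc => rw [mul_add, map_add, hb, hc, map_add, mul_add]
    | add a c ha hc => rw [add_mul, map_add, ha, hc, map_add, add_mul]
  have hone : Φ 1 = 1 := by
    have := hincl 1
    rwa [map_one, map_one] at this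
  refine ⟨⟨AlgEquiv.ofBijective (AlgHom.ofLinearMap Φ hone hmul) ⟨?_, ?_⟩, fun q => ?_, hincl⟩⟩
  · rw [injective_iff_map_eq_zero]
    intro r hr
    have hr : φ r = 0 := hr
    exact m.eq_zero fun f => by rw [← hφ, hr, map_zero]
  · intro r'
    obtain ⟨r, hr⟩ := exists_eq m' m r'
    exact ⟨r, uniq fun f => (hr _ _ f).symm⟩
  · refine le_antisymm ?_ fun r' hr' => ?_
    · rintro _ ⟨r, hr, rfl⟩
      exact hmem hr
    · obtain ⟨r, hr, h⟩ := exists_mem m' m q r' hr'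
      exact ⟨r, hr, uniq fun f => (h f).symm⟩

end GerbeModel

/-! ### Models and identifications of gerbes -/

/-- The underlying types of a family of simple modules. -/
abbrev SimpleMod.family {S : Type u} [Ring S] (V : SimpleClass S → SimpleMod S) :
    SimpleClass S → Type u :=
  fun i => (V i).1

section

variable {Q S : Type u} [Group Q] [Ring S] [Algebra ℂ S] [MulAction Q (SimpleClass S)]
  {V : SimpleClass S → SimpleMod S} {R : QExtension Q S}
  {G : SOneGerbe.{u} (ActionCategory Q (SimpleClass S))}

namespace QExtension

theorem HasBand.nonempty_act_equiv (hR : R.HasBand) (hV : ∀ i, (V i).toClass = i) (q : Q)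
    (i : SimpleClass S) :
    Nonempty (R.act q (SimpleMod.family V i) ≃ₗ[S] SimpleMod.family V (q • i)) := by
  obtain ⟨W, hW, ⟨e⟩⟩ := hR q (V i)
  rw [hV] at hW
  obtain ⟨e'⟩ : Nonempty (W.1 ≃ₗ[S] (V (q • i)).1) := Quotient.exact (hW.trans (hV (q • i)).symm)
  exact ⟨e.trans e'⟩

end QExtension

namespace GerbeIdentification

/-- The band makes `R_q ⊗_S V x` simple, and a nonzero map between simple modules is bijective. -/
theorem bijective (I : GerbeIdentification V R G) (hR : R.HasBand)
    {x y : ActionCategory Q (SimpleClass S)} {q : Q} (f : {f : G.Hom x y // (G.proj f).val = q}) :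
    Function.Bijective (I.equiv x y q f).1 := by
  obtain ⟨W, -, ⟨e⟩⟩ := hR q (V x.back)
  have := W.2
  have := (V y.back).2
  have : IsSimpleModule S (R.act q (V x.back).1) := IsSimpleModule.congr e
  exact (LinearMap.bijective_or_eq_zero _).resolve_right (I.equiv x y q f).2

end GerbeIdentification

variable [∀ i, Module ℂ (V i).1] [∀ i, IsScalarTower ℂ S (V i).1]

namespace GerbeModel

theorem hasBand [IsSimpleFamily S (SimpleMod.family V)]
    (m : GerbeModel (SimpleMod.family V) R G) (hV : ∀ i, (V i).toClass = i) : R.HasBand := by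
  intro q W
  obtain ⟨e⟩ : Nonempty (W.1 ≃ₗ[S] (V W.toClass).1) := Quotient.exact (hV W.toClass).symm
  obtain ⟨f, hf⟩ := G.exists_degree_eq (x := (W.toClass : ActionCategory Q (SimpleClass S)))
    (y := (q • W.toClass : SimpleClass S)) (q := q) rfl
  exact ⟨V (q • W.toClass), hV _, ⟨(R.actCongr q e).trans (m.evalEquiv f hf)⟩⟩

/-- The identification of the gerbe of a model with the gerbe of the extension. -/
noncomputable def toIdentification [IsSimpleFamily S (SimpleMod.family V)]
    (m : GerbeModel (SimpleMod.family V) R G) : GerbeIdentification V R G where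
  -- An arrow corresponds to the inverse of its evaluation map, which is nonzero because `V y` is.
  equiv x y q := Equiv.ofBijective
    (fun f => ⟨(m.evalEquiv f.1 f.2).symm.toLinearMap, fun h0 => by
      have := IsSimpleFamily.nontrivial S (SimpleMod.family V) y.back
      obtain ⟨v, hv⟩ := exists_ne (0 : SimpleMod.family V y.back)
      exact hv ((m.evalEquiv f.1 f.2).symm.map_eq_zero_iff.1 (LinearMap.congr_fun h0 v))⟩)
    ⟨fun f f' h => Subtype.ext <| m.map_injective fun r hr v => by
        have h1 : (m.evalEquiv f.1 f.2).symm = (m.evalEquiv f'.1 f'.2).symm :=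
          LinearEquiv.toLinearMap_injective (congrArg Subtype.val h)
        have h2 : m.evalEquiv f.1 f.2 = m.evalEquiv f'.1 f'.2 := by
          rw [← LinearEquiv.symm_symm (m.evalEquiv f.1 f.2), h1, LinearEquiv.symm_symm]
        exact LinearEquiv.congr_fun h2
          (balancedTmul S (⟨r, (f.2 : G.degree f.1 = q) ▸ hr⟩ : R.grade q) v),
      fun h => by
        obtain ⟨f, hf, h'⟩ := m.exists_evalEquiv_symm_eq h.2
        exact ⟨⟨f, hf⟩, Subtype.ext (LinearMap.ext h')⟩⟩
  equiv_smul := by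
    rintro x y q c ⟨f, hf⟩ ⟨f', hf'⟩ rfl v
    exact m.evalEquiv_smul_symm c f hf hf' v
  equiv_comp := by
    rintro x y z p q ⟨f, hf⟩ ⟨g, hg⟩ ⟨k, hk⟩ rfl
    refine LinearMap.ext fun v => ?_
    refine ((m.evalEquiv (G.comp f g) hk).symm_apply_eq).2 ?_
    refine Eq.trans ?_ (m.eval_extend f g hf hg ((m.evalEquiv g hg).symm v)).symm
    exact ((m.evalEquiv g hg).apply_symm_apply v).symm

end GerbeModel

namespace GerbeIdentification

/-- The inverse of the map `V y → R_q ⊗_S V x` of an arrow. -/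
noncomputable def evalEquiv (I : GerbeIdentification V R G) (hR : R.HasBand)
    {x y : ActionCategory Q (SimpleClass S)} (f : G.Hom x y) (q : Q) (hq : G.degree f = q) :
    R.act q (SimpleMod.family V x.back) ≃ₗ[S] SimpleMod.family V y.back :=
  (LinearEquiv.ofBijective (I.equiv x y q ⟨f, hq⟩).1 (I.bijective hR ⟨f, hq⟩)).symm

theorem equiv_evalEquiv (I : GerbeIdentification V R G) (hR : R.HasBand)
    {x y : ActionCategory Q (SimpleClass S)} (f : G.Hom x y) (q : Q) (hq : G.degree f = q)
    (t : R.act q (SimpleMod.family V x.back)) :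
    (I.equiv x y q ⟨f, hq⟩).1 (I.evalEquiv hR f q hq t) = t :=
  (LinearEquiv.ofBijective (I.equiv x y q ⟨f, hq⟩).1 (I.bijective hR ⟨f, hq⟩)).apply_symm_apply t

theorem equiv_injective (I : GerbeIdentification V R G) (hR : R.HasBand)
    {x y : ActionCategory Q (SimpleClass S)} (f : G.Hom x y) (q : Q) (hq : G.degree f = q) :
    Function.Injective (I.equiv x y q ⟨f, hq⟩).1 :=
  (I.bijective hR ⟨f, hq⟩).1

/-- The operators of the arrows of the gerbe of an extension. -/
noncomputable def operator (I : GerbeIdentification V R G) (hR : R.HasBand)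
    {x y : ActionCategory Q (SimpleClass S)} (f : G.Hom x y) :
    R.carrier →ₗ[ℂ] SimpleMod.family V x.back →ₗ[ℂ] SimpleMod.family V y.back :=
  R.operator (G.degree f) (I.evalEquiv hR f _ rfl).toLinearMap

theorem operator_of_mem (I : GerbeIdentification V R G) (hR : R.HasBand)
    {x y : ActionCategory Q (SimpleClass S)} (f : G.Hom x y) {q : Q} (hq : G.degree f = q)
    {r : R.carrier} (hr : r ∈ R.grade q) (v : SimpleMod.family V x.back) :
    I.operator hR f r v = I.evalEquiv hR f q hq (balancedTmul S (⟨r, hr⟩ : R.grade q) v) := by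
  subst hq
  exact R.operator_of_mem _ hr v

/-- The map of the composite arrow is injective, and applying it to both sides reduces the claim to
the composition rule of the identification. On pure tensors this is the multiplicativity of the
operators. -/
theorem evalEquiv_leftMul (I : GerbeIdentification V R G) (hR : R.HasBand)
    {x y z : ActionCategory Q (SimpleClass S)} (f : G.Hom x y) (g : G.Hom y z) {p q : Q}
    (hf : G.degree f = q) (hg : G.degree g = p) (hfg : G.degree (G.comp f g) = p * q)
    (a : R.grade p) (t : R.act q (SimpleMod.family V x.back)) :
    I.evalEquiv hR (G.comp f g) (p * q) hfg (R.leftMul p q _ a t) =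
      I.evalEquiv hR g p hg (balancedTmul S a (I.evalEquiv hR f q hf t)) := by
  apply I.equiv_injective hR (G.comp f g) (p * q) hfg
  rw [equiv_evalEquiv, I.equiv_comp x y z p q ⟨f, hf⟩ ⟨g, hg⟩ ⟨_, hfg⟩ rfl, LinearMap.comp_apply,
    equiv_evalEquiv, R.extend_tmul, equiv_evalEquiv]

/-- The model of an extension by the operators of its gerbe. -/
noncomputable def toModel (I : GerbeIdentification V R G) (hR : R.HasBand) :
    GerbeModel (SimpleMod.family V) R G :=
  have comp : ∀ {x y z : ActionCategory Q (SimpleClass S)} (f : G.Hom x y) (g : G.Hom y z),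
      ∀ a ∈ R.grade (G.degree g), ∀ b ∈ R.grade (G.degree f), ∀ v,
      I.operator hR (G.comp f g) (a * b) v = I.operator hR g a (I.operator hR f b v) := by
    intro x y z f g a ha b hb v
    rw [I.operator_of_mem hR f rfl hb, I.operator_of_mem hR g rfl ha,
      I.operator_of_mem hR (G.comp f g) (G.degree_comp f g) (R.mul_mem ha hb)]
    exact I.evalEquiv_leftMul hR f g rfl rfl (G.degree_comp f g) ⟨a, ha⟩
      (balancedTmul S (⟨b, hb⟩ : R.grade (G.degree f)) v)
  { map := fun f => I.operator hR f
    smul_map_smul := fun {x y} c f r => LinearMap.ext fun v => by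
      induction r using R.homogeneous_induction with
      | mem q r hr =>
        by_cases hq : G.degree f = q
        · rw [LinearMap.smul_apply, I.operator_of_mem hR f hq hr,
            I.operator_of_mem hR (c • f) ((G.degree_smul c f).trans hq) hr]
          apply I.equiv_injective hR f q hq
          rw [equiv_evalEquiv, ← algebraMap_smul S (c : ℂ), map_smul]
          refine (I.equiv_smul x y q c ⟨f, hq⟩ ⟨c • f, (G.degree_smul c f).trans hq⟩ rfl
            _).symm.trans
            (I.equiv_evalEquiv hR (c • f) q _ _)
        · rw [operator, R.operator_of_ne (by simpa using Ne.symm hq) _ hr, operator,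
            R.operator_of_ne (Ne.symm hq) _ hr, smul_zero]
      | add a b ha hb => rw [map_add, map_add, smul_add, LinearMap.add_apply, ha, hb]; rfl
    map_of_ne := fun f p hp r hr => R.operator_of_ne hp _ hr
    map_comp := comp
    map_id := fun x s v => by
      -- An identification says nothing about identity arrows. The operator of `1` at the identity
      -- is idempotent by multiplicativity, and injective, hence the identity.
      have h1 : ∀ w, I.operator hR (G.id x) 1 w = w := by
        intro w
        have hinj : ∀ w, I.operator hR (G.id x) 1 w = 0 → w = 0 := by
          intro w hw
          rw [I.operator_of_mem hR (G.id x) (G.degree_id x) R.one_mem,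
            LinearEquiv.map_eq_zero_iff] at hw
          -- The action map `R_1 ⊗_S V x → V x` shows that `1 ⊗ w` vanishes only for `w = 0`.
          have h3 := congrArg (R.evaluate 1 (W := SimpleMod.family V x.back)
            ((actionHom S (SimpleMod.family V x.back)).toLinearMap ∘ₗ R.degreeOne)
            (fun r s v => by simp [R.degreeOne_incl_mul])
            (fun r s v => by simp [R.degreeOne_mul_incl])) hw
          have h4 : R.degreeOne 1 • w = 0 := h3.trans (map_zero _)
          rwa [← map_one R.incl, R.degreeOne_incl, one_smul] at h4
        have h2 := comp (G.id x) (G.id x) 1 (by simpa using R.one_mem) 1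
          (by simpa using R.one_mem) w
        rw [G.id_comp, mul_one] at h2
        rw [← sub_eq_zero]
        refine hinj _ ?_
        rw [map_sub, ← h2, sub_self]
      rw [← mul_one (R.incl s), operator, R.operator_incl_mul]
      exact congrArg (s • ·) (h1 v) }

end GerbeIdentification

end

/-! ### The gerbe of a banded extension -/

namespace QExtension

variable {Q S : Type u} [Group Q] [Ring S] [Algebra ℂ S] (R : QExtension Q S)

/-- The nonzero bimodule maps `R_q → Hom (V, W)`, extended by zero to `R`. -/
structure IsOperator {V W : Type u} [AddCommGroup V] [Module S V] [Module ℂ V] [AddCommGroup W]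
    [Module S W] [Module ℂ W] (q : Q) (β : R.carrier →ₗ[ℂ] V →ₗ[ℂ] W) : Prop where
  incl_mul : ∀ r s v, β (R.incl s * r) v = s • β r v
  mul_incl : ∀ r s v, β (r * R.incl s) v = β r (s • v)
  of_ne : ∀ p, p ≠ q → ∀ r ∈ R.grade p, β r = 0
  ne_zero : β ≠ 0

variable {R}

namespace IsOperator

section

variable {V W U : Type u} [AddCommGroup V] [Module S V] [Module ℂ V] [AddCommGroup W]
  [Module S W] [Module ℂ W] [AddCommGroup U] [Module S U] [Module ℂ U] {p q : Q}
  {β β' : R.carrier →ₗ[ℂ] V →ₗ[ℂ] W} {γ : R.carrier →ₗ[ℂ] W →ₗ[ℂ] U}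

theorem eq_of_mem (hβ : R.IsOperator q β) (hβ' : R.IsOperator q β')
    (h : ∀ r ∈ R.grade q, β r = β' r) : β = β' := by
  refine LinearMap.ext fun r => ?_
  induction r using R.homogeneous_induction with
  | mem p r hr =>
    by_cases hp : p = q
    · exact h r (hp ▸ hr)
    · rw [hβ.of_ne p hp r hr, hβ'.of_ne p hp r hr]
  | add a b ha hb => rw [map_add, map_add, ha, hb]

theorem exists_ne_zero (hβ : R.IsOperator q β) : ∃ r ∈ R.grade q, ∃ v, β r v ≠ 0 := by
  by_contra! h
  refine hβ.ne_zero (LinearMap.ext fun r => ?_)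
  induction r using R.homogeneous_induction with
  | mem p r hr =>
    by_cases hp : p = q
    · exact LinearMap.ext (h r (hp ▸ hr))
    · exact hβ.of_ne p hp r hr
  | add a b ha hb => rw [map_add, ha, hb]; exact add_zero 0

theorem smul [IsScalarTower ℂ S W] (hβ : R.IsOperator q β) {c : ℂ} (hc : c ≠ 0) :
    R.IsOperator q (c • β) where
  incl_mul r s v := by
    rw [LinearMap.smul_apply, LinearMap.smul_apply, hβ.incl_mul, LinearMap.smul_apply,
      LinearMap.smul_apply]
    exact ((actionHom S W s).map_smul c _).symm
  mul_incl r s v := by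
    rw [LinearMap.smul_apply, LinearMap.smul_apply, hβ.mul_incl, LinearMap.smul_apply,
      LinearMap.smul_apply]
  of_ne p hp r hr := by rw [LinearMap.smul_apply, hβ.of_ne p hp r hr, smul_zero]
  ne_zero := smul_ne_zero hc hβ.ne_zero

variable (p) in
/-- The composition of operators of degrees `p` and `q`. -/
noncomputable def comp (β : R.carrier →ₗ[ℂ] V →ₗ[ℂ] W) (γ : R.carrier →ₗ[ℂ] W →ₗ[ℂ] U) :
    R.carrier →ₗ[ℂ] V →ₗ[ℂ] U :=
  -- Writing `r = ∑ a_k (b_k r)` splits `r` into products linearly in `r`, with no factorization of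
  -- `r` to choose.
  LinearMap.mk₂ ℂ (fun r v => ∑ k, γ (R.unitLeft p k) (β (R.unitRight p k * r) v))
    (fun r r' v => by simp [mul_add, Finset.sum_add_distrib])
    (fun c r v => by simp [Finset.smul_sum])
    (fun r v v' => by simp [Finset.sum_add_distrib])
    (fun c r v => by simp [Finset.smul_sum])

theorem comp_apply (r : R.carrier) (v : V) :
    comp p β γ r v = ∑ k, γ (R.unitLeft p k) (β (R.unitRight p k * r) v) :=
  rfl

/-- Since `b_k a` has degree one, it comes out of `β` as an element of `S` and enters `γ` on the
right, where `∑ a_k b_k = 1` applies. -/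
theorem comp_mul (hβ : R.IsOperator q β) (hγ : R.IsOperator p γ) {a : R.carrier}
    (ha : a ∈ R.grade p) (b : R.carrier) (v : V) : comp p β γ (a * b) v = γ a (β b v) := by
  have key : ∀ k, γ (R.unitLeft p k) (β (R.unitRight p k * (a * b)) v) =
      γ (R.unitLeft p k * R.unitRight p k * a) (β b v) := fun k => by
    obtain ⟨s, hs⟩ := R.exists_incl_eq (r := R.unitRight p k * a) (by
      simpa using R.mul_mem (R.unitRight_mem p k) ha)
    rw [← mul_assoc, ← hs, hβ.incl_mul, mul_assoc, ← hs, hγ.mul_incl]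
  rw [comp_apply, Finset.sum_congr rfl fun k _ => key k, ← LinearMap.sum_apply, ← map_sum,
    ← Finset.sum_mul, R.sum_unit, one_mul]

theorem isOperator_comp [IsSimpleModule S W] (hβ : R.IsOperator q β) (hγ : R.IsOperator p γ) :
    R.IsOperator (p * q) (comp p β γ) := by
  have hne : ∀ n, n ≠ p * q → ∀ r ∈ R.grade n, comp p β γ r = 0 := by
    intro n hn r hr
    refine LinearMap.ext fun v => ?_
    rw [comp_apply]
    refine Finset.sum_eq_zero fun k _ => ?_
    rw [hβ.of_ne (p⁻¹ * n) (fun h => hn (inv_mul_eq_iff_eq_mul.1 h)) _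
      (R.mul_mem (R.unitRight_mem p k) hr), LinearMap.zero_apply, map_zero]
  refine ⟨fun r s v => ?_, fun r s v => ?_, hne, fun h0 => ?_⟩
  · induction r using R.homogeneous_induction with
    | mem n r hr =>
      by_cases hn : n = p * q
      · subst hn
        rw [← R.grade_mul] at hr
        refine Submodule.mul_induction_on hr (fun a ha b _ => ?_) fun a b ha hb => ?_
        · rw [← mul_assoc, comp_mul hβ hγ (R.incl_mul_mem s ha), hγ.incl_mul, comp_mul hβ hγ ha]
        · simp only [mul_add, map_add, LinearMap.add_apply, ha, hb, smul_add]
      · rw [hne n hn r hr, hne n hn _ (R.incl_mul_mem s hr)]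
        simp
    | add a b ha hb => simp only [mul_add, map_add, LinearMap.add_apply, ha, hb, smul_add]
  · simp only [comp_apply, ← mul_assoc, hβ.mul_incl]
  · obtain ⟨b, hb, v, hv⟩ := hβ.exists_ne_zero
    obtain ⟨a, ha, w, hw⟩ := hγ.exists_ne_zero
    -- The composite is nonzero because the nonzero value `β b v` generates the simple module in the
    -- middle, so `S` moves it to a vector that `γ a` does not kill.
    obtain ⟨s, hs⟩ := IsSimpleModule.toSpanSingleton_surjective S hv w
    have h1 := comp_mul hβ hγ (R.mul_incl_mem s ha) b v
    rw [h0, hγ.mul_incl, show s • β b v = w from hs] at h1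
    exact hw h1.symm

theorem eq_comp [IsSimpleModule S W] (hβ : R.IsOperator q β) (hγ : R.IsOperator p γ) {n : Q}
    (hn : n = p * q) {δ : R.carrier →ₗ[ℂ] V →ₗ[ℂ] U} (hδ : R.IsOperator n δ)
    (h : ∀ a ∈ R.grade p, ∀ b ∈ R.grade q, ∀ v, δ (a * b) v = γ a (β b v)) :
    comp p β γ = δ := by
  subst hn
  exact (isOperator_comp hβ hγ).eq_of_mem hδ fun r hr => R.eq_of_mul_mem
    (fun a ha b hb => LinearMap.ext fun v => by rw [comp_mul hβ hγ ha, h a ha b hb]) hr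

theorem comp_comp {T : Type u} [AddCommGroup T] [Module S T] [Module ℂ T] [IsSimpleModule S W]
    [IsSimpleModule S U] {n : Q} {δ : R.carrier →ₗ[ℂ] U →ₗ[ℂ] T} (hβ : R.IsOperator q β)
    (hγ : R.IsOperator p γ) (hδ : R.IsOperator n δ) :
    comp n (comp p β γ) δ = comp (n * p) β (comp n γ δ) := by
  refine eq_comp (isOperator_comp hβ hγ) hδ (mul_assoc _ _ _)
    (isOperator_comp hβ (isOperator_comp hγ hδ)) fun a ha b hb v => ?_
  rw [← R.grade_mul] at hb
  refine Submodule.mul_induction_on hb (fun b hb c _ => ?_) fun b c hb hc => ?_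
  · rw [← mul_assoc, comp_mul hβ (isOperator_comp hγ hδ) (R.mul_mem ha hb), comp_mul hγ hδ ha,
      comp_mul hβ hγ hb]
  · simp only [mul_add, map_add, LinearMap.add_apply, hb, hc]

variable [IsScalarTower ℂ S V] [IsScalarTower ℂ S W]

/-- The operators of the identity arrow. -/
noncomputable def one (R : QExtension Q S) (V : Type u) [AddCommGroup V] [Module S V] [Module ℂ V]
    [IsScalarTower ℂ S V] : R.carrier →ₗ[ℂ] V →ₗ[ℂ] V :=
  (actionHom S V).toLinearMap ∘ₗ R.degreeOne

theorem one_incl (s : S) (v : V) : one R V (R.incl s) v = s • v := by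
  change R.degreeOne (R.incl s) • v = s • v
  rw [R.degreeOne_incl]

theorem isOperator_one [Nontrivial V] : R.IsOperator 1 (one R V) where
  incl_mul r s v := by
    change R.degreeOne _ • v = s • R.degreeOne r • v
    rw [R.degreeOne_incl_mul, mul_smul]
  mul_incl r s v := by
    change R.degreeOne _ • v = R.degreeOne r • s • v
    rw [R.degreeOne_mul_incl, mul_smul]
  of_ne p hp r hr := LinearMap.ext fun v => by
    change R.degreeOne r • v = 0
    rw [R.degreeOne_of_ne hp hr, zero_smul]
  ne_zero h := by
    obtain ⟨v, hv⟩ := exists_ne (0 : V)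
    have h1 := one_incl (R := R) 1 v
    rw [h, one_smul] at h1
    exact hv h1.symm

theorem evaluate_ne_zero (hβ : R.IsOperator q β) :
    R.evaluate q β hβ.incl_mul hβ.mul_incl ≠ 0 := by
  intro h
  obtain ⟨r, hr, v, hv⟩ := hβ.exists_ne_zero
  exact hv (LinearMap.congr_fun h (balancedTmul S (⟨r, hr⟩ : R.grade q) v))

/-- Both families induce maps from the simple module `R_q ⊗_S V` to `W`. The first is invertible,
and the second after its inverse is an endomorphism of `W`, a scalar by Schur's lemma. This gives
transitivity of the scalars on the fibres. -/
theorem exists_smul_eq [IsSimpleModule S W] [FiniteDimensional ℂ W]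
    [IsSimpleModule S (R.act q V)] (hβ : R.IsOperator q β) (hβ' : R.IsOperator q β') :
    ∃ c : ℂ, c ≠ 0 ∧ c • β = β' := by
  let E := LinearEquiv.ofBijective (R.evaluate q β hβ.incl_mul hβ.mul_incl)
    ((LinearMap.bijective_or_eq_zero _).resolve_right hβ.evaluate_ne_zero)
  obtain ⟨c, hc⟩ := exists_smul_of_isSimpleModule
    (R.evaluate q β' hβ'.incl_mul hβ'.mul_incl ∘ₗ E.symm.toLinearMap)
  have h : ∀ r ∈ R.grade q, ∀ v, c • β r v = β' r v := fun r hr v => by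
    have h1 := hc (E (balancedTmul S (⟨r, hr⟩ : R.grade q) v))
    rw [LinearMap.comp_apply, LinearEquiv.coe_coe, E.symm_apply_apply] at h1
    exact h1.symm
  have hc0 : c ≠ 0 := by
    rintro rfl
    obtain ⟨r, hr, v, hv⟩ := hβ'.exists_ne_zero
    exact hv (by rw [← h r hr v, zero_smul])
  exact ⟨c, hc0, (hβ.smul hc0).eq_of_mem hβ' fun r hr => LinearMap.ext (h r hr)⟩

theorem isOperator_operator [Nontrivial W] (E : R.act q V ≃ₗ[S] W) :
    R.IsOperator q (R.operator q E.toLinearMap) where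
  incl_mul r s v := R.operator_incl_mul _ s r v
  mul_incl r s v := R.operator_mul_incl _ s r v
  of_ne p hp r hr := R.operator_of_ne hp _ hr
  ne_zero h := by
    obtain ⟨w, hw⟩ := exists_ne (0 : W)
    refine hw ?_
    rw [← E.apply_symm_apply w]
    induction E.symm w using balancedTensor_induction with
    | h0 => exact map_zero E
    | hm r v =>
      exact (R.operator_of_mem E.toLinearMap r.2 v).symm.trans (by rw [h]; rfl)
    | ha x y hx hy => rw [map_add, hx, hy, add_zero]

end

end IsOperator

variable {X : Type w} [MulAction Q X] (V : X → Type u) [∀ x, AddCommGroup (V x)]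
  [∀ x, Module S (V x)] [∀ x, Module ℂ (V x)] [∀ x, IsScalarTower ℂ S (V x)]

variable (R) in
/-- The arrows of the gerbe of a banded extension. -/
structure OperatorArrow (x y : ActionCategory Q X) where
  /-- the arrow of the action groupoid -/
  proj : x ⟶ y
  /-- the operators -/
  operator : R.carrier →ₗ[ℂ] V x.back →ₗ[ℂ] V y.back
  isOperator : R.IsOperator proj.val operator

namespace OperatorArrow

variable {V}

theorem ext' {x y : ActionCategory Q X} {f g : R.OperatorArrow V x y}
    (h : f.proj.val = g.proj.val) (h' : f.operator = g.operator) : f = g := by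
  obtain ⟨f, β, hβ⟩ := f
  obtain ⟨g, γ, hγ⟩ := g
  obtain rfl : f = g := Subtype.ext h
  obtain rfl : β = γ := h'
  rfl

/-- Scalars act through their inverses, because operators stand for the inverses of the maps `V y →
R_q ⊗_S V x`. -/
instance (x y : ActionCategory Q X) : MulAction ℂˣ (R.OperatorArrow V x y) where
  smul c f := ⟨f.proj, ((c⁻¹ : ℂˣ) : ℂ) • f.operator, f.isOperator.smul (Units.ne_zero _)⟩
  one_smul f := ext' rfl (by
    change (((1 : ℂˣ)⁻¹ : ℂˣ) : ℂ) • f.operator = f.operator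
    simp)
  mul_smul c d f := ext' rfl (by
    change (((c * d)⁻¹ : ℂˣ) : ℂ) • f.operator =
      ((c⁻¹ : ℂˣ) : ℂ) • ((d⁻¹ : ℂˣ) : ℂ) • f.operator
    rw [smul_smul, mul_inv, Units.val_mul])

theorem smul_operator {x y : ActionCategory Q X} (c : ℂˣ) (f : R.OperatorArrow V x y) :
    (c • f).operator = ((c⁻¹ : ℂˣ) : ℂ) • f.operator :=
  rfl

end OperatorArrow

/-- The gerbe of an extension `R` such that `R_q ⊗_S V x` is isomorphic to `V (q • x)`. -/
noncomputable def operatorGerbe [hV : IsSimpleFamily S V]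
    (hR : ∀ (q : Q) (x : X), Nonempty (R.act q (V x) ≃ₗ[S] V (q • x))) :
    SOneGerbe.{u} (ActionCategory Q X) :=
  have simple : ∀ x, IsSimpleModule S (V x) := hV.simple
  have nontrivial : ∀ x, Nontrivial (V x) := IsSimpleFamily.nontrivial S V
  have finite : ∀ x, FiniteDimensional ℂ (V x) := hV.finite
  { Hom := fun x y => R.OperatorArrow V x y
    id := fun x => ⟨𝟙 x, IsOperator.one R _, IsOperator.isOperator_one⟩
    comp := fun f g => ⟨f.proj ≫ g.proj, IsOperator.comp g.proj.val f.operator g.operator,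
      IsOperator.isOperator_comp f.isOperator g.isOperator⟩
    id_comp := fun {x y} f => OperatorArrow.ext' (mul_one f.proj.val)
      (IsOperator.eq_comp IsOperator.isOperator_one f.isOperator (mul_one _).symm f.isOperator
        fun a ha b hb v => by
          obtain ⟨s, rfl⟩ := R.exists_incl_eq hb
          rw [f.isOperator.mul_incl, IsOperator.one_incl])
    comp_id := fun {x y} f => OperatorArrow.ext' (one_mul f.proj.val)
      (IsOperator.eq_comp f.isOperator IsOperator.isOperator_one (one_mul _).symm f.isOperator
        fun a ha b hb v => by
          obtain ⟨s, rfl⟩ := R.exists_incl_eq ha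
          rw [f.isOperator.incl_mul, IsOperator.one_incl])
    assoc := fun {x y z t} f g h => OperatorArrow.ext' (mul_assoc _ _ _).symm
      (IsOperator.comp_comp f.isOperator g.isOperator h.isOperator)
    proj := fun f => f.proj
    proj_id := fun x => rfl
    proj_comp := fun f g => rfl
    proj_surjective := fun x y f => by
      obtain ⟨E⟩ := hR f.val x.back
      have h : f.val • x.back = y.back := f.property
      rw [h] at E
      exact ⟨⟨f, R.operator f.val E.toLinearMap, IsOperator.isOperator_operator E⟩, rfl⟩
    smul_comp := fun c f g => OperatorArrow.ext' rfl (LinearMap.ext fun r =>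
      LinearMap.ext fun v => by
      change IsOperator.comp g.proj.val (((c⁻¹ : ℂˣ) : ℂ) • f.operator) g.operator r v =
        ((c⁻¹ : ℂˣ) : ℂ) • IsOperator.comp g.proj.val f.operator g.operator r v
      simp only [IsOperator.comp_apply, LinearMap.smul_apply, LinearMap.map_smul, Finset.smul_sum])
    comp_smul := fun c f g => OperatorArrow.ext' rfl (LinearMap.ext fun r =>
      LinearMap.ext fun v => by
      change IsOperator.comp g.proj.val f.operator (((c⁻¹ : ℂˣ) : ℂ) • g.operator) r v =
        ((c⁻¹ : ℂˣ) : ℂ) • IsOperator.comp g.proj.val f.operator g.operator r v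
      simp only [IsOperator.comp_apply, LinearMap.smul_apply, Finset.smul_sum])
    proj_smul := fun c f => rfl
    existsUnique_smul := fun {x y} f g h => by
      obtain ⟨E⟩ := hR f.proj.val x.back
      have : IsSimpleModule S (R.act f.proj.val (V x.back)) := IsSimpleModule.congr E
      obtain ⟨c, hc, h'⟩ := f.isOperator.exists_smul_eq (h ▸ g.isOperator)
      refine ⟨(Units.mk0 c hc)⁻¹, OperatorArrow.ext' (congrArg Subtype.val h) ?_, fun d hd => ?_⟩
      · rw [OperatorArrow.smul_operator, inv_inv]
        exact h'
      · have h1 : ((d⁻¹ : ℂˣ) : ℂ) • f.operator = c • f.operator := by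
          rw [h', ← hd, OperatorArrow.smul_operator]
        rw [eq_inv_iff_mul_eq_one, ← inv_eq_iff_mul_eq_one]
        exact Units.ext (smul_left_injective ℂ f.isOperator.ne_zero h1) }

/-- The tautological model of a banded extension. -/
noncomputable def operatorModel [hV : IsSimpleFamily S V]
    (hR : ∀ (q : Q) (x : X), Nonempty (R.act q (V x) ≃ₗ[S] V (q • x))) :
    GerbeModel V R (operatorGerbe V hR) where
  map f := f.operator
  smul_map_smul c f r := by
    change ((c : ℂ) • ((c⁻¹ : ℂˣ) : ℂ) • f.operator r) = f.operator r
    rw [smul_smul, Units.mul_inv, one_smul]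
  map_of_ne f p hp r hr := f.isOperator.of_ne p hp r hr
  map_comp f g a ha b _ v := IsOperator.comp_mul f.isOperator g.isOperator ha b v
  map_id x s v := IsOperator.one_incl s v

end QExtension

/-! ### The convolution algebra of a gerbe -/

namespace SOneGerbe

variable {Q : Type u} [Group Q] {X : Type w} [MulAction Q X]
  (G : SOneGerbe.{v} (ActionCategory Q X))

/-- A chosen arrow from `x` over `q`. -/
noncomputable def arrow (x : ActionCategory Q X) (q : Q) :
    G.Hom x (G.exists_arrow x q).choose :=
  (G.exists_arrow x q).choose_spec.choose

@[simp]
theorem degree_arrow (x : ActionCategory Q X) (q : Q) : G.degree (G.arrow x q) = q :=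
  (G.exists_arrow x q).choose_spec.choose_spec

theorem exists_comp_eq {x y z : ActionCategory Q X} (g : G.Hom x y) (f : G.Hom x z) :
    ∃ k : G.Hom y z, G.comp g k = f := by
  obtain ⟨h, hg, -⟩ := G.exists_inv g
  exact ⟨G.comp h f, by rw [← G.assoc, hg, G.id_comp]⟩

/-- The arrow `k` with `g ≫ k = f`. -/
noncomputable def quotient {x y z : ActionCategory Q X} (g : G.Hom x y) (f : G.Hom x z) :
    G.Hom y z :=
  (G.exists_comp_eq g f).choose

@[simp]
theorem comp_quotient {x y z : ActionCategory Q X} (g : G.Hom x y) (f : G.Hom x z) :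
    G.comp g (G.quotient g f) = f :=
  (G.exists_comp_eq g f).choose_spec

theorem comp_left_cancel {x y z : ActionCategory Q X} {g : G.Hom x y} {k k' : G.Hom y z}
    (h : G.comp g k = G.comp g k') : k = k' := by
  obtain ⟨g', -, hg⟩ := G.exists_inv g
  rw [← G.id_comp k, ← hg, G.assoc, h, ← G.assoc, hg, G.id_comp]

theorem quotient_smul {x y z : ActionCategory Q X} (c : ℂˣ) (g : G.Hom x y) (f : G.Hom x z) :
    G.quotient g (c • f) = c • G.quotient g f :=
  G.comp_left_cancel (g := g) (by rw [comp_quotient, G.comp_smul, comp_quotient])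

end SOneGerbe

section

variable {Q : Type u} [Group Q] {X : Type w} [MulAction Q X]
  (V : X → Type u) [∀ x, AddCommGroup (V x)] [∀ x, Module ℂ (V x)]
  (G : SOneGerbe.{v} (ActionCategory Q X))

/-- The operators on the arrows of a gerbe that are equivariant for the action of `ℂˣ`. -/
def equivariantOperators :
    Submodule ℂ (∀ x y : ActionCategory Q X, G.Hom x y → V x.back →ₗ[ℂ] V y.back) where
  carrier := {a | ∀ (x y : ActionCategory Q X) (c : ℂˣ) (f : G.Hom x y),
    a x y (c • f) = (c⁻¹ : ℂ) • a x y f}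
  add_mem' {a b} ha hb x y c f := by
    change a x y (c • f) + b x y (c • f) = (c⁻¹ : ℂ) • (a x y f + b x y f)
    rw [ha, hb, smul_add]
  zero_mem' x y c f := (smul_zero _).symm
  smul_mem' d a ha x y c f := by
    change d • a x y (c • f) = (c⁻¹ : ℂ) • d • a x y f
    rw [ha, smul_comm]

/-- The convolution algebra of a gerbe with coefficients in the operators between the members of
a family of vector spaces. -/
def GerbeAlgebra : Type _ :=
  equivariantOperators V G

namespace GerbeAlgebra

noncomputable instance : AddCommGroup (GerbeAlgebra V G) :=
  inferInstanceAs (AddCommGroup (equivariantOperators V G))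

noncomputable instance : Module ℂ (GerbeAlgebra V G) :=
  inferInstanceAs (Module ℂ (equivariantOperators V G))

/-- The set `X` may live in a larger universe, as the set of isomorphism classes does; finiteness
makes the functions indexed by it small. -/
instance [Finite X] : Small.{max u v} (GerbeAlgebra V G) :=
  have := Finite.of_equiv X (ActionCategory.objEquiv Q X)
  inferInstanceAs (Small.{max u v} (equivariantOperators V G))

variable {V G}

/-- The value at an arrow. -/
def op {x y : ActionCategory Q X} (f : G.Hom x y) :
    GerbeAlgebra V G →ₗ[ℂ] V x.back →ₗ[ℂ] V y.back where
  toFun a := a.1 x y f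
  map_add' _ _ := rfl
  map_smul' _ _ := rfl

theorem op_smul {x y : ActionCategory Q X} (c : ℂˣ) (f : G.Hom x y) (a : GerbeAlgebra V G) :
    op (c • f) a = (c⁻¹ : ℂ) • op f a :=
  a.2 x y c f

theorem ext {a b : GerbeAlgebra V G}
    (h : ∀ {x y : ActionCategory Q X} (f : G.Hom x y), op f a = op f b) : a = b :=
  Subtype.ext (funext fun _ => funext fun _ => funext fun f => h f)

/-- An element from its values. -/
def ofFun (T : ∀ {x y : ActionCategory Q X}, G.Hom x y → V x.back →ₗ[ℂ] V y.back)
    (hT : ∀ {x y : ActionCategory Q X} (c : ℂˣ) (f : G.Hom x y), T (c • f) = (c⁻¹ : ℂ) • T f) :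
    GerbeAlgebra V G :=
  ⟨fun _ _ f => T f, fun _ _ c f => hT c f⟩

@[simp]
theorem op_ofFun (T : ∀ {x y : ActionCategory Q X}, G.Hom x y → V x.back →ₗ[ℂ] V y.back)
    (hT : ∀ {x y : ActionCategory Q X} (c : ℂˣ) (f : G.Hom x y), T (c • f) = (c⁻¹ : ℂ) • T f)
    {x y : ActionCategory Q X} (f : G.Hom x y) : op f (ofFun T hT) = T f :=
  rfl

variable (V G) in
/-- The elements supported on the arrows over `q`. -/
def grade (q : Q) : Submodule ℂ (GerbeAlgebra V G) where
  carrier := {a | ∀ (x y : ActionCategory Q X) (f : G.Hom x y), G.degree f ≠ q → op f a = 0}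
  add_mem' ha hb x y f hf := by rw [map_add, ha x y f hf, hb x y f hf, add_zero]
  zero_mem' _ _ f _ := map_zero _
  smul_mem' c a ha x y f hf := by rw [LinearMap.map_smul, ha x y f hf, smul_zero]

theorem op_of_mem {q : Q} {a : GerbeAlgebra V G} (ha : a ∈ grade V G q) {x y : ActionCategory Q X}
    {f : G.Hom x y} (hf : G.degree f ≠ q) : op f a = 0 :=
  ha _ _ f hf

/-- Source and degree determine an arrow up to a scalar, and equivariance accounts for the scalar.
-/
theorem eq_of_mem {q : Q} {a b : GerbeAlgebra V G} (ha : a ∈ grade V G q) (hb : b ∈ grade V G q)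
    (h : ∀ x, ∃ (y : ActionCategory Q X) (f : G.Hom x y), G.degree f = q ∧ op f a = op f b) :
    a = b := by
  refine ext fun {x z} f => ?_
  by_cases hf : G.degree f = q
  · obtain ⟨y, g, hg, h⟩ := h x
    obtain rfl : y = z := actionCategory_back_injective (by
      rw [← G.degree_smul_back f, ← G.degree_smul_back g, hg, hf])
    obtain ⟨c, rfl⟩ := G.exists_smul_eq (hg.trans hf.symm)
    rw [op_smul, op_smul, h]
  · rw [op_of_mem ha hf, op_of_mem hb hf]

/-- The relation between the arrows `c • f` and the operators `c⁻¹ • φ`. -/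
inductive Extends {x y : ActionCategory Q X} (f : G.Hom x y) (φ : V x.back →ₗ[ℂ] V y.back) :
    ∀ {x' y' : ActionCategory Q X}, G.Hom x' y' → (V x'.back →ₗ[ℂ] V y'.back) → Prop
  | smul (c : ℂˣ) : Extends f φ (c • f) ((c⁻¹ : ℂ) • φ)

theorem Extends.eq {x y : ActionCategory Q X} {f : G.Hom x y} {φ : V x.back →ₗ[ℂ] V y.back}
    {x' y' : ActionCategory Q X} {f' : G.Hom x' y'} {φ' φ'' : V x'.back →ₗ[ℂ] V y'.back}
    (h : Extends f φ f' φ') (h' : Extends f φ f' φ'') : φ' = φ'' := by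
  obtain ⟨c⟩ := h
  generalize hf : c • f = f' at h'
  obtain ⟨d⟩ := h'
  rw [(G.existsUnique_smul f (d • f) (G.proj_smul d f).symm).unique hf rfl]

/-- The value `φ` at `f` is spread equivariantly over the scalar orbit of `f` and extended by zero;
freeness of the action (`Extends.eq`) makes this consistent. The relation `Extends` compares arrows
with different endpoints without transport along equalities. -/
theorem exists_single {x y : ActionCategory Q X} (f : G.Hom x y) (φ : V x.back →ₗ[ℂ] V y.back) :
    ∃ a ∈ grade V G (G.degree f), op f a = φ ∧
      ∀ {x' y' : ActionCategory Q X} (f' : G.Hom x' y'), x' ≠ x → op f' a = 0 := by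
  classical
  have key : ∀ {x' y' : ActionCategory Q X} (f' : G.Hom x' y'),
      ∃ φ' : V x'.back →ₗ[ℂ] V y'.back, (∀ ψ, Extends f φ f' ψ → φ' = ψ) ∧
        ((∀ ψ, ¬ Extends f φ f' ψ) → φ' = 0) := by
    intro x' y' f'
    by_cases h : ∃ φ', Extends f φ f' φ'
    · obtain ⟨φ', h⟩ := h
      exact ⟨φ', fun ψ hψ => h.eq hψ, fun h0 => absurd h (h0 φ')⟩
    · exact ⟨0, fun ψ hψ => absurd ⟨ψ, hψ⟩ h, fun _ => rfl⟩
  choose T hT hT0 using @key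
  refine ⟨ofFun T fun {x' y'} c f' => ?_, fun x' y' f' hf' => hT0 f' fun ψ hψ => ?_, ?_,
    fun {x' y'} f' hf' => hT0 f' fun ψ hψ => ?_⟩
  · by_cases h : ∃ φ', Extends f φ f' φ'
    · obtain ⟨φ', h⟩ := h
      rw [hT f' φ' h]
      obtain ⟨d⟩ := h
      rw [smul_smul, hT _ _ (Extends.smul (c * d)), smul_smul]
      congr 1
      simp [mul_comm]
    · rw [hT0 f' fun ψ hψ => h ⟨ψ, hψ⟩, smul_zero, hT0]
      intro ψ hψ
      generalize hg : c • f' = g at hψ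
      obtain ⟨d⟩ := hψ
      have h1 := Extends.smul (f := f) (φ := φ) (c⁻¹ * d)
      rw [mul_smul, ← hg, inv_smul_smul] at h1
      exact h ⟨_, h1⟩
  · obtain ⟨c⟩ := hψ
    exact hf' (G.degree_smul c f)
  · have h1 := Extends.smul (f := f) (φ := φ) 1
    rw [one_smul] at h1
    rw [op_ofFun, hT f _ h1]
    simp
  · obtain ⟨c⟩ := hψ
    exact hf' rfl

theorem exists_extend [Finite X] (q : Q) (y : ActionCategory Q X → ActionCategory Q X)
    (g : ∀ x, G.Hom x (y x)) (hg : ∀ x, G.degree (g x) = q)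
    (T : ∀ x : ActionCategory Q X, V x.back →ₗ[ℂ] V (y x).back) :
    ∃ a ∈ grade V G q, ∀ x, op (g x) a = T x := by
  have := Finite.of_equiv X (ActionCategory.objEquiv Q X)
  have := Fintype.ofFinite (ActionCategory Q X)
  choose a ha haT ha0 using fun x => exists_single (g x) (T x)
  refine ⟨∑ x, a x, sum_mem fun x _ => hg x ▸ ha x, fun x => ?_⟩
  rw [map_sum, Finset.sum_eq_single x, haT]
  · intro x' _ hx'
    exact ha0 x' _ hx'.symm
  · simp

/-- The part of the convolution product where the right factor has degree `q`. -/
noncomputable def mulTerm (q : Q) (a b : GerbeAlgebra V G) : GerbeAlgebra V G :=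
  ofFun (fun {x _} f => op (G.quotient (G.arrow x q) f) a ∘ₗ op (G.arrow x q) b)
    (fun c f => by rw [G.quotient_smul, op_smul, LinearMap.smul_comp])

/-- The product does not depend on the factorization of `f`: rescaling `g` by `c` rescales `k` by
`c⁻¹`, and the two factors cancel in the composite of operators. -/
theorem op_mulTerm {q : Q} {x y z : ActionCategory Q X} {f : G.Hom x z} {g : G.Hom x y}
    {k : G.Hom y z} (h : G.comp g k = f) (hg : G.degree g = q) (a b : GerbeAlgebra V G) :
    op f (mulTerm q a b) = op k a ∘ₗ op g b := by
  obtain rfl : (G.exists_arrow x q).choose = y := actionCategory_back_injective (by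
    rw [← G.degree_smul_back g, ← G.degree_smul_back (G.arrow x q), G.degree_arrow, hg])
  obtain ⟨c, rfl⟩ := G.exists_smul_eq ((G.degree_arrow x q).trans hg.symm)
  have hk : G.quotient (G.arrow x q) f = c • k := G.comp_left_cancel (by
    rw [G.comp_quotient, ← h, G.smul_comp, G.comp_smul])
  change op (G.quotient (G.arrow x q) f) a ∘ₗ op (G.arrow x q) b = _
  rw [hk, op_smul, op_smul, LinearMap.smul_comp, LinearMap.comp_smul]

theorem exists_one [Finite X] : ∃ e ∈ grade V G 1, ∀ x : ActionCategory Q X,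
    op (G.id x) e = LinearMap.id :=
  exists_extend 1 id G.id G.degree_id fun _ => LinearMap.id

variable [Fintype Q]

noncomputable instance : Mul (GerbeAlgebra V G) :=
  ⟨fun a b => ∑ q, mulTerm q a b⟩

theorem mul_def (a b : GerbeAlgebra V G) : a * b = ∑ q, mulTerm q a b :=
  rfl

/-- Any system of factorizations of `f` with one initial arrow in each degree computes the
convolution, which gives the freedom needed for associativity. -/
theorem op_mul {ι : Type*} [Fintype ι] (e : ι ≃ Q) {x z : ActionCategory Q X} (f : G.Hom x z)
    {y : ι → ActionCategory Q X} (g : ∀ i, G.Hom x (y i)) (k : ∀ i, G.Hom (y i) z)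
    (h : ∀ i, G.comp (g i) (k i) = f) (hg : ∀ i, G.degree (g i) = e i) (a b : GerbeAlgebra V G) :
    op f (a * b) = ∑ i, op (k i) a ∘ₗ op (g i) b := by
  rw [mul_def, map_sum, ← e.sum_comp]
  exact Finset.sum_congr rfl fun i _ => op_mulTerm (h i) (hg i) a b

theorem op_comp_mul_left {x y z : ActionCategory Q X} (g : G.Hom x y) (k : G.Hom y z)
    {a : GerbeAlgebra V G} (ha : a ∈ grade V G (G.degree k)) (b : GerbeAlgebra V G) :
    op (G.comp g k) (a * b) = op k a ∘ₗ op g b := by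
  rw [mul_def, map_sum, Finset.sum_eq_single (G.degree g), op_mulTerm rfl rfl]
  · intro q _ hq
    rw [op_mulTerm (G.comp_quotient (G.arrow x q) _) (G.degree_arrow x q), op_of_mem ha,
      LinearMap.zero_comp]
    intro h
    have h1 := congrArg G.degree (G.comp_quotient (G.arrow x q) (G.comp g k))
    rw [G.degree_comp, G.degree_comp, h, G.degree_arrow] at h1
    exact hq (mul_left_cancel h1)
  · simp

theorem op_comp_mul_right {x y z : ActionCategory Q X} (g : G.Hom x y) (k : G.Hom y z)
    (a : GerbeAlgebra V G) {b : GerbeAlgebra V G} (hb : b ∈ grade V G (G.degree g)) :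
    op (G.comp g k) (a * b) = op k a ∘ₗ op g b := by
  rw [mul_def, map_sum, Finset.sum_eq_single (G.degree g), op_mulTerm rfl rfl]
  · intro q _ hq
    rw [op_mulTerm (G.comp_quotient (G.arrow x q) _) (G.degree_arrow x q),
      op_of_mem hb (by rwa [G.degree_arrow]), LinearMap.comp_zero]
  · simp

noncomputable instance [Finite X] : One (GerbeAlgebra V G) :=
  ⟨exists_one.choose⟩

theorem one_mem [Finite X] : (1 : GerbeAlgebra V G) ∈ grade V G 1 :=
  exists_one.choose_spec.1

theorem op_id_one [Finite X] (x : ActionCategory Q X) :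
    op (G.id x) (1 : GerbeAlgebra V G) = LinearMap.id :=
  exists_one.choose_spec.2 x

theorem add_mul' (a b c : GerbeAlgebra V G) : (a + b) * c = a * c + b * c := by
  simp only [mul_def, ← Finset.sum_add_distrib]
  refine Finset.sum_congr rfl fun q _ => ext fun {x y} f => ?_
  rw [map_add]
  simp only [op_mulTerm (G.comp_quotient (G.arrow x q) f) (G.degree_arrow x q), map_add,
    LinearMap.add_comp]

theorem mul_add' (a b c : GerbeAlgebra V G) : a * (b + c) = a * b + a * c := by
  simp only [mul_def, ← Finset.sum_add_distrib]
  refine Finset.sum_congr rfl fun q _ => ext fun {x y} f => ?_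
  rw [map_add]
  simp only [op_mulTerm (G.comp_quotient (G.arrow x q) f) (G.degree_arrow x q), map_add,
    LinearMap.comp_add]

theorem smul_mul' (r : ℂ) (a b : GerbeAlgebra V G) : (r • a) * b = r • (a * b) := by
  simp only [mul_def, Finset.smul_sum]
  refine Finset.sum_congr rfl fun q _ => ext fun {x y} f => ?_
  rw [LinearMap.map_smul]
  simp only [op_mulTerm (G.comp_quotient (G.arrow x q) f) (G.degree_arrow x q),
    LinearMap.map_smul, LinearMap.smul_comp]

theorem mul_smul' (r : ℂ) (a b : GerbeAlgebra V G) : a * (r • b) = r • (a * b) := by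
  simp only [mul_def, Finset.smul_sum]
  refine Finset.sum_congr rfl fun q _ => ext fun {x y} f => ?_
  rw [LinearMap.map_smul]
  simp only [op_mulTerm (G.comp_quotient (G.arrow x q) f) (G.degree_arrow x q),
    LinearMap.map_smul, LinearMap.comp_smul]

theorem mul_assoc' (a b c : GerbeAlgebra V G) : a * b * c = a * (b * c) := by
  have hsum : a * (b * c) = ∑ q, a * mulTerm q b c :=
    map_sum (AddMonoidHom.mk' (fun t => a * t) (mul_add' a)) _ _
  rw [hsum, mul_def (a * b) c]
  refine Finset.sum_congr rfl fun q _ => ext fun {x z} f => ?_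
  rw [op_mulTerm (G.comp_quotient (G.arrow x q) f) (G.degree_arrow x q)]
  have hq := G.comp_quotient (G.arrow x q) f
  generalize G.quotient (G.arrow x q) f = k at hq ⊢
  -- Both sides sum over factorizations of `f` into three arrows, the first of degree `q` and the
  -- second of degree `p`. For `a * (b * c)` the first two are composed, so the initial arrow has
  -- degree `p * q`, whence the reindexing.
  rw [op_mul (Equiv.refl Q) k (fun p => G.arrow _ p) (fun p => G.quotient (G.arrow _ p) k)
      (fun p => G.comp_quotient _ _) (fun p => G.degree_arrow _ p),
    op_mul (Equiv.mulRight q) f (fun p => G.comp (G.arrow x q) (G.arrow _ p))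
      (fun p => G.quotient (G.arrow _ p) k) (fun p => by rw [G.assoc, G.comp_quotient, hq])
      (fun p => by simp)]
  ext v
  simp only [LinearMap.comp_apply, LinearMap.sum_apply]
  refine Finset.sum_congr rfl fun p _ => ?_
  rw [op_mulTerm rfl (G.degree_arrow x q)]
  rfl

noncomputable instance [Finite X] : Ring (GerbeAlgebra V G) where
  __ := (inferInstance : AddCommGroup (GerbeAlgebra V G))
  left_distrib := mul_add'
  right_distrib := add_mul'
  zero_mul a := by simpa using add_mul' 0 0 a
  mul_zero a := by simpa using mul_add' a 0 0
  mul_assoc := mul_assoc'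
  one_mul a := ext fun {x y} f => by
    rw [← G.comp_id f, op_comp_mul_left f (G.id y) (by simpa using one_mem), op_id_one,
      LinearMap.id_comp, G.comp_id]
  mul_one a := ext fun {x y} f => by
    rw [← G.id_comp f, op_comp_mul_right (G.id x) f a (by simpa using one_mem), op_id_one,
      LinearMap.comp_id, G.id_comp]

noncomputable instance [Finite X] : Algebra ℂ (GerbeAlgebra V G) :=
  Algebra.ofModule smul_mul' mul_smul'

end GerbeAlgebra

end

/-! ### The strong grading of the convolution algebra and its component of degree one -/

namespace GerbeAlgebra

section

variable {Q : Type u} [Group Q] {X : Type w} [MulAction Q X]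
  {V : X → Type u} [∀ x, AddCommGroup (V x)] [∀ x, Module ℂ (V x)]
  {G : SOneGerbe.{v} (ActionCategory Q X)}

theorem iSupIndep_grade : iSupIndep (grade V G) := by
  intro q
  rw [Submodule.disjoint_def]
  intro a ha ha'
  refine ext fun {x y} f => ?_
  rw [map_zero]
  by_cases hf : G.degree f = q
  · have : (⨆ p, ⨆ _ : p ≠ q, grade V G p) ≤ LinearMap.ker (op f) :=
      iSup₂_le fun p hp b hb => op_of_mem hb (by rw [hf]; exact hp.symm)
    exact this ha'
  · exact op_of_mem ha hf

theorem iSup_grade [Finite Q] : ⨆ q, grade V G q = ⊤ := by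
  classical
  have := Fintype.ofFinite Q
  refine eq_top_iff.2 fun a _ => ?_
  let b : Q → GerbeAlgebra V G := fun q => ofFun (fun f => if G.degree f = q then op f a else 0)
    (fun c f => by
      by_cases hf : G.degree f = q
      · rw [if_pos hf, if_pos (by rw [G.degree_smul, hf]), op_smul]
      · rw [if_neg hf, if_neg (by rwa [G.degree_smul]), smul_zero])
  have hb : ∀ q, b q ∈ grade V G q := fun q x y f hf => if_neg hf
  have hsum : a = ∑ q, b q := ext fun {x y} f => by
    rw [map_sum]
    simp [b]
  rw [hsum]
  exact sum_mem fun q _ => Submodule.mem_iSup_of_mem q (hb q)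

variable [Fintype Q] [Finite X]

theorem mul_mem {p q : Q} {a b : GerbeAlgebra V G} (ha : a ∈ grade V G p) (hb : b ∈ grade V G q) :
    a * b ∈ grade V G (p * q) := by
  intro x z f hf
  have h := G.comp_quotient (G.arrow x q) f
  rw [← h, op_comp_mul_right _ _ _ (by rwa [G.degree_arrow]), op_of_mem ha, LinearMap.zero_comp]
  intro hp
  rw [← h, G.degree_comp, hp, G.degree_arrow] at hf
  exact hf rfl

end

section

variable {Q S : Type u} [Group Q] [Ring S] [Algebra ℂ S] {X : Type w} [MulAction Q X]
  {V : X → Type u} [∀ x, AddCommGroup (V x)] [∀ x, Module S (V x)] [∀ x, Module ℂ (V x)]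
  [∀ x, IsScalarTower ℂ S (V x)]
  {G : SOneGerbe.{v} (ActionCategory Q X)} [Fintype Q] [Finite X]

variable (S) in
-- For each source `x`, an arrow over `p * q` factors as `g` followed by `k`. With `η w = 1` in the
-- intermediate space, the value of `c` is a sum over basis vectors `e_j` of products of rank one
-- operators: the right factor sends `e_j` to `w`, the left one sends `w` to the image of `e_j`
-- under `c`. The intermediate space being nonzero is what matters.
theorem grade_mul_grade [hV : IsSimpleFamily S V] (p q : Q) :
    grade V G p * grade V G q = grade V G (p * q) := by
  refine le_antisymm (Submodule.mul_le.2 fun a ha b hb => mul_mem ha hb) fun c hc => ?_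
  have := Finite.of_equiv X (ActionCategory.objEquiv Q X)
  have := Fintype.ofFinite (ActionCategory Q X)
  choose y g hg using fun x => G.exists_arrow x q
  choose z k hk using fun x => G.exists_arrow (y x) p
  choose w η hη using fun x => IsSimpleFamily.exists_dual S V (ActionCategory.back (y x))
  let B := fun x : ActionCategory Q X => IsSimpleFamily.basis S V x.back
  choose b hb hbT hb0 using fun x j => exists_single (V := V) (g x)
    (((B x).coord j).smulRight (w x))
  choose a ha haT _ using fun x j => exists_single (V := V) (k x)
    ((η x).smulRight (op (G.comp (g x) (k x)) c (B x j)))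
  simp only [hg] at hb
  simp only [hk] at ha
  have hsum : c = ∑ x, ∑ j, a x j * b x j := by
    refine eq_of_mem hc (sum_mem fun x _ => sum_mem fun j _ => mul_mem (ha x j) (hb x j))
      fun x => ⟨z x, G.comp (g x) (k x), by rw [G.degree_comp, hg, hk], (B x).ext fun i => ?_⟩
    rw [map_sum, Finset.sum_eq_single x]
    · rw [map_sum, LinearMap.sum_apply, Finset.sum_eq_single i]
      · rw [op_comp_mul_right _ _ _ (by rw [hg]; exact hb x i), hbT, haT]
        simp [hη]
      · intro j _ hj
        rw [op_comp_mul_right _ _ _ (by rw [hg]; exact hb x j), hbT, haT]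
        simp [Finsupp.single_eq_of_ne hj]
      · simp
    · intro x' _ hx'
      rw [map_sum]
      refine Finset.sum_eq_zero fun j _ => ?_
      rw [op_comp_mul_right _ _ _ (by rw [hg]; exact hb x' j), hb0 _ _ _ hx'.symm,
        LinearMap.comp_zero]
    · simp
  rw [hsum]
  exact sum_mem fun x _ => sum_mem fun j _ => Submodule.mul_mem_mul (ha x j) (hb x j)

theorem exists_incl (s : S) : ∃ a ∈ grade V G 1, ∀ x : ActionCategory Q X,
    op (G.id x) a = actionHom S (V x.back) s :=
  exists_extend 1 id G.id G.degree_id fun x => actionHom S (V x.back) s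

variable (V G)

/-- The element of degree one which acts as `s` on each member of the family. -/
noncomputable def inclFun (s : S) : GerbeAlgebra V G :=
  (exists_incl (V := V) (G := G) s).choose

theorem inclFun_mem (s : S) : inclFun V G s ∈ grade V G 1 :=
  (exists_incl (V := V) (G := G) s).choose_spec.1

theorem op_id_inclFun (s : S) (x : ActionCategory Q X) :
    op (G.id x) (inclFun V G s) = actionHom S (V x.back) s :=
  (exists_incl (V := V) (G := G) s).choose_spec.2 x

variable {V G} in
theorem eq_of_op_id {a b : GerbeAlgebra V G} (ha : a ∈ grade V G 1) (hb : b ∈ grade V G 1)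
    (h : ∀ x : ActionCategory Q X, op (G.id x) a = op (G.id x) b) : a = b :=
  eq_of_mem ha hb fun x => ⟨x, G.id x, G.degree_id x, h x⟩

/-- The inclusion of `S` into the convolution algebra. -/
noncomputable def incl : S →ₐ[ℂ] GerbeAlgebra V G :=
  AlgHom.ofLinearMap
    { toFun := inclFun V G
      map_add' := fun s t => eq_of_op_id (inclFun_mem V G _)
        (add_mem (inclFun_mem V G _) (inclFun_mem V G _)) fun x => by
          rw [map_add, op_id_inclFun, op_id_inclFun, op_id_inclFun, map_add]
      map_smul' := fun c s => eq_of_op_id (inclFun_mem V G _)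
        (Submodule.smul_mem _ _ (inclFun_mem V G _)) fun x => by
          rw [map_smul, op_id_inclFun, op_id_inclFun, map_smul, RingHom.id_apply] }
    (eq_of_op_id (inclFun_mem V G _) one_mem fun x => by
      rw [op_id_one]
      exact (op_id_inclFun V G _ x).trans (map_one _))
    (fun s t => eq_of_op_id (inclFun_mem V G _)
      (by simpa using mul_mem (inclFun_mem V G s) (inclFun_mem V G t)) fun x => by
        refine (op_id_inclFun V G _ x).trans ?_
        have h := op_comp_mul_right (G.id x) (G.id x) (inclFun V G s) (b := inclFun V G t)
          (by simpa using inclFun_mem V G t)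
        rw [G.id_comp, op_id_inclFun, op_id_inclFun] at h
        exact (map_mul _ s t).trans h.symm)

theorem incl_apply (s : S) : incl V G s = inclFun V G s :=
  rfl

variable [hV : IsSimpleFamily S V]

theorem incl_injective : Function.Injective (incl V G : S →ₐ[ℂ] GerbeAlgebra V G) := by
  intro s t h
  have key : ∀ x : ActionCategory Q X, actionHom S (V x.back) s = actionHom S (V x.back) t :=
    fun x => by rw [← op_id_inclFun V G, ← op_id_inclFun V G, ← incl_apply, h, incl_apply]
  exact IsSimpleFamily.ext V fun x v => LinearMap.congr_fun (key (x : ActionCategory Q X)) v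

/-- An element of degree one is determined by its values at the identities, a family of
endomorphisms of the members, and `S` realizes every such family. -/
theorem range_incl :
    LinearMap.range (incl V G : S →ₐ[ℂ] GerbeAlgebra V G).toLinearMap = grade V G 1 := by
  refine le_antisymm ?_ fun a ha => ?_
  · rintro _ ⟨s, rfl⟩
    exact inclFun_mem V G s
  · obtain ⟨s, hs⟩ := hV.bijective.2 fun x => op (G.id (x : ActionCategory Q X)) a
    refine ⟨s, eq_of_op_id (inclFun_mem V G s) ha fun x => ?_⟩
    exact (op_id_inclFun V G s x).trans (congrFun hs x.back)

end

end GerbeAlgebra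

/-! ### The extension and the model defined by the convolution algebra -/

section

variable {Q S : Type u} [Group Q] [Ring S] [Algebra ℂ S] {X : Type w} [MulAction Q X]
  (V : X → Type u) [∀ x, AddCommGroup (V x)] [∀ x, Module S (V x)] [∀ x, Module ℂ (V x)]
  [∀ x, IsScalarTower ℂ S (V x)]
  (G : SOneGerbe.{u} (ActionCategory Q X)) [Fintype Q] [Finite X] [hV : IsSimpleFamily S V]

/-- The extension of `S` given by the convolution algebra of a gerbe. -/
noncomputable def convolutionExtension : QExtension Q S :=
  let e : GerbeAlgebra V G ≃ₐ[ℂ] Shrink.{u} (GerbeAlgebra V G) := (Shrink.algEquiv ℂ _).symm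
  { carrier := Shrink.{u} (GerbeAlgebra V G)
    grade := fun q => (GerbeAlgebra.grade V G q).map e.toAlgHom.toLinearMap
    grade_indep := GerbeAlgebra.iSupIndep_grade.map_orderIso
      (Submodule.orderIsoMapComap e.toLinearEquiv)
    grade_iSup := by
      rw [← Submodule.map_iSup, GerbeAlgebra.iSup_grade, Submodule.map_top, LinearMap.range_eq_top]
      exact e.surjective
    grade_mul := fun p q => by
      rw [← Submodule.map_mul, GerbeAlgebra.grade_mul_grade S]
    incl := e.toAlgHom.comp (GerbeAlgebra.incl V G)
    incl_injective := e.injective.comp (GerbeAlgebra.incl_injective V G)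
    incl_range := by
      rw [← GerbeAlgebra.range_incl (S := S) V G, ← LinearMap.range_comp]
      rfl }

/-- The convolution algebra of a gerbe is modelled on the gerbe. -/
noncomputable def convolutionModel : GerbeModel V (convolutionExtension (S := S) V G) G :=
  let e : Shrink.{u} (GerbeAlgebra V G) ≃ₐ[ℂ] GerbeAlgebra V G := Shrink.algEquiv ℂ _
  have he : ∀ {q : Q} {r : (convolutionExtension (S := S) V G).carrier},
      r ∈ (convolutionExtension (S := S) V G).grade q → e r ∈ GerbeAlgebra.grade V G q := by
    rintro q _ ⟨a, ha, rfl⟩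
    exact (e.apply_symm_apply a).symm ▸ ha
  { map := fun f => GerbeAlgebra.op f ∘ₗ e.toLinearMap
    smul_map_smul := fun c f r => by
      change (c : ℂ) • GerbeAlgebra.op (c • f) (e r) = GerbeAlgebra.op f (e r)
      rw [GerbeAlgebra.op_smul, smul_smul, mul_inv_cancel₀ c.ne_zero, one_smul]
    map_of_ne := fun f p hp r hr => GerbeAlgebra.op_of_mem (he hr) hp.symm
    map_comp := fun f g a ha b hb v => by
      refine Eq.trans (congrArg (fun t => GerbeAlgebra.op (G.comp f g) t v) (map_mul e a b)) ?_
      exact LinearMap.congr_fun (GerbeAlgebra.op_comp_mul_left f g (he ha) (e b)) v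
    map_id := fun x s v => by
      have h : e ((convolutionExtension (S := S) V G).incl s) = GerbeAlgebra.incl V G s :=
        e.apply_symm_apply _
      refine Eq.trans (congrArg (fun t => GerbeAlgebra.op (G.id x) t v) h) ?_
      rw [GerbeAlgebra.incl_apply, GerbeAlgebra.op_id_inclFun]
      rfl }

end

/-! ### Modules over an extension and twisted representations -/

/-- The space `Hom_S(V x, M)`. -/
def homSpace {Q S : Type u} [Group Q] [Ring S] [Algebra ℂ S] (R : QExtension Q S) (V : Type u)
    [AddCommGroup V] [Module S V] [Module ℂ V] (M : Type u) [AddCommGroup M] [Module R.carrier M]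
    [Module ℂ M] [IsScalarTower ℂ R.carrier M] : Submodule ℂ (V →ₗ[ℂ] M) where
  carrier := {φ | ∀ (s : S) (v : V), φ (s • v) = R.incl s • φ v}
  add_mem' {φ ψ} hφ hψ s v := by
    rw [LinearMap.add_apply, LinearMap.add_apply, hφ, hψ, smul_add]
  zero_mem' s v := (smul_zero _).symm
  smul_mem' c φ hφ s v := by
    rw [LinearMap.smul_apply, LinearMap.smul_apply, hφ]
    exact ((Algebra.lsmul ℂ ℂ M (R.incl s)).map_smul c (φ v)).symm

theorem homSpace_map_smul {Q S : Type u} [Group Q] [Ring S] [Algebra ℂ S] {R : QExtension Q S}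
    {V : Type u} [AddCommGroup V] [Module S V] [Module ℂ V] {M : Type u} [AddCommGroup M]
    [Module R.carrier M] [Module ℂ M] [IsScalarTower ℂ R.carrier M] (φ : homSpace R V M) (s : S)
    (v : V) : φ.1 (s • v) = R.incl s • φ.1 v :=
  φ.2 s v

namespace GerbeModel

variable {Q S : Type u} [Group Q] [Ring S] [Algebra ℂ S] {X : Type w} [MulAction Q X]
  {V : X → Type u} [∀ x, AddCommGroup (V x)] [∀ x, Module S (V x)] [∀ x, Module ℂ (V x)]
  {R : QExtension Q S} {G : SOneGerbe.{v} (ActionCategory Q X)} (m : GerbeModel V R G)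
  {M : Type u} [AddCommGroup M] [Module R.carrier M] [Module ℂ M] [IsScalarTower ℂ R.carrier M]
  {M' : Type u} [AddCommGroup M'] [Module R.carrier M'] [Module ℂ M']
  [IsScalarTower ℂ R.carrier M']

/-- The bilinear map `(r, v) ↦ r • φ v`. -/
noncomputable def smulHom (x : ActionCategory Q X) :
    homSpace R (V x.back) M →ₗ[ℂ] R.carrier →ₗ[ℂ] V x.back →ₗ[ℂ] M where
  toFun φ := (Algebra.lsmul ℂ ℂ M).toLinearMap.compl₁₂ LinearMap.id φ.1
  map_add' φ ψ := by ext r v; exact smul_add r (φ.1 v) (ψ.1 v)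
  map_smul' c φ := by ext r v; exact (Algebra.lsmul ℂ ℂ M r).map_smul c (φ.1 v)

theorem smulHom_apply (x : ActionCategory Q X) (φ : homSpace R (V x.back) M) (r : R.carrier)
    (v : V x.back) : smulHom x φ r v = r • φ.1 v :=
  rfl

theorem descend_smulHom_map {x y : ActionCategory Q X} (f : G.Hom x y)
    (φ : homSpace R (V x.back) M) {r : R.carrier} (hr : r ∈ R.grade (G.degree f)) (v : V x.back) :
    m.descend f (smulHom x φ) (m.map f r v) = r • φ.1 v :=
  m.descend_map f (fun r s v => by
    rw [smulHom_apply, smulHom_apply, homSpace_map_smul, mul_smul]) hr v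

/-- The action of the arrows of the gerbe on the spaces `Hom_S(V x, M)`. -/
noncomputable def transfer {x y : ActionCategory Q X} (f : G.Hom x y) :
    homSpace R (V x.back) M →ₗ[ℂ] homSpace R (V y.back) M :=
  (m.descend f ∘ₗ smulHom x).codRestrict _ fun φ s w => m.eq_of_map f
    (T := (m.descend f (smulHom x φ)).toAddMonoidHom.comp (DistribSMul.toAddMonoidHom _ s))
    (T' := (DistribSMul.toAddMonoidHom _ (R.incl s)).comp
      (m.descend f (smulHom x φ)).toAddMonoidHom)
    (fun r hr v => by
      change m.descend f (smulHom x φ) (s • m.map f r v) =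
        R.incl s • m.descend f (smulHom x φ) (m.map f r v)
      rw [← m.map_incl_mul, m.descend_smulHom_map f φ hr,
        m.descend_smulHom_map f φ (R.incl_mul_mem s hr), mul_smul]) w

/-- This formula characterizes the action, since the vectors `map f r v` span `V y`; functoriality
and naturality are all checked on such vectors. -/
theorem transfer_map {x y : ActionCategory Q X} (f : G.Hom x y) (φ : homSpace R (V x.back) M)
    {r : R.carrier} (hr : r ∈ R.grade (G.degree f)) (v : V x.back) :
    (m.transfer f φ).1 (m.map f r v) = r • φ.1 v :=
  m.descend_smulHom_map f φ hr v

theorem homSpace_ext {x y : ActionCategory Q X} (f : G.Hom x y) {ψ ψ' : homSpace R (V y.back) M}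
    (h : ∀ r ∈ R.grade (G.degree f), ∀ v, ψ.1 (m.map f r v) = ψ'.1 (m.map f r v)) : ψ = ψ' :=
  Subtype.ext (LinearMap.ext fun w =>
    m.eq_of_map f (T := ψ.1.toAddMonoidHom) (T' := ψ'.1.toAddMonoidHom) h w)

theorem transfer_id (x : ActionCategory Q X) (φ : homSpace R (V x.back) M) :
    m.transfer (G.id x) φ = φ := by
  refine m.homSpace_ext (G.id x) fun r hr v => ?_
  rw [m.transfer_map _ _ hr]
  rw [G.degree_id] at hr
  obtain ⟨s, rfl⟩ := R.exists_incl_eq hr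
  rw [m.map_id, homSpace_map_smul]

theorem transfer_comp {x y z : ActionCategory Q X} (f : G.Hom x y) (g : G.Hom y z)
    (φ : homSpace R (V x.back) M) :
    m.transfer (G.comp f g) φ = m.transfer g (m.transfer f φ) := by
  refine m.homSpace_ext g fun a ha w => ?_
  rw [m.transfer_map _ _ ha]
  refine m.eq_of_map f
    (T := (m.transfer (G.comp f g) φ).1.toAddMonoidHom.comp (m.map g a).toAddMonoidHom)
    (T' := (DistribSMul.toAddMonoidHom _ a).comp (m.transfer f φ).1.toAddMonoidHom)
    (fun b hb v => ?_) w
  change (m.transfer (G.comp f g) φ).1 (m.map g a (m.map f b v)) =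
    a • (m.transfer f φ).1 (m.map f b v)
  rw [← m.map_comp f g a ha b hb, m.transfer_map _ _ hb,
    m.transfer_map _ _ (by rw [G.degree_comp]; exact R.mul_mem ha hb), mul_smul]

/-- The vector `map (c • f) r v` is `c⁻¹` times `map f r v`, while the prescribed value `r • φ v` is
unchanged. This makes the representation twisted. -/
theorem transfer_smul {x y : ActionCategory Q X} (c : ℂˣ) (f : G.Hom x y)
    (φ : homSpace R (V x.back) M) : m.transfer (c • f) φ = (c : ℂ) • m.transfer f φ := by
  refine m.homSpace_ext (c • f) fun r hr v => ?_
  rw [m.transfer_map _ _ hr, Submodule.coe_smul, LinearMap.smul_apply, ← LinearMap.map_smul]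
  change r • φ.1 v = (m.transfer f φ).1 (((c : ℂ) • m.map (c • f) r) v)
  rw [m.smul_map_smul, m.transfer_map _ _ (by rwa [G.degree_smul] at hr)]

/-- Composition with a homomorphism of modules. -/
def homSpaceMap (V : Type u) [AddCommGroup V] [Module S V] [Module ℂ V] (T : M →ₗ[R.carrier] M') :
    homSpace R V M →ₗ[ℂ] homSpace R V M' :=
  ((LinearMap.llcomp ℂ V M M' (T.restrictScalars ℂ)).comp (homSpace R V M).subtype).codRestrict _
    fun φ s v => by
      change T (φ.1 (s • v)) = R.incl s • T (φ.1 v)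
      rw [homSpace_map_smul, LinearMap.map_smul]

theorem homSpaceMap_apply {V : Type u} [AddCommGroup V] [Module S V] [Module ℂ V]
    (T : M →ₗ[R.carrier] M') (φ : homSpace R V M) (v : V) :
    (homSpaceMap V T φ).1 v = T (φ.1 v) :=
  rfl

theorem transfer_homSpaceMap {x y : ActionCategory Q X} (f : G.Hom x y) (T : M →ₗ[R.carrier] M')
    (φ : homSpace R (V x.back) M) :
    m.transfer f (homSpaceMap _ T φ) = homSpaceMap _ T (m.transfer f φ) := by
  refine m.homSpace_ext f fun r hr v => ?_
  rw [m.transfer_map _ _ hr, homSpaceMap_apply, homSpaceMap_apply, m.transfer_map _ _ hr,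
    LinearMap.map_smul]

section

variable [∀ x, IsScalarTower ℂ S (V x)] [hV : IsSimpleFamily S V]

variable (V) in
/-- The element `v ↦ (w ↦ η w • v) • t` of `Hom_S(V x, M)`. -/
noncomputable def homOfDual (x : X) (η : V x →ₗ[ℂ] ℂ) : M →ₗ[ℂ] homSpace R (V x) M where
  toFun t :=
    { val := ((Algebra.lsmul ℂ ℂ M).toLinearMap.flip t) ∘ₗ R.incl.toLinearMap ∘ₗ
        (IsSimpleFamily.rankOne S V x η).restrictScalars ℂ
      property := fun s v => by
        change R.incl (IsSimpleFamily.rankOne S V x η (s • v)) • t =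
          R.incl s • R.incl (IsSimpleFamily.rankOne S V x η v) • t
        rw [LinearMap.map_smul, smul_eq_mul, map_mul, mul_smul] }
  map_add' t t' := Subtype.ext (LinearMap.ext fun v => smul_add _ t t')
  map_smul' c t := Subtype.ext (LinearMap.ext fun v =>
    (Algebra.lsmul ℂ ℂ M (R.incl (IsSimpleFamily.rankOne S V x η v))).map_smul c t)

theorem homOfDual_apply (x : X) (η : V x →ₗ[ℂ] ℂ) (t : M) (v : V x) :
    (homOfDual (R := R) V x η t).1 v = R.incl (IsSimpleFamily.rankOne S V x η v) • t :=
  rfl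

variable (V) in
-- The rank one decomposition of `1` in `S` is applied to `t`. Hence the images of the homomorphisms
-- `V x → M` span `M`.
theorem sum_homOfDual [Fintype X] (t : M) :
    ∑ x, ∑ k, (homOfDual (R := R) V x ((IsSimpleFamily.basis S V x).coord k) t).1
      (IsSimpleFamily.basis S V x k) = t := by
  simp only [homOfDual_apply, ← Finset.sum_smul, ← map_sum]
  rw [IsSimpleFamily.sum_rankOne, map_one, one_smul]

theorem homOfDual_map (x : X) (η : V x →ₗ[ℂ] ℂ) (φ : homSpace R (V x) M) (v : V x) :
    homOfDual (R := R) V x η (φ.1 v) = η v • φ := by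
  refine Subtype.ext (LinearMap.ext fun w => ?_)
  rw [homOfDual_apply, ← homSpace_map_smul, IsSimpleFamily.rankOne_smul, LinearMap.map_smul]
  rfl

theorem homOfDual_map_of_ne {x y : X} (h : y ≠ x) (η : V x →ₗ[ℂ] ℂ) (φ : homSpace R (V y) M)
    (v : V y) : homOfDual (R := R) V x η (φ.1 v) = 0 := by
  refine Subtype.ext (LinearMap.ext fun w => ?_)
  rw [homOfDual_apply, ← homSpace_map_smul, IsSimpleFamily.rankOne_smul_of_ne S V h,
    LinearMap.map_zero]
  rfl

variable (V) in
theorem eq_of_homSpace [Finite X] {N : Type*} [AddCommGroup N] {T T' : M →+ N}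
    (h : ∀ (x : X) (φ : homSpace R (V x) M) (v : V x), T (φ.1 v) = T' (φ.1 v)) (t : M) :
    T t = T' t := by
  have := Fintype.ofFinite X
  rw [← sum_homOfDual V (R := R) t, map_sum, map_sum]
  refine Finset.sum_congr rfl fun x _ => ?_
  rw [map_sum, map_sum]
  exact Finset.sum_congr rfl fun k _ => h _ _ _

theorem exists_map_apply_eq [Finite X]
    (τ : ∀ x : X, homSpace R (V x) M →ₗ[ℂ] homSpace R (V x) M') :
    ∃ T : M →ₗ[ℂ] M', ∀ (x : X) (φ : homSpace R (V x) M) (v : V x), T (φ.1 v) = (τ x φ).1 v := by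
  have := Fintype.ofFinite X
  -- On the isotypic part `V x ⊗ Hom_S(V x, M)` the map has to be the identity tensored with `τ x`,
  -- written here in a basis of `V x`.
  let T : M →ₗ[ℂ] M' := ∑ x : X, ∑ k, LinearMap.applyₗ (IsSimpleFamily.basis S V x k) ∘ₗ
    (homSpace R (V x) M').subtype ∘ₗ τ x ∘ₗ homOfDual V x ((IsSimpleFamily.basis S V x).coord k)
  have happly : ∀ t, T t = ∑ x : X, ∑ k, (τ x (homOfDual V x
      ((IsSimpleFamily.basis S V x).coord k) t)).1 (IsSimpleFamily.basis S V x k) := fun t => by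
    simp only [T, LinearMap.sum_apply]
    rfl
  refine ⟨T, fun x φ v => ?_⟩
  rw [happly, Finset.sum_eq_single x]
  · conv_rhs => rw [← (IsSimpleFamily.basis S V x).sum_repr v, map_sum]
    refine Finset.sum_congr rfl fun k _ => ?_
    rw [homOfDual_map, LinearMap.map_smul, LinearMap.map_smul]
    rfl
  · intro y _ hy
    refine Finset.sum_eq_zero fun k _ => ?_
    rw [homOfDual_map_of_ne hy.symm, map_zero]
    rfl
  · simp

/-- A natural family of maps `Hom_S(V x, M) → Hom_S(V x, M')` comes from a homomorphism. -/
theorem exists_homSpaceMap_eq [Finite X]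
    (τ : ∀ x : ActionCategory Q X, homSpace R (V x.back) M →ₗ[ℂ] homSpace R (V x.back) M')
    (hτ : ∀ {x y : ActionCategory Q X} (f : G.Hom x y) (φ : homSpace R (V x.back) M),
      τ y (m.transfer f φ) = m.transfer f (τ x φ)) :
    ∃ T : M →ₗ[R.carrier] M', ∀ (x : ActionCategory Q X) (φ : homSpace R (V x.back) M),
      homSpaceMap _ T φ = τ x φ := by
  obtain ⟨T, hT'⟩ := exists_map_apply_eq (V := V) fun x : X => τ (x : ActionCategory Q X)
  have hT : ∀ (x : ActionCategory Q X) (φ : homSpace R (V x.back) M) (v : V x.back),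
      T (φ.1 v) = (τ x φ).1 v := fun x => hT' x.back
  refine ⟨{ T with map_smul' := fun r t => ?_ }, fun x φ => Subtype.ext (LinearMap.ext (hT x φ))⟩
  change T (r • t) = r • T t
  induction r using R.homogeneous_induction with
  | mem q r hr =>
    refine eq_of_homSpace V (R := R)
      (T := T.toAddMonoidHom.comp (DistribSMul.toAddMonoidHom _ r))
      (T' := (DistribSMul.toAddMonoidHom _ r).comp T.toAddMonoidHom) (fun x φ v => ?_) t
    change T (r • φ.1 v) = r • T (φ.1 v)
    have key : ∀ (x : ActionCategory Q X) (φ : homSpace R (V x.back) M) (v : V x.back),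
        T (r • φ.1 v) = r • T (φ.1 v) := by
      intro x φ v
      obtain ⟨y, f, rfl⟩ := G.exists_arrow x q
      -- Since `r • φ v` is a value of the transferred homomorphism, naturality of `τ` along `f` is
      -- commutation with `r`.
      rw [← m.transfer_map f φ hr, hT, hτ, m.transfer_map f _ hr, hT]
    exact key (x : ActionCategory Q X) φ v
  | add a b ha hb => rw [add_smul, map_add, ha, hb, add_smul]

end

end GerbeModel

/-! ### The module induced from a twisted representation -/

/-- A twisted representation of a gerbe, unbundled. -/
structure TwistedAction {Q : Type u} [Group Q] {X : Type w} [MulAction Q X]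
    (G : SOneGerbe.{v} (ActionCategory Q X)) (E : ActionCategory Q X → Type u)
    [∀ x, AddCommGroup (E x)] [∀ x, Module ℂ (E x)] where
  /-- the action of an arrow -/
  map : ∀ {x y : ActionCategory Q X}, G.Hom x y → E x →ₗ[ℂ] E y
  map_id : ∀ x e, map (G.id x) e = e
  map_comp : ∀ {x y z : ActionCategory Q X} (f : G.Hom x y) (g : G.Hom y z) (e : E x),
    map (G.comp f g) e = map g (map f e)
  map_smul : ∀ {x y : ActionCategory Q X} (c : ℂˣ) (f : G.Hom x y) (e : E x),
    map (c • f) e = (c : ℂ) • map f e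

namespace GerbeModel

variable {Q S : Type u} [Group Q] [Ring S] [Algebra ℂ S] {X : Type w} [MulAction Q X]
  {V : X → Type u} [∀ x, AddCommGroup (V x)] [∀ x, Module S (V x)] [∀ x, Module ℂ (V x)]
  {R : QExtension Q S} {G : SOneGerbe.{v} (ActionCategory Q X)} (m : GerbeModel V R G)
  {E : ActionCategory Q X → Type u} [∀ x, AddCommGroup (E x)] [∀ x, Module ℂ (E x)]
  (A : TwistedAction G E)

/-- The operator `V x ⊗ E x → V y ⊗ E y` of an arrow. -/
noncomputable def tensorMap {x y : ActionCategory Q X} (f : G.Hom x y) (r : R.carrier) :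
    V x.back ⊗[ℂ] E x →ₗ[ℂ] V y.back ⊗[ℂ] E y :=
  TensorProduct.map (m.map f r) (A.map f)

theorem tensorMap_tmul {x y : ActionCategory Q X} (f : G.Hom x y) (r : R.carrier) (v : V x.back)
    (e : E x) : m.tensorMap A f r (v ⊗ₜ e) = m.map f r v ⊗ₜ A.map f e :=
  rfl

/-- The factor `c⁻¹` of the model cancels the factor `c` of the twisted representation. So the
operator depends only on the arrow of the action groupoid, and `R` can act. -/
theorem tensorMap_smul {x y : ActionCategory Q X} (c : ℂˣ) (f : G.Hom x y) (r : R.carrier) :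
    m.tensorMap A (c • f) r = m.tensorMap A f r := by
  refine TensorProduct.ext' fun v e => ?_
  rw [tensorMap_tmul, tensorMap_tmul, A.map_smul, ← m.smul_map_smul c f, TensorProduct.tmul_smul,
    LinearMap.smul_apply, TensorProduct.smul_tmul']

theorem tensorMap_of_ne {x y : ActionCategory Q X} (f : G.Hom x y) {p : Q} (hp : p ≠ G.degree f)
    {r : R.carrier} (hr : r ∈ R.grade p) : m.tensorMap A f r = 0 := by
  refine TensorProduct.ext' fun v e => ?_
  rw [tensorMap_tmul, m.map_of_ne f hp r hr, LinearMap.zero_apply, TensorProduct.zero_tmul,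
    LinearMap.zero_apply]

theorem tensorMap_comp {x y z : ActionCategory Q X} (f : G.Hom x y) (g : G.Hom y z)
    {a b : R.carrier} (ha : a ∈ R.grade (G.degree g)) (hb : b ∈ R.grade (G.degree f)) (t) :
    m.tensorMap A (G.comp f g) (a * b) t = m.tensorMap A g a (m.tensorMap A f b t) := by
  induction t using TensorProduct.induction_on with
  | zero => simp only [map_zero]
  | tmul v e =>
    rw [tensorMap_tmul, tensorMap_tmul, tensorMap_tmul, A.map_comp, m.map_comp f g a ha b hb]
  | add t t' h h' => rw [map_add, map_add, map_add, h, h']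

theorem tensorMap_id (x : ActionCategory Q X) (s : S) (t : V x.back ⊗[ℂ] E x) :
    m.tensorMap A (G.id x) (R.incl s) t =
      TensorProduct.map (m.map (G.id x) (R.incl s)) LinearMap.id t := by
  induction t using TensorProduct.induction_on with
  | zero => simp only [map_zero]
  | tmul v e => rw [tensorMap_tmul, A.map_id, TensorProduct.map_tmul, LinearMap.id_apply]
  | add t t' h h' => rw [map_add, map_add, h, h']

variable [Finite Q] [Finite X]

open Classical in
/-- The action of `R` on the sum of the spaces `V x ⊗ E x`. -/
noncomputable def inducedMap : R.carrier →ₗ[ℂ] Module.End ℂ (∀ x, V x.back ⊗[ℂ] E x) :=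
  have := Finite.of_equiv X (ActionCategory.objEquiv Q X)
  letI := Fintype.ofFinite (ActionCategory Q X)
  letI := Fintype.ofFinite Q
  { toFun := fun r => ∑ x, ∑ q, LinearMap.single ℂ (fun x => V x.back ⊗[ℂ] E x)
      (G.exists_arrow x q).choose ∘ₗ m.tensorMap A (G.arrow x q) r ∘ₗ LinearMap.proj x
    map_add' := fun r r' => by
      simp only [tensorMap, map_add, TensorProduct.map_add_left, LinearMap.add_comp,
        LinearMap.comp_add, Finset.sum_add_distrib]
    map_smul' := fun c r => by
      simp only [tensorMap, LinearMap.map_smul, TensorProduct.map_smul_left, LinearMap.smul_comp,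
        LinearMap.comp_smul, Finset.smul_sum, RingHom.id_apply] }

open Classical in
-- Only the term with source `x` and the degree of `r` survives, and by `tensorMap_smul` its chosen
-- arrow may be replaced by `f`.
theorem inducedMap_single {x y : ActionCategory Q X} (f : G.Hom x y) {r : R.carrier}
    (hr : r ∈ R.grade (G.degree f)) (t : V x.back ⊗[ℂ] E x) :
    m.inducedMap A r (Pi.single x t) = Pi.single y (m.tensorMap A f r t) := by
  have := Finite.of_equiv X (ActionCategory.objEquiv Q X)
  let := Fintype.ofFinite (ActionCategory Q X)
  let := Fintype.ofFinite Q
  have h : m.inducedMap A r (Pi.single x t) = ∑ x', ∑ q, Pi.single (G.exists_arrow x' q).choose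
      (m.tensorMap A (G.arrow x' q) r ((Pi.single x t : ∀ x, V x.back ⊗[ℂ] E x) x')) := by
    change (∑ x, ∑ q, LinearMap.single ℂ (fun x => V x.back ⊗[ℂ] E x)
      (G.exists_arrow x q).choose ∘ₗ m.tensorMap A (G.arrow x q) r ∘ₗ LinearMap.proj x)
        (Pi.single x t) = _
    simp only [LinearMap.sum_apply]
    rfl
  rw [h, Finset.sum_eq_single x, Finset.sum_eq_single (G.degree f)]
  · rw [Pi.single_eq_same]
    have key : ∀ {z : ActionCategory Q X} (g : G.Hom x z), G.degree g = G.degree f →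
        (Pi.single z (m.tensorMap A g r t) : ∀ x, V x.back ⊗[ℂ] E x) =
          Pi.single y (m.tensorMap A f r t) := by
      intro z g hg
      obtain rfl : z = y := actionCategory_back_injective (by
        rw [← G.degree_smul_back f, ← G.degree_smul_back g, hg])
      obtain ⟨c, rfl⟩ := G.exists_smul_eq hg
      rw [m.tensorMap_smul]
    exact key _ (G.degree_arrow x _)
  · intro q _ hq
    rw [m.tensorMap_of_ne A _ (by rw [G.degree_arrow]; exact hq.symm) hr, LinearMap.zero_apply,
      Pi.single_zero]
  · simp
  · intro x' _ hx'
    refine Finset.sum_eq_zero fun q _ => ?_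
    rw [Pi.single_eq_of_ne hx', map_zero, Pi.single_zero]
  · simp

open Classical in
theorem eq_of_single {N : Type*} [AddCommGroup N] {T T' : (∀ x, V x.back ⊗[ℂ] E x) →+ N}
    (h : ∀ x t, T (Pi.single x t) = T' (Pi.single x t)) (t) : T t = T' t := by
  have := Finite.of_equiv X (ActionCategory.objEquiv Q X)
  let := Fintype.ofFinite (ActionCategory Q X)
  rw [← Finset.univ_sum_single t, map_sum, map_sum]
  exact Finset.sum_congr rfl fun x _ => h x _

open Classical in
theorem inducedMap_incl_single (x : ActionCategory Q X) (s : S) (t : V x.back ⊗[ℂ] E x) :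
    m.inducedMap A (R.incl s) (Pi.single x t) =
      Pi.single x (TensorProduct.map (m.map (G.id x) (R.incl s)) LinearMap.id t) := by
  rw [m.inducedMap_single A (G.id x) (by rw [G.degree_id]; exact R.incl_mem s), tensorMap_id]

theorem inducedMap_incl (s : S) (t : ∀ x, V x.back ⊗[ℂ] E x) (x : ActionCategory Q X) :
    m.inducedMap A (R.incl s) t x =
      TensorProduct.map (m.map (G.id x) (R.incl s)) LinearMap.id (t x) := by
  classical
  refine eq_of_single
    (T := (Pi.evalAddMonoidHom _ x).comp (m.inducedMap A (R.incl s)).toAddMonoidHom)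
    (T' := (TensorProduct.map (m.map (G.id x) (R.incl s)) LinearMap.id).toAddMonoidHom.comp
      (Pi.evalAddMonoidHom (fun x => V x.back ⊗[ℂ] E x) x)) (fun y t => ?_) t
  change m.inducedMap A (R.incl s) (Pi.single y t) x =
    TensorProduct.map (m.map (G.id x) (R.incl s)) LinearMap.id
      ((Pi.single y t : ∀ x, V x.back ⊗[ℂ] E x) x)
  have h := m.inducedMap_incl_single A y s t
  by_cases hxy : x = y
  · subst hxy
    rw [Pi.single_eq_same]
    convert congrFun h x
    rw [Pi.single_eq_same]
  · rw [Pi.single_eq_of_ne hxy, map_zero]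
    convert congrFun h x
    rw [Pi.single_eq_of_ne hxy]

theorem inducedMap_one : m.inducedMap A 1 = 1 := by
  refine LinearMap.ext fun t => funext fun x => ?_
  rw [← map_one R.incl, inducedMap_incl]
  have : m.map (G.id x) (R.incl 1) = LinearMap.id := LinearMap.ext fun v => by
    rw [m.map_id, one_smul, LinearMap.id_apply]
  rw [this, TensorProduct.map_id]
  rfl

theorem inducedMap_mul (a b : R.carrier) :
    m.inducedMap A (a * b) = m.inducedMap A a * m.inducedMap A b := by
  classical
  induction a using R.homogeneous_induction with
  | mem p a ha =>
    induction b using R.homogeneous_induction with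
    | mem q b hb =>
      refine LinearMap.ext fun t => ?_
      refine eq_of_single (T := (m.inducedMap A (a * b)).toAddMonoidHom)
        (T' := (m.inducedMap A a * m.inducedMap A b).toAddMonoidHom) (fun x t => ?_) t
      obtain ⟨y, f, rfl⟩ := G.exists_arrow x q
      obtain ⟨z, g, rfl⟩ := G.exists_arrow y p
      change m.inducedMap A (a * b) (Pi.single x t) =
        m.inducedMap A a (m.inducedMap A b (Pi.single x t))
      have h1 := m.inducedMap_single A f hb t
      have h2 := m.inducedMap_single A g ha (m.tensorMap A f b t)
      have h3 := m.inducedMap_single A (G.comp f g) (r := a * b)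
        (by rw [G.degree_comp]; exact R.mul_mem ha hb) t
      rw [m.tensorMap_comp A f g ha hb] at h3
      convert h3
      convert h2
    | add b c hb hc => rw [mul_add, map_add, hb, hc, map_add, mul_add]
  | add a c ha hc => rw [add_mul, map_add, ha, hc, map_add, add_mul]

/-- The `R`-module `⨁ x, V x ⊗ E x` of a twisted representation. -/
def Induced (_m : GerbeModel V R G) (_A : TwistedAction G E) : Type u :=
  have := Finite.of_equiv X (ActionCategory.objEquiv Q X)
  Shrink.{u} (∀ x : ActionCategory Q X, V x.back ⊗[ℂ] E x)

noncomputable instance : AddCommGroup (Induced m A) :=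
  have := Finite.of_equiv X (ActionCategory.objEquiv Q X)
  inferInstanceAs (AddCommGroup (Shrink.{u} (∀ x : ActionCategory Q X, V x.back ⊗[ℂ] E x)))

/-- The components of an element of the induced module. -/
noncomputable def inducedEquiv : Induced m A ≃+ ∀ x : ActionCategory Q X, V x.back ⊗[ℂ] E x :=
  have := Finite.of_equiv X (ActionCategory.objEquiv Q X)
  Shrink.addEquiv

noncomputable instance : Module R.carrier (Induced m A) where
  smul r t := (m.inducedEquiv A).symm (m.inducedMap A r (m.inducedEquiv A t))
  one_smul t := by
    change (m.inducedEquiv A).symm (m.inducedMap A 1 (m.inducedEquiv A t)) = t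
    rw [inducedMap_one, Module.End.one_apply, AddEquiv.symm_apply_apply]
  mul_smul a b t := by
    change (m.inducedEquiv A).symm (m.inducedMap A (a * b) (m.inducedEquiv A t)) =
      (m.inducedEquiv A).symm (m.inducedMap A a (m.inducedEquiv A
        ((m.inducedEquiv A).symm (m.inducedMap A b (m.inducedEquiv A t)))))
    rw [inducedMap_mul, Module.End.mul_apply, AddEquiv.apply_symm_apply]
  smul_zero r := by
    change (m.inducedEquiv A).symm (m.inducedMap A r (m.inducedEquiv A 0)) = 0
    rw [map_zero, map_zero, map_zero]
  smul_add r t t' := by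
    change (m.inducedEquiv A).symm (m.inducedMap A r (m.inducedEquiv A (t + t'))) =
      (m.inducedEquiv A).symm (m.inducedMap A r (m.inducedEquiv A t)) +
        (m.inducedEquiv A).symm (m.inducedMap A r (m.inducedEquiv A t'))
    rw [map_add, map_add, map_add]
  add_smul a b t := by
    change (m.inducedEquiv A).symm (m.inducedMap A (a + b) (m.inducedEquiv A t)) =
      (m.inducedEquiv A).symm (m.inducedMap A a (m.inducedEquiv A t)) +
        (m.inducedEquiv A).symm (m.inducedMap A b (m.inducedEquiv A t))
    rw [map_add, LinearMap.add_apply, map_add]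
  zero_smul t := by
    change (m.inducedEquiv A).symm (m.inducedMap A 0 (m.inducedEquiv A t)) = 0
    rw [map_zero, LinearMap.zero_apply, map_zero]

theorem inducedEquiv_smul (r : R.carrier) (t : Induced m A) :
    m.inducedEquiv A (r • t) = m.inducedMap A r (m.inducedEquiv A t) :=
  (m.inducedEquiv A).apply_symm_apply _

section

variable [Module ℂ (Induced m A)] [IsScalarTower ℂ R.carrier (Induced m A)]

/-- The components of an element of the induced module, as a linear map. -/
noncomputable def inducedLinearEquiv :
    Induced m A ≃ₗ[ℂ] ∀ x : ActionCategory Q X, V x.back ⊗[ℂ] E x :=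
  { m.inducedEquiv A with
    map_smul' := fun c t => by
      change m.inducedEquiv A (c • t) = c • m.inducedEquiv A t
      rw [← one_smul R.carrier t, ← smul_assoc, inducedEquiv_smul, LinearMap.map_smul,
        inducedMap_one, one_smul]
      rfl }

theorem inducedLinearEquiv_smul (r : R.carrier) (t : Induced m A) :
    m.inducedLinearEquiv A (r • t) = m.inducedMap A r (m.inducedLinearEquiv A t) :=
  m.inducedEquiv_smul A r t

theorem finite_induced [∀ x, FiniteDimensional ℂ (V x)] [∀ x, FiniteDimensional ℂ (E x)] :
    Module.Finite R.carrier (Induced m A) := by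
  have := Finite.of_equiv X (ActionCategory.objEquiv Q X)
  have : Module.Finite ℂ (Induced m A) := Module.Finite.equiv (m.inducedLinearEquiv A).symm
  exact Module.Finite.of_restrictScalars_finite ℂ R.carrier _

open Classical in
/-- The map `E x → Hom_S(V x, ⨁ y, V y ⊗ E y)`. -/
noncomputable def coinduced (x : ActionCategory Q X) :
    E x →ₗ[ℂ] homSpace R (V x.back) (Induced m A) :=
  LinearMap.codRestrict _ ((LinearMap.llcomp ℂ _ _ _ ((m.inducedLinearEquiv A).symm.toLinearMap ∘ₗ
      LinearMap.single ℂ (fun x : ActionCategory Q X => V x.back ⊗[ℂ] E x) x)) ∘ₗ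
    (TensorProduct.mk ℂ (V x.back) (E x)).flip) fun e s v => by
      change (m.inducedLinearEquiv A).symm (Pi.single x ((s • v) ⊗ₜ e)) =
        R.incl s • (m.inducedLinearEquiv A).symm (Pi.single x (v ⊗ₜ e))
      rw [LinearEquiv.symm_apply_eq, inducedLinearEquiv_smul, LinearEquiv.apply_symm_apply,
        inducedMap_incl_single, TensorProduct.map_tmul, m.map_id, LinearMap.id_apply]

open Classical in
theorem coinduced_apply (x : ActionCategory Q X) (e : E x) (v : V x.back) :
    (m.coinduced A x e).1 v = (m.inducedLinearEquiv A).symm (Pi.single x (v ⊗ₜ e)) :=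
  rfl

theorem transfer_coinduced {x y : ActionCategory Q X} (f : G.Hom x y) (e : E x) :
    m.transfer f (m.coinduced A x e) = m.coinduced A y (A.map f e) := by
  classical
  refine m.homSpace_ext f fun r hr v => ?_
  rw [m.transfer_map f _ hr, coinduced_apply, coinduced_apply, LinearEquiv.eq_symm_apply,
    inducedLinearEquiv_smul, LinearEquiv.apply_symm_apply, inducedMap_single m A f hr,
    tensorMap_tmul]

/-- With `η v₀ = 1`, the inverse sends `φ` to the contraction by `η` of the component of `φ v₀` at
`x`. It recovers `φ` because `v` is the image of `v₀` under a rank one element of `S`, which acts as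
zero on the components other than `x`. -/
theorem coinduced_bijective [∀ x, IsScalarTower ℂ S (V x)] [hV : IsSimpleFamily S V]
    (x : ActionCategory Q X) : Function.Bijective (m.coinduced A x) := by
  classical
  obtain ⟨v₀, η, h₀⟩ := IsSimpleFamily.exists_dual S V x.back
  let c : V x.back ⊗[ℂ] E x →ₗ[ℂ] E x := TensorProduct.lid ℂ (E x) ∘ₗ
    TensorProduct.map η LinearMap.id
  have hc : ∀ v e, c (v ⊗ₜ e) = η v • e := fun v e => rfl
  refine ⟨(injective_iff_map_eq_zero _).2 fun e he => ?_, fun φ => ?_⟩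
  · have h := LinearMap.congr_fun (congrArg Subtype.val he) v₀
    rw [coinduced_apply] at h
    have h' := congrFun ((LinearEquiv.map_eq_zero_iff _).1 h) x
    rw [Pi.single_eq_same] at h'
    have h2 := congrArg c h'
    rwa [hc, h₀, one_smul, Pi.zero_apply, map_zero] at h2
  · refine ⟨c (m.inducedLinearEquiv A (φ.1 v₀) x), Subtype.ext (LinearMap.ext fun v => ?_)⟩
    have hv : v = IsSimpleFamily.rankOne S V x.back η v • v₀ := by
      rw [IsSimpleFamily.rankOne_smul, h₀, one_smul]
    rw [coinduced_apply, LinearEquiv.symm_apply_eq]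
    conv_rhs => rw [hv, homSpace_map_smul, inducedLinearEquiv_smul]
    funext y
    rw [inducedMap_incl]
    by_cases hy : y = x
    · subst hy
      rw [Pi.single_eq_same]
      generalize m.inducedLinearEquiv A (φ.1 v₀) y = t
      induction t using TensorProduct.induction_on with
      | zero => simp only [map_zero, TensorProduct.tmul_zero]
      | tmul w e =>
        rw [hc, TensorProduct.map_tmul, m.map_id, IsSimpleFamily.rankOne_smul, LinearMap.id_apply,
          TensorProduct.smul_tmul]
      | add t t' h h' => rw [map_add, map_add, TensorProduct.tmul_add, h, h']
    · rw [Pi.single_eq_of_ne hy]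
      have h0 : m.map (G.id y) (R.incl (IsSimpleFamily.rankOne S V x.back η v)) = 0 :=
        LinearMap.ext fun w => by
          rw [m.map_id, IsSimpleFamily.rankOne_smul_of_ne S V
            (fun h => hy (actionCategory_back_injective h))]
          rfl
      rw [h0, TensorProduct.map_zero_left]
      rfl

end

end GerbeModel

/-! ### The equivalence of categories -/

namespace QExtension

variable {Q S : Type u} [Group Q] [Ring S] [Algebra ℂ S] (R : QExtension Q S)

/-- For `r` of degree `q`, `r = ∑ a_k (b_k r)` with `b_k r` in `S`, so the finitely many `a_k`
generate `R_q` as a right `S`-module. -/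
theorem finite_carrier [Finite Q] [Module.Finite ℂ S] : Module.Finite ℂ R.carrier := by
  have := Fintype.ofFinite Q
  let T : (∀ q : Q, R.UnitIndex q → S) →ₗ[ℂ] R.carrier := ∑ q, ∑ k,
    LinearMap.mulLeft ℂ (R.unitLeft q k) ∘ₗ R.incl.toLinearMap ∘ₗ LinearMap.proj k ∘ₗ
      LinearMap.proj q
  have hT : ∀ a, T a = ∑ q, ∑ k, R.unitLeft q k * R.incl (a q k) := fun a => by
    simp only [T, LinearMap.sum_apply]
    rfl
  refine Module.Finite.of_surjective T fun r => ?_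
  induction r using R.homogeneous_induction with
  | mem q r hr =>
    have h : ∀ k, ∃ s, R.incl s = R.unitRight q k * r := fun k => R.exists_incl_eq (by
      have := R.mul_mem (R.unitRight_mem q k) hr
      rwa [inv_mul_cancel] at this)
    choose a ha using h
    classical
    refine ⟨Pi.single q a, ?_⟩
    rw [hT, Finset.sum_eq_single q]
    · simp only [Pi.single_eq_same, ha, ← mul_assoc, ← Finset.sum_mul, R.sum_unit, one_mul]
    · intro p _ hp
      simp [Pi.single_eq_of_ne hp]
    · simp
  | add a b ha hb =>
    obtain ⟨a, rfl⟩ := ha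
    obtain ⟨b, rfl⟩ := hb
    exact ⟨a + b, map_add T a b⟩

noncomputable instance (M : ModuleCat.{u} R.carrier) : Module ℂ M :=
  Module.restrictScalars ℂ R.carrier M

instance (M : ModuleCat.{u} R.carrier) : IsScalarTower ℂ R.carrier M :=
  IsScalarTower.restrictScalars ℂ R.carrier M

theorem finite_moduleCat [Finite Q] [Module.Finite ℂ S] (M : FGModuleCat.{u} R.carrier) :
    FiniteDimensional ℂ M :=
  have := R.finite_carrier
  Module.Finite.trans R.carrier M

end QExtension

namespace GerbeModel

variable {Q S : Type u} [Group Q] [Ring S] [Algebra ℂ S] {X : Type w} [MulAction Q X]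
  {V : X → Type u} [∀ x, AddCommGroup (V x)] [∀ x, Module S (V x)] [∀ x, Module ℂ (V x)]
  {R : QExtension Q S} {G : SOneGerbe.{u} (ActionCategory Q X)} (m : GerbeModel V R G)
  [Finite Q] [Module.Finite ℂ S] [∀ x, FiniteDimensional ℂ (V x)]

instance (W : Type u) [AddCommGroup W] [Module S W] [Module ℂ W] [FiniteDimensional ℂ W]
    (M : FGModuleCat.{u} R.carrier) : FiniteDimensional ℂ (homSpace R W M) :=
  have := R.finite_moduleCat M
  inferInstance

/-- The twisted representation `x ↦ Hom_S(V x, M)` of an `R`-module `M`. -/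
noncomputable def twistedRep (M : FGModuleCat.{u} R.carrier) : G.TwistedRep where
  obj :=
    { obj := fun x => FGModuleCat.of ℂ (homSpace R (V (ActionCategory.back x)) M)
      map := fun f => FGModuleCat.ofHom (m.transfer f)
      map_id := fun x => FGModuleCat.hom_ext (LinearMap.ext fun φ => m.transfer_id x φ)
      map_comp := fun f g => FGModuleCat.hom_ext (LinearMap.ext fun φ => m.transfer_comp f g φ) }
  property _ _ c f φ := m.transfer_smul c f φ

/-- The functor from `R`-modules to twisted representations. -/
noncomputable def twistedRepFunctor : FGModuleCat.{u} R.carrier ⥤ G.TwistedRep where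
  obj M := m.twistedRep M
  map T := ObjectProperty.homMk
    { app := fun x => FGModuleCat.ofHom (homSpaceMap (V (ActionCategory.back x)) T.hom.hom)
      naturality := fun _ _ f => FGModuleCat.hom_ext (LinearMap.ext fun φ =>
        (m.transfer_homSpaceMap f T.hom.hom φ).symm) }
  map_id _ := rfl
  map_comp _ _ := rfl

theorem twistedRepFunctor_additive : m.twistedRepFunctor.Additive where
  map_add := rfl

theorem twistedRepFunctor_linear : m.twistedRepFunctor.Linear ℂ where
  map_smul T c := by
    refine ObjectProperty.hom_ext _ (NatTrans.ext (funext fun x => FGModuleCat.hom_ext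
      (LinearMap.ext fun φ => Subtype.ext (LinearMap.ext fun v => ?_))))
    rfl

variable [Finite X] [∀ x, IsScalarTower ℂ S (V x)] [hV : IsSimpleFamily S V]

theorem twistedRepFunctor_faithful : m.twistedRepFunctor.Faithful where
  map_injective {M M'} T T' h := by
    refine FGModuleCat.hom_ext (LinearMap.ext fun t => ?_)
    refine eq_of_homSpace V (R := R) (T := T.hom.hom.toAddMonoidHom)
      (T' := T'.hom.hom.toAddMonoidHom) (fun x φ v => ?_) t
    let y : G.Total := (x : ActionCategory Q X)
    have h' := LinearMap.congr_fun (congrArg (fun k => (k.hom.app y).hom.hom) h) φ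
    exact LinearMap.congr_fun (congrArg Subtype.val h') v

theorem twistedRepFunctor_full : m.twistedRepFunctor.Full where
  map_surjective {M M'} τ := by
    obtain ⟨T, hT⟩ := m.exists_homSpaceMap_eq (M := M) (M' := M')
      (fun x => (τ.hom.app x).hom.hom) (fun {x y} f φ =>
        LinearMap.congr_fun (congrArg (fun k => k.hom.hom) (τ.hom.naturality f)) φ)
    refine ⟨ObjectProperty.homMk (ModuleCat.ofHom T), ?_⟩
    exact ObjectProperty.hom_ext _ (NatTrans.ext (funext fun x => FGModuleCat.hom_ext
      (LinearMap.ext fun φ => hT x φ)))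

theorem twistedRepFunctor_essSurj : m.twistedRepFunctor.EssSurj where
  mem_essImage F := by
    let E : ActionCategory Q X → Type u := fun x => F.obj.obj x
    let A : TwistedAction G E :=
      { map := fun {x y} f => (F.obj.map (X := x) (Y := y) f).hom.hom
        map_id := fun x e =>
          LinearMap.congr_fun (congrArg (fun k => k.hom.hom) (F.obj.map_id x)) e
        map_comp := fun {x y z} f g e => LinearMap.congr_fun (congrArg (fun k => k.hom.hom)
          (F.obj.map_comp (X := x) (Y := y) (Z := z) f g)) e
        map_smul := fun {x y} c f e => F.property x y c f e }
    have hE : ∀ x, FiniteDimensional ℂ (E x) := fun x =>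
      inferInstanceAs (Module.Finite ℂ (F.obj.obj x))
    let : Module ℂ (Induced m A) := Module.restrictScalars ℂ R.carrier _
    have : IsScalarTower ℂ R.carrier (Induced m A) := IsScalarTower.restrictScalars ℂ R.carrier _
    have := m.finite_induced A
    have := R.finite_carrier
    have : FiniteDimensional ℂ (Induced m A) := Module.Finite.trans R.carrier _
    let e : ∀ x : ActionCategory Q X, E x ≃ₗ[ℂ] homSpace R (V x.back) (Induced m A) := fun x =>
      LinearEquiv.ofBijective (m.coinduced A x) (m.coinduced_bijective A x)
    refine ⟨FGModuleCat.of R.carrier (Induced m A), ⟨ObjectProperty.isoMk _ (NatIso.ofComponents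
      (fun x => (e x).symm.toFGModuleCatIso) fun {x y} f => ?_)⟩⟩
    refine FGModuleCat.hom_ext (LinearMap.ext fun φ => ?_)
    obtain ⟨a, rfl⟩ : ∃ a, e x a = φ := (e x).surjective φ
    change (e y).symm (m.transfer f (e x a)) = A.map f ((e x).symm (e x a))
    rw [LinearEquiv.symm_apply_apply, LinearEquiv.symm_apply_eq]
    exact m.transfer_coinduced A f a

theorem exists_equivalence (m : GerbeModel V R G) :
    ∃ e : FGModuleCat.{u} R.carrier ≌ G.TwistedRep,
      e.functor.Additive ∧ e.functor.Linear ℂ := by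
  have := m.twistedRepFunctor_full
  have := m.twistedRepFunctor_faithful
  have := m.twistedRepFunctor_essSurj
  have : m.twistedRepFunctor.IsEquivalence := {}
  exact ⟨m.twistedRepFunctor.asEquivalence, m.twistedRepFunctor_additive,
    m.twistedRepFunctor_linear⟩

end GerbeModel

/-! ### The bijection of isomorphism classes and the main theorem -/

section

variable {Q S : Type u} [Group Q] [Ring S] [Algebra ℂ S] [MulAction Q (SimpleClass S)]
  {V : SimpleClass S → SimpleMod S}
  [∀ i, Module ℂ (V i).1] [∀ i, IsScalarTower ℂ S (V i).1]

theorem GerbeModel.nonempty_iff_nonempty_identification [IsSimpleFamily S (SimpleMod.family V)]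
    (R : {R : QExtension Q S // R.HasBand})
    (G : SOneGerbe.{u} (ActionCategory Q (SimpleClass S))) :
    Nonempty (GerbeModel (SimpleMod.family V) R.1 G) ↔ Nonempty (GerbeIdentification V R.1 G) :=
  ⟨fun ⟨m⟩ => ⟨m.toIdentification⟩, fun ⟨I⟩ => ⟨I.toModel R.2⟩⟩

/-- The bijection between extensions and gerbes that relates `R` and `G` if they have a common
model. -/
theorem exists_equiv_nonempty_gerbeModel [Finite Q] [Finite (SimpleClass S)]
    [IsSimpleFamily S (SimpleMod.family V)] (hV : ∀ i, (V i).toClass = i) :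
    ∃ Φ : BandedExtensionClass Q S ≃ SOneGerbeClass.{u} (ActionCategory Q (SimpleClass S)),
      ∀ (R : {R : QExtension Q S // R.HasBand})
        (G : SOneGerbe.{u} (ActionCategory Q (SimpleClass S))),
        Φ (Quotient.mk _ R) = Quotient.mk _ G ↔
          Nonempty (GerbeModel (SimpleMod.family V) R.1 G) := by
  have hband : ∀ R : {R : QExtension Q S // R.HasBand}, ∀ q i,
      Nonempty (R.1.act q (SimpleMod.family V i) ≃ₗ[S] SimpleMod.family V (q • i)) :=
    fun R => R.2.nonempty_act_equiv hV
  let Γ : {R : QExtension Q S // R.HasBand} →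
      SOneGerbe.{u} (ActionCategory Q (SimpleClass S)) :=
    fun R => QExtension.operatorGerbe (SimpleMod.family V) (hband R)
  let model : ∀ R, GerbeModel (SimpleMod.family V) R.1 (Γ R) :=
    fun R => QExtension.operatorModel (SimpleMod.family V) (hband R)
  -- A common model characterizes the class of the gerbe of `R`: models move along isomorphisms of
  -- gerbes, and two gerbes with models of the same extension are isomorphic.
  have hΓ : ∀ R G, (Quotient.mk (sOneGerbeSetoid _) (Γ R) = Quotient.mk _ G ↔
      Nonempty (GerbeModel (SimpleMod.family V) R.1 G)) := fun R G =>
    ⟨fun h => (Quotient.exact h).elim fun e => ⟨(model R).ofGerbeIso e⟩,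
      fun ⟨m⟩ => Quotient.sound ((model R).nonempty_gerbeIso m)⟩
  let Φ : BandedExtensionClass Q S → SOneGerbeClass.{u} (ActionCategory Q (SimpleClass S)) :=
    Quotient.lift (fun R => Quotient.mk _ (Γ R)) fun R R' ⟨e⟩ =>
      (hΓ R (Γ R')).2 ⟨(model R').ofExtensionIso
        (Classical.choice ((bandedExtensionSetoid Q S).symm ⟨e⟩))⟩
  -- If the gerbes agree, `R` and `R'` both have models on the gerbe of `R'`, so uniqueness of the
  -- extension applies.
  have inj : Function.Injective Φ := fun a b => Quotient.inductionOn₂ a b fun R R' h =>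
    ((hΓ R (Γ R')).1 h).elim fun m => Quotient.sound (m.nonempty_extensionIso (model R'))
  have surj : Function.Surjective Φ := fun b => Quotient.inductionOn b fun G => by
    have := Fintype.ofFinite Q
    let m := convolutionModel (S := S) (SimpleMod.family V) G
    -- The preimage is the convolution algebra; its band comes from the evaluation isomorphisms of
    -- its model.
    exact ⟨Quotient.mk _ ⟨_, m.hasBand hV⟩, (hΓ ⟨_, m.hasBand hV⟩ G).2 ⟨m⟩⟩
  exact ⟨Equiv.ofBijective Φ ⟨inj, surj⟩, hΓ⟩

end

theorem theorem2 (Q S : Type u) [Group Q] [Finite Q] [Ring S] [Algebra ℂ S]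
    [Module.Finite ℂ S] [IsSemisimpleRing S] [MulAction Q (SimpleClass S)]
    (V : SimpleClass S → SimpleMod S) (hV : ∀ i, (V i).toClass = i) :
    ∃ Φ : BandedExtensionClass Q S ≃ SOneGerbeClass.{u} (ActionCategory Q (SimpleClass S)),
      ∀ (R : {R : QExtension Q S // R.HasBand})
        (G : SOneGerbe.{u} (ActionCategory Q (SimpleClass S))),
        (Φ (Quotient.mk _ R) = Quotient.mk _ G ↔ Nonempty (GerbeIdentification V R.1 G)) ∧
        (Φ (Quotient.mk _ R) = Quotient.mk _ G →
          ∃ e : FGModuleCat.{u} R.1.carrier ≌ G.TwistedRep,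
            e.functor.Additive ∧ e.functor.Linear ℂ) := by
  let : ∀ i, Module ℂ (V i).1 := fun i => Module.restrictScalars ℂ S (V i).1
  have : ∀ i, IsScalarTower ℂ S (V i).1 := fun i => IsScalarTower.restrictScalars ℂ S (V i).1
  have := finite_simpleClass (S := S)
  have hfam : IsSimpleFamily S (SimpleMod.family V) := isSimpleFamily_of_toClass V hV
  have : ∀ i, FiniteDimensional ℂ (SimpleMod.family V i) := hfam.finite
  obtain ⟨Φ, hΦ⟩ := exists_equiv_nonempty_gerbeModel (Q := Q) hV
  exact ⟨Φ, fun R G => ⟨(hΦ R G).trans (GerbeModel.nonempty_iff_nonempty_identification R G),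
    fun h => ((hΦ R G).1 h).elim fun m => m.exists_equivalence⟩⟩
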